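/- Let $\mathcal C$ be a fusion category over $\mathbb C$ (a finite $\mathbb C$-linear semisimple rigid monoidal category with simple unit object $\mathbf 1$). Let $\underline{\mathrm{Inv}}(\mathcal C)$ be the monoidal groupoid (categorical 1-group) of invertible objects of $\mathcal C$ and their isomorphisms, and $\underline{\mathrm{Eq}}(\mathcal C)$ that of ($\mathbb C$-linear) tensor auto-equivalences of $\mathcal C$ and monoidal natural isomorphisms, with composition as product. Let $\mathrm{BrPic}(\mathcal C)$ be the categorical 2-group of invertible (finite semisimple) $\mathcal C$-$\mathcal C$-bimodule categories, bimodule equivalences and bimodule natural isomorphisms, with product the relative tensor product $\boxtimes_{\mathcal C}$ and unit the regular bimodule category $\mathcal C$; let $\mathrm{Out}(\mathcal C)\subseteq \mathrm{BrPic}(\mathcal C)$ be the full categorical 2-subgroup on those bimodule categories which are equivalent to $\mathcal C$ as left module categories. For a categorical group, $\pi_0$ is the group of equivalence classes of objects; for a categorical 1-group, $\pi_1$ is the automorphism group of the unit object; for a categorical 2-group, $\pi_1$ is the group of isomorphism classes of auto-equivalences of the unit object, and $\pi_2$ is the group of automorphisms of the identity 1-morphism of the unit object. Let $F_-:\underline{\mathrm{Inv}}(\mathcal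 C)\to\underline{\mathrm{Eq}}(\mathcal C)$ be $F_g(X)=g\otimes X\otimes g^*$, $(F_\varphi)_X=\varphi\otimes X\otimes(\varphi^{-1})^*$. Let $M_-:\underline{\mathrm{Eq}}(\mathcal C)\to\mathrm{Out}(\mathcal C)$ send $F$ to $M_F$, the category $\mathcal C$ with actions $X\cdot m\cdot Y=X\otimes m\otimes F(Y)$, and send $\theta:F\cong G$ to the identity functor $M_F\to M_G$ with the bimodule structure given by $\theta$. Then all $M_F$ are objects of $\mathrm{Out}(\mathcal C)$; any two objects of $\mathrm{Out}(\mathcal C)$ have a relative tensor product in $\mathrm{Out}(\mathcal C)$, and this makes $\pi_0\mathrm{Out}(\mathcal C)$ a group; and there is an exact sequence of groups $$0\to\pi_2\mathrm{Out}(\mathcal C)\xrightarrow{\delta_2}\pi_1\underline{\mathrm{Inv}}(\mathcal C)\to\pi_1\underline{\mathrm{Eq}}(\mathcal C)\to\pi_1\mathrm{Out}(\mathcal C)\xrightarrow{\delta_1}\pi_0\underline{\mathrm{Inv}}(\mathcal C)\to\pi_0\underline{\mathrm{Eq}}(\mathcal C)\to\pi_0\mathrm{Out}(\mathcal C)\to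 0,$$ in which the unnamed maps are induced by $F_-$ and $M_-$, $\delta_2$ sends an automorphism $\eta$ of $\mathrm{id}_{\mathcal C}$ to its component $\eta_{\mathbf 1}$, and $\delta_1$ sends the class of a bimodule auto-equivalence $\phi$ of $\mathcal C$ to the class of the invertible object $\phi(\mathbf 1)$. Moreover there are group isomorphisms: * $\pi_2\mathrm{Out}(\mathcal C)\cong\pi_1\underline{\mathrm{Inv}}(\mathcal C)$, given by $\delta_2$, and $\pi_1\underline{\mathrm{Inv}}(\mathcal C)\cong\mathbb C^\times$, taking $c\cdot\mathrm{id}_{\mathbf 1}$ to $c$; * $\pi_1\underline{\mathrm{Eq}}(\mathcal C)\cong\mathrm{Aut}(\mathrm{id}_{\mathcal C})$, the group of monoidal automorphisms of the identity functor, and $\pi_1\underline{\mathrm{Eq}}(\mathcal C)\cong\mathrm{Hom}(U(\mathcal C),\mathbb C^\times)$, where $\theta$ corresponds to $\chi$ if $\theta_X=\chi([X])\,\mathrm{id}_X$ for all simple $X$. Here $U(\mathcal C)$ is the universal grading group: the group generated by the isomorphism classes $[X]$ of simple objects, with relations $[X][Y]=[Z]$ whenever $Z$ occurs in $X\otimes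 Y$; * $\pi_1\mathrm{Out}(\mathcal C)\cong\pi_1\mathrm{BrPic}(\mathcal C)$, induced by the inclusion, and $\pi_1\mathrm{Out}(\mathcal C)\cong\mathrm{Inv}(Z(\mathcal C))$, the group of isomorphism classes of invertible objects of the Drinfeld center, under which $\delta_1$ becomes the map induced by the forgetful functor $Z(\mathcal C)\to\mathcal C$; * $\pi_0\underline{\mathrm{Inv}}(\mathcal C)\cong\mathrm{Inv}(\mathcal C)$, the group of isomorphism classes of invertible objects of $\mathcal C$, by $[g]\mapsto[g]$; * $\pi_0\underline{\mathrm{Eq}}(\mathcal C)\cong\mathrm{Eq}(\mathcal C)$, the group of tensor auto-equivalences of $\mathcal C$ up to monoidal natural isomorphism, by $[F]\mapsto[F]$; * $\pi_0\mathrm{Out}(\mathcal C)\cong\mathrm{Out}(\mathcal C)$, the quotient of $\mathrm{Eq}(\mathcal C)$ by the normal subgroup formed by the classes of the $F_g$, taking $[M_F]$ to the class of $F$. -/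

import Mathlib

open CategoryTheory MonoidalCategory Limits

universe v u v₁ u₁

noncomputable section

namespace OuterSequence

/-! ### Finite semisimple linear categories and fusion categories -/

/-- A `ℂ`-linear functor. -/
class IsCLinear {A : Type u} [Category.{v} A] [Preadditive A] [Linear ℂ A]
    {B : Type u₁} [Category.{v₁} B] [Preadditive B] [Linear ℂ B] (F : A ⥤ B) : Prop
    extends F.Additive, F.Linear ℂ

attribute [local instance] Abelian.hasFiniteBiproducts

/-- A finite semisimple `ℂ`-linear abelian category: finite-dimensional morphism spaces, every
object is a finite direct sum of simple objects, finitely many simple objects up to isomorphism. -/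
class IsFiniteSemisimple (A : Type u) [Category.{v} A] [Abelian A] [Linear ℂ A] : Prop where
  finite_hom : ∀ X Y : A, Module.Finite ℂ (X ⟶ Y)
  semisimple : ∀ X : A, ∃ (n : ℕ) (S : Fin n → A), (∀ i, Simple (S i)) ∧ Nonempty (X ≅ ⨁ S)
  finite_simple : ∃ (n : ℕ) (S : Fin n → A), ∀ X : A, Simple X → ∃ i, Nonempty (X ≅ S i)

/-- A fusion category over `ℂ`: a finite `ℂ`-linear semisimple rigid monoidal category with
simple identity object. -/
class IsFusionCategory (C : Type u) [Category.{v} C] [Abelian C] [Linear ℂ C]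
    [MonoidalCategory C] [MonoidalPreadditive C] [MonoidalLinear ℂ C] [RigidCategory C] : Prop
    extends IsFiniteSemisimple C where
  simple_unit : Simple (𝟙_ C)

/-! ### Categorical 1-groups and their homotopy groups -/

section CatGroup

variable {D : Type u} [Category.{v} D] [MonoidalCategory D]

/-- The core of a monoidal category is monoidal. -/
instance coreMonoidalStruct : MonoidalCategoryStruct (Core D) where
  tensorObj X Y := ⟨X.of ⊗ Y.of⟩
  whiskerLeft X _ _ f := ⟨whiskerLeftIso X.of f.iso⟩
  whiskerRight f Y := ⟨whiskerRightIso f.iso Y.of⟩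
  tensorHom f g := ⟨f.iso ⊗ᵢ g.iso⟩
  tensorUnit := ⟨𝟙_ D⟩
  associator X Y Z := Core.isoMk (α_ X.of Y.of Z.of)
  leftUnitor X := Core.isoMk (λ_ X.of)
  rightUnitor X := Core.isoMk (ρ_ X.of)

instance coreMonoidal : MonoidalCategory (Core D) where
  tensorHom_def f g := Core.hom_ext (MonoidalCategory.tensorHom_def f.iso.hom g.iso.hom)
  id_tensorHom_id X Y := Core.hom_ext (MonoidalCategory.id_tensorHom_id X.of Y.of)
  tensorHom_comp_tensorHom f g h k := Core.hom_ext
    (MonoidalCategory.tensorHom_comp_tensorHom f.iso.hom g.iso.hom h.iso.hom k.iso.hom)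
  whiskerLeft_id X Y := Core.hom_ext (MonoidalCategory.whiskerLeft_id X.of Y.of)
  id_whiskerRight X Y := Core.hom_ext (MonoidalCategory.id_whiskerRight X.of Y.of)
  associator_naturality f g h := Core.hom_ext
    (MonoidalCategory.associator_naturality f.iso.hom g.iso.hom h.iso.hom)
  leftUnitor_naturality f := Core.hom_ext (MonoidalCategory.leftUnitor_naturality f.iso.hom)
  rightUnitor_naturality f := Core.hom_ext (MonoidalCategory.rightUnitor_naturality f.iso.hom)
  pentagon X Y Z W := Core.hom_ext (MonoidalCategory.pentagon X.of Y.of Z.of W.of)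
  triangle X Y := Core.hom_ext (MonoidalCategory.triangle X.of Y.of)

/-- An object of a monoidal category is invertible if it has a two-sided tensor inverse. -/
def IsInvertible : ObjectProperty D := fun X =>
  ∃ Y : D, Nonempty (X ⊗ Y ≅ 𝟙_ D) ∧ Nonempty (Y ⊗ X ≅ 𝟙_ D)

/-- A categorical 1-group: a monoidal groupoid all of whose objects are invertible. -/
class IsCatGroup (G : Type u) [Category.{v} G] [MonoidalCategory G] : Prop where
  isIso : ∀ {X Y : G} (f : X ⟶ Y), IsIso f
  isInvertible : ∀ X : G, IsInvertible X

/-- `π₀` of a categorical 1-group: isomorphism classes of objects, under tensor product. -/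
abbrev PiZero (G : Type u) [Category.{v} G] [MonoidalCategory G] := Skeleton G

instance piZeroGroup (G : Type u) [Category.{v} G] [MonoidalCategory G] [IsCatGroup G] :
    Group (PiZero G) :=
  groupOfIsUnit fun x => by
    obtain ⟨Y, ⟨e⟩, ⟨e'⟩⟩ := IsCatGroup.isInvertible x.out
    have hx : toSkeleton x.out = x := Quotient.out_eq x
    refine ⟨⟨x, toSkeleton Y, ?_, ?_⟩, rfl⟩
    · conv_lhs => rw [← hx]
      rw [← Skeleton.toSkeleton_tensorObj]
      exact Quotient.sound ⟨e⟩
    · conv_lhs => rw [← hx]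
      rw [← Skeleton.toSkeleton_tensorObj]
      exact Quotient.sound ⟨e'⟩

/-- `π₁` of a categorical 1-group: automorphisms of the unit object. -/
abbrev PiOne (G : Type u) [Category.{v} G] [MonoidalCategory G] := Aut (𝟙_ G)

/-- The tensor product of invertible objects, and the unit, are invertible. -/
instance isInvertible_isMonoidal :
    ObjectProperty.IsMonoidal (IsInvertible (D := D)) where
  prop_unit := ⟨𝟙_ D, ⟨λ_ _⟩, ⟨λ_ _⟩⟩
  prop_tensor X X' := by
    rintro ⟨Y, ⟨e⟩, ⟨f⟩⟩ ⟨Y', ⟨e'⟩, ⟨f'⟩⟩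
    refine ⟨Y' ⊗ Y, ⟨?_⟩, ⟨?_⟩⟩
    · exact α_ _ _ _ ≪≫ whiskerLeftIso X ((α_ _ _ _).symm ≪≫ whiskerRightIso e' Y ≪≫ λ_ _) ≪≫ e
    · exact α_ _ _ _ ≪≫ whiskerLeftIso Y' ((α_ _ _ _).symm ≪≫ whiskerRightIso f X' ≪≫ λ_ _) ≪≫ f'

variable (D) in
/-- The categorical 1-group of invertible objects of `D` and their isomorphisms. -/
abbrev InvCat := Core (ObjectProperty.FullSubcategory (IsInvertible (D := D)))

/-- The object of `D` underlying an object of `InvCat D`. -/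
abbrev InvCat.toObj (g : InvCat D) : D := g.of.obj

theorem InvCat.property (g : InvCat D) : IsInvertible g.toObj := g.of.property

/-- The isomorphism of `D` underlying a morphism of `InvCat D`. -/
def InvCat.iso {g h : InvCat D} (φ : g ⟶ h) : g.toObj ≅ h.toObj :=
  (ObjectProperty.ι _).mapIso φ.iso

/-- The core of a monoidal category in which all objects are invertible is a categorical
1-group. -/
theorem isCatGroup_core (h : ∀ X : D, IsInvertible X) : IsCatGroup (Core D) where
  isIso f := inferInstance
  isInvertible X := by
    obtain ⟨Y, ⟨e⟩, ⟨e'⟩⟩ := h X.of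
    exact ⟨⟨Y⟩, ⟨Core.isoMk e⟩, ⟨Core.isoMk e'⟩⟩

instance invCat_isCatGroup : IsCatGroup (InvCat D) :=
  isCatGroup_core fun X => by
    obtain ⟨Y, ⟨e⟩, ⟨e'⟩⟩ := X.property
    exact ⟨⟨Y, X.obj, ⟨e'⟩, ⟨e⟩⟩, ⟨ObjectProperty.isoMk _ e⟩, ⟨ObjectProperty.isoMk _ e'⟩⟩

variable (D) in
/-- The group of isomorphism classes of invertible objects of `D`: the units of the monoid of
isomorphism classes of objects. -/
abbrev InvGroup := (Skeleton D)ˣ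

end CatGroup

/-! ### Tensor auto-equivalences -/

section TensorEnd

variable (C : Type u) [Category.{v} C] [Preadditive C] [Linear ℂ C] [MonoidalCategory C]

/-- A (strong, `ℂ`-linear) tensor functor from `C` to itself. -/
structure TensorEnd where
  functor : C ⥤ C
  [monoidal : functor.Monoidal]
  [linear : IsCLinear functor]

attribute [instance] TensorEnd.monoidal TensorEnd.linear

variable {C}

namespace TensorEnd

/-- A monoidal natural transformation. -/
@[ext]
structure Hom (F G : TensorEnd C) where
  nat : F.functor ⟶ G.functor
  [isMonoidal : NatTrans.IsMonoidal nat]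

attribute [instance] Hom.isMonoidal

instance : Category (TensorEnd C) where
  Hom := Hom
  id F := ⟨𝟙 F.functor⟩
  comp f g := ⟨f.nat ≫ g.nat⟩

@[simp] theorem id_nat (F : TensorEnd C) : Hom.nat (𝟙 F) = 𝟙 F.functor := rfl

@[simp] theorem comp_nat {F G H : TensorEnd C} (f : F ⟶ G) (g : G ⟶ H) :
    (f ≫ g).nat = f.nat ≫ g.nat := rfl

@[ext] theorem hom_ext {F G : TensorEnd C} {f g : F ⟶ G} (h : ∀ X, f.nat.app X = g.nat.app X) :
    f = g :=
  Hom.ext (NatTrans.ext (funext h))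

/-- An isomorphism of tensor functors from a monoidal natural isomorphism. -/
def isoMk {F G : TensorEnd C} (e : F.functor ≅ G.functor) [NatTrans.IsMonoidal e.hom] : F ≅ G where
  hom := ⟨e.hom⟩
  inv := ⟨e.inv⟩

instance (A : Type u) [Category.{v} A] [Preadditive A] [Linear ℂ A] : IsCLinear (𝟭 A) where

instance {A₁ A₂ A₃ : Type*} [Category* A₁] [Category* A₂] [Category* A₃] [Preadditive A₁]
    [Preadditive A₂] [Preadditive A₃] [Linear ℂ A₁] [Linear ℂ A₂] [Linear ℂ A₃]
    (F : A₁ ⥤ A₂) (G : A₂ ⥤ A₃) [IsCLinear F] [IsCLinear G] : IsCLinear (F ⋙ G) where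

/-- The tensor product `F ⊗ G` is the composite `F ∘ G`. -/
instance : MonoidalCategoryStruct (TensorEnd C) where
  tensorObj F G := ⟨G.functor ⋙ F.functor⟩
  tensorUnit := ⟨𝟭 C⟩
  whiskerLeft F _ _ g := ⟨Functor.whiskerRight g.nat F.functor⟩
  whiskerRight f G := ⟨Functor.whiskerLeft G.functor f.nat⟩
  tensorHom f g := ⟨g.nat ◫ f.nat⟩
  associator F G H := (isoMk (Functor.associator H.functor G.functor F.functor)).symm
  leftUnitor F := isoMk F.functor.rightUnitor
  rightUnitor F := isoMk F.functor.leftUnitor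

instance : MonoidalCategory (TensorEnd C) where
  tensorHom_def f g := hom_ext fun _ => rfl
  id_tensorHom_id F G := hom_ext fun X => by
    change 𝟙 _ ≫ F.functor.map (𝟙 _) = 𝟙 _
    simp
  tensorHom_comp_tensorHom f g h k := hom_ext fun X =>
    (NatTrans.congr_app (NatTrans.exchange (I := _) g.nat k.nat f.nat h.nat) X).symm
  whiskerLeft_id F G := hom_ext fun X => F.functor.map_id _
  id_whiskerRight F G := hom_ext fun X => rfl
  associator_naturality f g h := hom_ext fun X => by
    have h₁ (F G H F' G' H' : TensorEnd C) (f : F ⟶ F') (g : G ⟶ G') (h : H ⟶ H') (X : C) :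
        (f.nat.app (G.functor.obj (H.functor.obj X)) ≫
          F'.functor.map (g.nat.app (H.functor.obj X))) ≫
            F'.functor.map (G'.functor.map (h.nat.app X)) =
        f.nat.app _ ≫ F'.functor.map (g.nat.app _ ≫ G'.functor.map (h.nat.app X)) := by
      simp
    exact (Category.comp_id _).trans ((h₁ _ _ _ _ _ _ f g h X).trans (Category.id_comp _).symm)
  leftUnitor_naturality f := hom_ext fun X => by
    change f.nat.app X ≫ 𝟙 _ = 𝟙 _ ≫ f.nat.app X
    simp
  rightUnitor_naturality f := hom_ext fun X => by
    change f.nat.app X ≫ 𝟙 _ = 𝟙 _ ≫ f.nat.app X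
    simp
  pentagon F G H K := hom_ext fun X => by
    change 𝟙 _ ≫ 𝟙 _ ≫ F.functor.map (𝟙 _) = 𝟙 _ ≫ 𝟙 _
    simp
  triangle F G := hom_ext fun X => by
    change 𝟙 _ ≫ F.functor.map (𝟙 _) = 𝟙 _
    simp

/-- The auto-equivalences among the tensor endofunctors. -/
def IsAutoEquiv : ObjectProperty (TensorEnd C) := fun F => F.functor.IsEquivalence

instance : ObjectProperty.IsMonoidal (IsAutoEquiv : ObjectProperty (TensorEnd C)) where
  prop_unit := inferInstanceAs (𝟭 C).IsEquivalence
  prop_tensor F G hF hG := by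
    have : F.functor.IsEquivalence := hF
    have : G.functor.IsEquivalence := hG
    exact inferInstanceAs (G.functor ⋙ F.functor).IsEquivalence

/-- A monoidal linear auto-equivalence has a tensor inverse. -/
theorem exists_inverse_aux (e : C ≌ C) [e.functor.Monoidal] [e.inverse.Monoidal] [e.IsMonoidal]
    [IsCLinear e.functor] [IsCLinear e.inverse] :
    ∃ G : TensorEnd C, IsAutoEquiv G ∧ Nonempty (⟨e.functor⟩ ⊗ G ≅ 𝟙_ (TensorEnd C)) ∧
      Nonempty (G ⊗ ⟨e.functor⟩ ≅ 𝟙_ (TensorEnd C)) := by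
  refine ⟨⟨e.inverse⟩, inferInstanceAs e.inverse.IsEquivalence, ⟨?_⟩, ⟨?_⟩⟩
  · have : NatTrans.IsMonoidal e.counitIso.hom := inferInstanceAs (NatTrans.IsMonoidal e.counit)
    exact isoMk e.counitIso
  · have : NatTrans.IsMonoidal e.unitIso.hom := inferInstanceAs (NatTrans.IsMonoidal e.unit)
    exact (isoMk e.unitIso).symm

theorem exists_inverse (e : C ≌ C) [e.functor.Monoidal]
    [IsCLinear e.functor] [IsCLinear e.inverse] :
    ∃ G : TensorEnd C, IsAutoEquiv G ∧ Nonempty (⟨e.functor⟩ ⊗ G ≅ 𝟙_ (TensorEnd C)) ∧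
      Nonempty (G ⊗ ⟨e.functor⟩ ≅ 𝟙_ (TensorEnd C)) :=
  have h : @Adjunction.IsMonoidal _ _ _ _ _ _ _ _ e.toAdjunction _
      e.toAdjunction.rightAdjointLaxMonoidal := inferInstance
  @exists_inverse_aux _ _ _ _ _ e _ e.inverseMonoidal h _ _

theorem isInvertible_of_isAutoEquiv {F : TensorEnd C} (hF : IsAutoEquiv F) :
    ∃ G : TensorEnd C, IsAutoEquiv G ∧ Nonempty (F ⊗ G ≅ 𝟙_ _) ∧ Nonempty (G ⊗ F ≅ 𝟙_ _) := by
  have : F.functor.IsEquivalence := hF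
  let _ : F.functor.asEquivalence.functor.Monoidal := F.monoidal
  have : IsCLinear F.functor.asEquivalence.functor := F.linear
  have : IsCLinear F.functor.asEquivalence.inverse :=
    { toAdditive := F.functor.asEquivalence.inverse_additive
      toLinear := inferInstance }
  exact exists_inverse F.functor.asEquivalence

end TensorEnd

variable (C)

/-- The categorical 1-group of tensor auto-equivalences of `C` and monoidal natural isomorphisms,
with composition as its product. -/
abbrev EqCat :=
  Core (ObjectProperty.FullSubcategory (TensorEnd.IsAutoEquiv : ObjectProperty (TensorEnd C)))

instance eqCat_isCatGroup : IsCatGroup (EqCat C) :=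
  isCatGroup_core fun F => by
    obtain ⟨G, hG, ⟨e⟩, ⟨e'⟩⟩ := TensorEnd.isInvertible_of_isAutoEquiv F.property
    exact ⟨⟨G, hG⟩, ⟨ObjectProperty.isoMk _ e⟩, ⟨ObjectProperty.isoMk _ e'⟩⟩

variable {C}

/-- The tensor functor underlying an object of `EqCat C`. -/
abbrev EqCat.tensorEnd (F : EqCat C) : TensorEnd C := F.of.obj

/-- The monoidal natural isomorphism underlying a morphism of `EqCat C`. -/
def EqCat.iso {F G : EqCat C} (θ : F ⟶ G) : F.tensorEnd ≅ G.tensorEnd :=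
  (TensorEnd.IsAutoEquiv (C := C)).ι.mapIso θ.iso

variable (C) in
/-- The group of tensor auto-equivalences of `C` up to monoidal natural isomorphism: the units of
the monoid of isomorphism classes of tensor endofunctors under composition. -/
abbrev EqGroup := (Skeleton (TensorEnd C))ˣ

end TensorEnd

/-! ### Conjugation by invertible objects -/

section Conj

variable {C : Type u} [Category.{v} C] [MonoidalCategory C]

theorem IsInvertible.tensorLeft {g : C} (hg : IsInvertible g) :
    (tensorLeft g).IsEquivalence := by
  obtain ⟨h, ⟨e⟩, ⟨e'⟩⟩ := hg
  exact (CategoryTheory.Equivalence.mk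
    (MonoidalCategory.tensorLeft g) (MonoidalCategory.tensorLeft h)
    ((leftUnitorNatIso C).symm ≪≫ (curriedTensor C).mapIso e'.symm ≪≫ tensorLeftTensor h g)
    ((tensorLeftTensor g h).symm ≪≫ (curriedTensor C).mapIso e ≪≫
      leftUnitorNatIso C)).isEquivalence_functor

theorem IsInvertible.tensorRight {g : C} (hg : IsInvertible g) :
    (tensorRight g).IsEquivalence := by
  obtain ⟨h, ⟨e⟩, ⟨e'⟩⟩ := hg
  exact (CategoryTheory.Equivalence.mk
    (MonoidalCategory.tensorRight g) (MonoidalCategory.tensorRight h)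
    ((rightUnitorNatIso C).symm ≪≫ (curriedTensor C).flip.mapIso e.symm ≪≫ tensorRightTensor g h)
    ((tensorRightTensor h g).symm ≪≫ (curriedTensor C).flip.mapIso e' ≪≫
      rightUnitorNatIso C)).isEquivalence_functor

theorem isIso_coevaluation {g : C} [HasRightDual g] (hg : IsInvertible g) :
    IsIso (η_ g gᘁ) := by
  have := hg.tensorLeft
  have h : IsIso ((tensorLeftAdjunction g gᘁ).unit.app (𝟙_ C)) := inferInstance
  have h' : (tensorLeftAdjunction g gᘁ).unit.app (𝟙_ C) =
      (λ_ _).inv ≫ η_ g gᘁ ▷ 𝟙_ C ≫ (α_ _ _ _).hom := by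
    simp [tensorLeftAdjunction, tensorLeftHomEquiv]
  rw [h'] at h
  have h₁ := IsIso.of_isIso_comp_left (λ_ (𝟙_ C)).inv (η_ g gᘁ ▷ 𝟙_ C ≫ (α_ _ _ _).hom)
  have h₂ := IsIso.of_isIso_comp_right (η_ g gᘁ ▷ 𝟙_ C) (α_ _ _ _).hom
  exact (NatIso.isIso_map_iff (rightUnitorNatIso C) (η_ g gᘁ)).1 h₂

theorem isIso_evaluation {g : C} [HasRightDual g] (hg : IsInvertible g) :
    IsIso (ε_ g gᘁ) := by
  have := hg.tensorLeft
  have h : IsIso ((tensorLeftAdjunction g gᘁ).counit.app (𝟙_ C)) := inferInstance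
  have h' : (tensorLeftAdjunction g gᘁ).counit.app (𝟙_ C) =
      (α_ _ _ _).inv ≫ ε_ g gᘁ ▷ 𝟙_ C ≫ (λ_ _).hom := by
    simp [tensorLeftAdjunction, tensorLeftHomEquiv]
  rw [h'] at h
  have h₁ := IsIso.of_isIso_comp_left (α_ _ _ _).inv (ε_ g gᘁ ▷ 𝟙_ C ≫ (λ_ _).hom)
  have h₂ := IsIso.of_isIso_comp_right (ε_ g gᘁ ▷ 𝟙_ C) (λ_ _).hom
  exact (NatIso.isIso_map_iff (rightUnitorNatIso C) (ε_ g gᘁ)).1 h₂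

theorem isInvertible_rightDual {g : C} [HasRightDual g] (hg : IsInvertible g) :
    IsInvertible (gᘁ) :=
  have := isIso_coevaluation hg
  have := isIso_evaluation hg
  ⟨g, ⟨asIso (ε_ g gᘁ)⟩, ⟨(asIso (η_ g gᘁ)).symm⟩⟩

/-- The functor `X ↦ g ⊗ X ⊗ g*`. -/
def conjFunctorObj (g : C) [HasRightDual g] : C ⥤ C where
  obj X := g ⊗ (X ⊗ gᘁ)
  map f := g ◁ (f ▷ gᘁ)

/-- The map `F_g(X) ⊗ F_g(Y) ⟶ F_g(X ⊗ Y)` given by the evaluation `g* ⊗ g ⟶ 𝟙`. -/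
def conjMu (g : C) [HasRightDual g] (X Y : C) :
    (g ⊗ (X ⊗ gᘁ)) ⊗ (g ⊗ (Y ⊗ gᘁ)) ⟶ g ⊗ ((X ⊗ Y) ⊗ gᘁ) :=
  𝟙 _ ⊗≫ (g ⊗ X) ◁ (ε_ g gᘁ ▷ (Y ⊗ gᘁ)) ⊗≫ 𝟙 _

/-- The map `𝟙 ⟶ F_g(𝟙)` given by the coevaluation `𝟙 ⟶ g ⊗ g*`. -/
def conjEps (g : C) [HasRightDual g] : 𝟙_ C ⟶ g ⊗ (𝟙_ C ⊗ gᘁ) :=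
  η_ g gᘁ ≫ g ◁ (λ_ gᘁ).inv

theorem conjMu_isIso {g : C} [HasRightDual g] (hg : IsInvertible g) (X Y : C) :
    IsIso (conjMu g X Y) := by
  have := isIso_evaluation hg
  unfold conjMu
  simp only [monoidalComp]
  infer_instance

theorem conjEps_isIso {g : C} [HasRightDual g] (hg : IsInvertible g) : IsIso (conjEps g) := by
  have := isIso_coevaluation hg
  unfold conjEps
  infer_instance

theorem conjMu_natural_left (g : C) [HasRightDual g] {X Y : C} (f : X ⟶ Y) (X' : C) :
    (g ◁ (f ▷ gᘁ)) ▷ (g ⊗ (X' ⊗ gᘁ)) ≫ conjMu g Y X' = conjMu g X X' ≫ g ◁ ((f ▷ X') ▷ gᘁ) := by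
  unfold conjMu
  calc _ = 𝟙 _ ⊗≫ g ◁ (f ▷ (gᘁ ⊗ g) ≫ Y ◁ ε_ g gᘁ) ▷ (X' ⊗ gᘁ) ⊗≫ 𝟙 _ := by monoidal
    _ = _ := by rw [← whisker_exchange]; monoidal

theorem conjMu_natural_right (g : C) [HasRightDual g] (X' : C) {X Y : C} (f : X ⟶ Y) :
    (g ⊗ (X' ⊗ gᘁ)) ◁ (g ◁ (f ▷ gᘁ)) ≫ conjMu g X' Y = conjMu g X' X ≫ g ◁ ((X' ◁ f) ▷ gᘁ) := by
  unfold conjMu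
  calc _ = 𝟙 _ ⊗≫ (g ⊗ X') ◁ ((gᘁ ⊗ g) ◁ f ≫ ε_ g gᘁ ▷ Y) ▷ gᘁ ⊗≫ 𝟙 _ := by monoidal
    _ = _ := by rw [whisker_exchange]; monoidal

theorem conjMu_assoc (g : C) [HasRightDual g] (X Y Z : C) :
    conjMu g X Y ▷ (g ⊗ (Z ⊗ gᘁ)) ≫ conjMu g (X ⊗ Y) Z ≫ g ◁ ((α_ X Y Z).hom ▷ gᘁ) =
      (α_ _ _ _).hom ≫ (g ⊗ (X ⊗ gᘁ)) ◁ conjMu g Y Z ≫ conjMu g X (Y ⊗ Z) := by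
  unfold conjMu
  calc _ = 𝟙 _ ⊗≫ (g ⊗ X) ◁ (ε_ g gᘁ ▷ (Y ⊗ (gᘁ ⊗ g)) ≫ 𝟙_ C ◁ (Y ◁ ε_ g gᘁ)) ▷ (Z ⊗ gᘁ)
        ⊗≫ 𝟙 _ := by monoidal
    _ = _ := by rw [← whisker_exchange]; monoidal

theorem conj_left_unitality (g : C) [HasRightDual g] (X : C) :
    (λ_ (g ⊗ (X ⊗ gᘁ))).hom =
      conjEps g ▷ (g ⊗ (X ⊗ gᘁ)) ≫ conjMu g (𝟙_ C) X ≫ g ◁ ((λ_ X).hom ▷ gᘁ) := by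
  unfold conjMu conjEps
  symm
  calc _ = 𝟙 _ ⊗≫ (η_ g gᘁ ▷ g ⊗≫ g ◁ ε_ g gᘁ) ▷ (X ⊗ gᘁ) ⊗≫ 𝟙 _ := by monoidal
    _ = _ := by rw [ExactPairing.evaluation_coevaluation'']; monoidal

theorem conj_right_unitality (g : C) [HasRightDual g] (X : C) :
    (ρ_ (g ⊗ (X ⊗ gᘁ))).hom =
      (g ⊗ (X ⊗ gᘁ)) ◁ conjEps g ≫ conjMu g X (𝟙_ C) ≫ g ◁ ((ρ_ X).hom ▷ gᘁ) := by
  unfold conjMu conjEps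
  symm
  calc _ = 𝟙 _ ⊗≫ (g ⊗ X) ◁ (gᘁ ◁ η_ g gᘁ ⊗≫ ε_ g gᘁ ▷ gᘁ) ⊗≫ 𝟙 _ := by monoidal
    _ = _ := by rw [ExactPairing.coevaluation_evaluation'']; monoidal

/-- For invertible `g`, the functor `X ↦ g ⊗ X ⊗ g*` is monoidal. -/
@[reducible] def conjMonoidal {g : C} [HasRightDual g] (hg : IsInvertible g) :
    (conjFunctorObj g).Monoidal :=
  Functor.CoreMonoidal.toMonoidal
    { εIso := @asIso _ _ _ _ (conjEps g) (conjEps_isIso hg)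
      μIso := fun X Y => @asIso _ _ _ _ (conjMu g X Y) (conjMu_isIso hg X Y)
      μIso_hom_natural_left := conjMu_natural_left g
      μIso_hom_natural_right := fun X' f => conjMu_natural_right g X' f
      associativity := conjMu_assoc g
      left_unitality := conj_left_unitality g
      right_unitality := conj_right_unitality g }

/-- A morphism `φ : g ⟶ h` and a morphism `ψ : g* ⟶ h*` act on conjugates. -/
def conjMap {g h : C} [HasRightDual g] [HasRightDual h] (φ : g ⟶ h) (ψ : gᘁ ⟶ hᘁ) :
    conjFunctorObj g ⟶ conjFunctorObj h where
  app X := φ ⊗ₘ (X ◁ ψ)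
  naturality X Y f := by
    change g ◁ (f ▷ gᘁ) ≫ (φ ⊗ₘ (Y ◁ ψ)) = (φ ⊗ₘ (X ◁ ψ)) ≫ h ◁ (f ▷ hᘁ)
    simp only [MonoidalCategory.tensorHom_def, Category.assoc]
    rw [whisker_exchange_assoc, ← MonoidalCategory.whiskerLeft_comp,
      ← MonoidalCategory.whiskerLeft_comp, whisker_exchange]

theorem conjMap_isMonoidal {g h : C} [HasRightDual g] [HasRightDual h] (hg : IsInvertible g)
    (hh : IsInvertible h) (φ : g ≅ h) :
    letI := conjMonoidal hg
    letI := conjMonoidal hh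
    NatTrans.IsMonoidal (conjMap φ.hom (φ.invᘁ)) := by
  refine @NatTrans.IsMonoidal.mk _ _ _ _ _ _ _ _ _ (conjMonoidal hg).toLaxMonoidal
    (conjMonoidal hh).toLaxMonoidal ?_ fun X Y => ?_
  · change conjEps g ≫ (φ.hom ⊗ₘ (𝟙_ C ◁ (φ.invᘁ))) = conjEps h
    have h₁ : φ.homᘁ ≫ φ.invᘁ = 𝟙 _ := by
      rw [← comp_rightAdjointMate, φ.inv_hom_id, rightAdjointMate_id]
    calc conjEps g ≫ (φ.hom ⊗ₘ (𝟙_ C ◁ (φ.invᘁ)))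
        = (η_ g gᘁ ≫ φ.hom ▷ gᘁ) ⊗≫ h ◁ φ.invᘁ ⊗≫ 𝟙 _ := by
          simp only [conjEps, MonoidalCategory.tensorHom_def]; monoidal
      _ = η_ h hᘁ ⊗≫ h ◁ (φ.homᘁ ≫ φ.invᘁ) ⊗≫ 𝟙 _ := by
        rw [← coevaluation_comp_rightAdjointMate]; monoidal
      _ = conjEps h := by rw [h₁]; unfold conjEps; monoidal
  · change conjMu g X Y ≫ (φ.hom ⊗ₘ ((X ⊗ Y) ◁ (φ.invᘁ))) =
      ((φ.hom ⊗ₘ (X ◁ (φ.invᘁ))) ⊗ₘ (φ.hom ⊗ₘ (Y ◁ (φ.invᘁ)))) ≫ conjMu h X Y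
    have h₁ : φ.invᘁ ≫ φ.homᘁ = 𝟙 _ := by
      rw [← comp_rightAdjointMate, φ.hom_inv_id, rightAdjointMate_id]
    have h₂ : φ.invᘁ ▷ g ≫ hᘁ ◁ φ.hom ≫ ε_ h hᘁ = ε_ g gᘁ := by
      rw [← rightAdjointMate_comp_evaluation, ← comp_whiskerRight_assoc, h₁]
      simp
    symm
    calc ((φ.hom ⊗ₘ (X ◁ (φ.invᘁ))) ⊗ₘ (φ.hom ⊗ₘ (Y ◁ (φ.invᘁ)))) ≫ conjMu h X Y
        = 𝟙 _ ⊗≫ φ.hom ▷ (X ⊗ gᘁ ⊗ g ⊗ Y ⊗ gᘁ) ⊗≫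
            (h ⊗ X) ◁ (φ.invᘁ ▷ g ≫ hᘁ ◁ φ.hom) ▷ (Y ⊗ gᘁ) ⊗≫
            (h ⊗ X) ◁ ((hᘁ ⊗ h) ◁ (Y ◁ φ.invᘁ) ≫ ε_ h hᘁ ▷ (Y ⊗ hᘁ)) ⊗≫ 𝟙 _ := by
          simp only [conjMu, MonoidalCategory.tensorHom_def]; monoidal
      _ = 𝟙 _ ⊗≫ φ.hom ▷ (X ⊗ gᘁ ⊗ g ⊗ Y ⊗ gᘁ) ⊗≫
            (h ⊗ X) ◁ (φ.invᘁ ▷ g ≫ hᘁ ◁ φ.hom ≫ ε_ h hᘁ) ▷ (Y ⊗ gᘁ) ⊗≫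
            (h ⊗ X ⊗ Y) ◁ φ.invᘁ ⊗≫ 𝟙 _ := by
          rw [whisker_exchange]; monoidal
      _ = 𝟙 _ ⊗≫ (φ.hom ▷ (X ⊗ (gᘁ ⊗ g) ⊗ Y ⊗ gᘁ) ≫
            h ◁ (X ◁ ε_ g gᘁ ▷ (Y ⊗ gᘁ))) ⊗≫ (h ⊗ X ⊗ Y) ◁ φ.invᘁ ⊗≫ 𝟙 _ := by
          rw [h₂]; monoidal
      _ = conjMu g X Y ≫ (φ.hom ⊗ₘ ((X ⊗ Y) ◁ (φ.invᘁ))) := by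
          rw [← whisker_exchange]; simp only [conjMu, MonoidalCategory.tensorHom_def]; monoidal

theorem conj_isEquivalence {g : C} [HasRightDual g] (hg : IsInvertible g) :
    (conjFunctorObj g).IsEquivalence := by
  have := hg.tensorLeft
  have := (isInvertible_rightDual hg).tensorRight
  exact inferInstanceAs (tensorRight gᘁ ⋙ tensorLeft g).IsEquivalence

instance conj_isCLinear [Preadditive C] [Linear ℂ C] [MonoidalPreadditive C] [MonoidalLinear ℂ C]
    (g : C) [HasRightDual g] : IsCLinear (conjFunctorObj g) where
  map_add := by intros; simp [conjFunctorObj]; rfl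
  map_smul := by intros; simp [conjFunctorObj]; rfl

theorem conjMap_comp {g h k : C} [HasRightDual g] [HasRightDual h] [HasRightDual k]
    (φ : g ⟶ h) (φ' : h ⟶ k) (ψ : gᘁ ⟶ hᘁ) (ψ' : hᘁ ⟶ kᘁ) (X : C) :
    (conjMap φ ψ).app X ≫ (conjMap φ' ψ').app X = (conjMap (φ ≫ φ') (ψ ≫ ψ')).app X := by
  change (φ ⊗ₘ X ◁ ψ) ≫ (φ' ⊗ₘ X ◁ ψ') = φ ≫ φ' ⊗ₘ X ◁ (ψ ≫ ψ')
  rw [MonoidalCategory.tensorHom_comp_tensorHom, MonoidalCategory.whiskerLeft_comp]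

theorem conjMap_id (g : C) [HasRightDual g] (X : C) : (conjMap (𝟙 g) (𝟙 gᘁ)).app X = 𝟙 _ := by
  simp [conjMap, conjFunctorObj]

variable (C)
variable [Preadditive C] [Linear ℂ C] [MonoidalPreadditive C] [MonoidalLinear ℂ C]
  [RigidCategory C]

variable {C} in
/-- The tensor functor `F_g : X ↦ g ⊗ X ⊗ g*`. -/
def conjTensorEnd {g : C} (hg : IsInvertible g) : TensorEnd C :=
  @TensorEnd.mk C _ _ _ _ (conjFunctorObj g) (conjMonoidal hg) inferInstance

variable {C} in
/-- The monoidal natural isomorphism `F_g ≅ F_h` with components `φ ⊗ X ⊗ (φ⁻¹)*`. -/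
def conjIso {g h : C} (hg : IsInvertible g) (hh : IsInvertible h) (φ : g ≅ h) :
    conjTensorEnd hg ≅ conjTensorEnd hh where
  hom := @TensorEnd.Hom.mk _ _ _ _ _ (conjTensorEnd hg) (conjTensorEnd hh)
    (conjMap φ.hom (φ.invᘁ)) (conjMap_isMonoidal hg hh φ)
  inv := @TensorEnd.Hom.mk _ _ _ _ _ (conjTensorEnd hh) (conjTensorEnd hg)
    (conjMap φ.inv (φ.homᘁ)) (conjMap_isMonoidal hh hg φ.symm)
  hom_inv_id := TensorEnd.hom_ext fun X => by
    refine (conjMap_comp _ _ _ _ X).trans ?_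
    rw [← comp_rightAdjointMate, Iso.hom_inv_id, rightAdjointMate_id]
    exact conjMap_id g X
  inv_hom_id := TensorEnd.hom_ext fun X => by
    refine (conjMap_comp _ _ _ _ X).trans ?_
    rw [← comp_rightAdjointMate, Iso.inv_hom_id, rightAdjointMate_id]
    exact conjMap_id h X

/-- The functor `F_-` from invertible objects to tensor auto-equivalences: `g` is sent to
`F_g : X ↦ g ⊗ X ⊗ g*`, and `φ : g ≅ h` to the natural isomorphism with components
`φ ⊗ X ⊗ (φ⁻¹)*`. -/
def conj : InvCat C ⥤ EqCat C where
  obj g := ⟨⟨conjTensorEnd g.property, conj_isEquivalence g.property⟩⟩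
  map {g h} φ := ⟨ObjectProperty.isoMk _ (conjIso g.property h.property
    (InvCat.iso φ))⟩
  map_id g := Core.hom_ext <| ObjectProperty.hom_ext _ <| TensorEnd.hom_ext fun X => by
    change (conjMap (𝟙 g.toObj) ((𝟙 g.toObj)ᘁ)).app X = 𝟙 _
    rw [rightAdjointMate_id, conjMap_id]
  map_comp {g h k} φ ψ := Core.hom_ext <| ObjectProperty.hom_ext _ <| TensorEnd.hom_ext fun X => by
    change (conjMap ((InvCat.iso φ).hom ≫ (InvCat.iso ψ).hom)
        (((InvCat.iso ψ).inv ≫ (InvCat.iso φ).inv)ᘁ)).app X =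
      (conjMap (InvCat.iso φ).hom ((InvCat.iso φ).invᘁ)).app X ≫
        (conjMap (InvCat.iso ψ).hom ((InvCat.iso ψ).invᘁ)).app X
    rw [comp_rightAdjointMate, conjMap_comp]

end Conj

/-! ### Bimodule categories -/

section Bimodule

open scoped MonoidalLeftAction MonoidalRightAction
open Functor.LaxLeftLinear Functor.LaxRightLinear Functor.OplaxLeftLinear Functor.OplaxRightLinear

variable (C : Type u) [Category.{v} C] [Abelian C] [Linear ℂ C] [MonoidalCategory C]

/-- A (finite semisimple) `C`-`C`-bimodule category: a finite semisimple `ℂ`-linear abelian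
category with bilinear left and right actions of `C` (with coherent associativity and unit
isomorphisms), and coherent middle associativity isomorphisms `(X ⊙ m) ⊙ Y ≅ X ⊙ (m ⊙ Y)`. -/
structure Bimod where
  carrier : Type u
  [category : Category.{v} carrier]
  [abelian : Abelian carrier]
  [linear : Linear ℂ carrier]
  [finiteSemisimple : IsFiniteSemisimple carrier]
  [leftAction : MonoidalLeftAction C carrier]
  [rightAction : MonoidalRightAction C carrier]
  left_linear_obj : ∀ X : C, IsCLinear ((MonoidalLeftAction.curriedAction C carrier).obj X)
  left_linear_flip : ∀ m : carrier,
    IsCLinear ((MonoidalLeftAction.curriedAction C carrier).flip.obj m)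
  right_linear_obj : ∀ Y : C, IsCLinear ((MonoidalRightAction.curriedAction C carrier).obj Y)
  right_linear_flip : ∀ m : carrier,
    IsCLinear ((MonoidalRightAction.curriedAction C carrier).flip.obj m)
  mid : ∀ (X : C) (m : carrier) (Y : C), (X ⊙ₗ m) ⊙ᵣ Y ≅ X ⊙ₗ (m ⊙ᵣ Y)
  mid_naturality_left : ∀ {X X' : C} (f : X ⟶ X') (m : carrier) (Y : C),
    (f ⊵ₗ m) ⊵ᵣ Y ≫ (mid X' m Y).hom = (mid X m Y).hom ≫ f ⊵ₗ (m ⊙ᵣ Y)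
  mid_naturality_mid : ∀ (X : C) {m m' : carrier} (h : m ⟶ m') (Y : C),
    (X ⊴ₗ h) ⊵ᵣ Y ≫ (mid X m' Y).hom = (mid X m Y).hom ≫ X ⊴ₗ (h ⊵ᵣ Y)
  mid_naturality_right : ∀ (X : C) (m : carrier) {Y Y' : C} (k : Y ⟶ Y'),
    (X ⊙ₗ m) ⊴ᵣ k ≫ (mid X m Y').hom = (mid X m Y).hom ≫ X ⊴ₗ (m ⊴ᵣ k)
  left_pentagon : ∀ (X X' : C) (m : carrier) (Y : C),
    (αₗ X X' m).hom ⊵ᵣ Y ≫ (mid X (X' ⊙ₗ m) Y).hom ≫ X ⊴ₗ (mid X' m Y).hom =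
      (mid (X ⊗ X') m Y).hom ≫ (αₗ X X' (m ⊙ᵣ Y)).hom
  right_pentagon : ∀ (X : C) (m : carrier) (Y Y' : C),
    (αᵣ (X ⊙ₗ m) Y Y').hom ≫ (mid X m Y).hom ⊵ᵣ Y' ≫ (mid X (m ⊙ᵣ Y) Y').hom =
      (mid X m (Y ⊗ Y')).hom ≫ X ⊴ₗ (αᵣ m Y Y').hom
  left_triangle : ∀ (m : carrier) (Y : C),
    (λₗ[C] m).hom ⊵ᵣ Y = (mid (𝟙_ C) m Y).hom ≫ (λₗ (m ⊙ᵣ Y)).hom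
  right_triangle : ∀ (X : C) (m : carrier),
    (ρᵣ (X ⊙ₗ m)).hom = (mid X m (𝟙_ C)).hom ≫ X ⊴ₗ (ρᵣ m).hom

attribute [instance] Bimod.category Bimod.abelian Bimod.linear Bimod.finiteSemisimple
  Bimod.leftAction Bimod.rightAction

variable {C}

namespace Bimod

/-- A bimodule functor: a `ℂ`-linear functor with natural isomorphisms `X ⊙ F m ≅ F (X ⊙ m)` and
`F m ⊙ Y ≅ F (m ⊙ Y)`, coherent with all structure isomorphisms. -/
structure Hom (M N : Bimod C) where
  functor : M.carrier ⥤ N.carrier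
  [linear : IsCLinear functor]
  [left : functor.LeftLinear C]
  [right : functor.RightLinear C]
  compat : ∀ (X : C) (m : M.carrier) (Y : C),
    μₗ functor X m ⊵ᵣ Y ≫ μᵣ functor (X ⊙ₗ m) Y ≫ functor.map (M.mid X m Y).hom =
      (N.mid X (functor.obj m) Y).hom ≫ X ⊴ₗ μᵣ functor m Y ≫ μₗ functor X (m ⊙ᵣ Y)

attribute [instance] Hom.linear Hom.left Hom.right

/-- A natural transformation of bimodule functors. -/
@[ext]
structure Hom₂ {M N : Bimod C} (F G : Hom M N) where
  nat : F.functor ⟶ G.functor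
  left : ∀ (X : C) (m : M.carrier),
    μₗ F.functor X m ≫ nat.app (X ⊙ₗ m) = X ⊴ₗ nat.app m ≫ μₗ G.functor X m := by cat_disch
  right : ∀ (m : M.carrier) (Y : C),
    μᵣ F.functor m Y ≫ nat.app (m ⊙ᵣ Y) = nat.app m ⊵ᵣ Y ≫ μᵣ G.functor m Y := by cat_disch


instance (M N : Bimod C) : Category (Hom M N) where
  Hom := Hom₂
  id F := { nat := 𝟙 F.functor }
  comp f g :=
    { nat := f.nat ≫ g.nat
      left := fun X m => by
        rw [NatTrans.comp_app, ← Category.assoc, f.left, Category.assoc, g.left]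
        simp
      right := fun m Y => by
        rw [NatTrans.comp_app, ← Category.assoc, f.right, Category.assoc, g.right]
        simp }

@[simp] theorem id_nat {M N : Bimod C} (F : Hom M N) : Hom₂.nat (𝟙 F) = 𝟙 F.functor := rfl

@[simp] theorem comp_nat {M N : Bimod C} {F G H : Hom M N} (f : F ⟶ G) (g : G ⟶ H) :
    (f ≫ g).nat = f.nat ≫ g.nat := rfl

@[ext] theorem hom₂_ext {M N : Bimod C} {F G : Hom M N} {f g : F ⟶ G}
    (h : ∀ m, f.nat.app m = g.nat.app m) : f = g :=
  Hom₂.ext (NatTrans.ext (funext h))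

section comp

variable {A₁ A₂ A₃ : Type u} [Category.{v} A₁] [Category.{v} A₂] [Category.{v} A₃]

instance leftLinearId [MonoidalLeftAction C A₁] : (𝟭 A₁).LeftLinear C where
  μₗ _ _ := 𝟙 _
  δₗ _ _ := 𝟙 _
  μₗ_comp_δₗ _ _ := Category.id_comp _
  δₗ_comp_μₗ _ _ := Category.id_comp _

instance rightLinearId [MonoidalRightAction C A₁] : (𝟭 A₁).RightLinear C where
  μᵣ _ _ := 𝟙 _
  δᵣ _ _ := 𝟙 _
  μᵣ_comp_δᵣ _ _ := Category.id_comp _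
  δᵣ_comp_μᵣ _ _ := Category.id_comp _

instance leftLinearComp [MonoidalLeftAction C A₁] [MonoidalLeftAction C A₂]
    [MonoidalLeftAction C A₃] (F : A₁ ⥤ A₂) (G : A₂ ⥤ A₃) [F.LeftLinear C] [G.LeftLinear C] :
    (F ⋙ G).LeftLinear C where
  μₗ X m := μₗ G X (F.obj m) ≫ G.map (μₗ F X m)
  δₗ X m := G.map (δₗ F X m) ≫ δₗ G X (F.obj m)
  μₗ_naturality_left f m := by
    simp [← Functor.map_comp, -Functor.LeftLinear.inv_δₗ]
  μₗ_naturality_right X _ _ f := by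
    simp [← Functor.map_comp]
  μₗ_associativity X X' m := by
    simp only [Functor.comp_map, Functor.comp_obj, Category.assoc, ← Functor.map_comp,
      μₗ_associativity]
    simp
  δₗ_naturality_left f m := by
    simp [← Functor.map_comp_assoc]
  δₗ_naturality_right X _ _ f := by
    simp [← Functor.map_comp_assoc]
  δₗ_associativity X X' m := by
    simp only [Functor.comp_map, Functor.comp_obj, Category.assoc, δₗ_associativity,
      ← Functor.map_comp_assoc]
    simp
  μₗ_comp_δₗ X m := by simp [← Functor.map_comp_assoc]
  δₗ_comp_μₗ X m := by simp [← Functor.map_comp]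

instance rightLinearComp [MonoidalRightAction C A₁] [MonoidalRightAction C A₂]
    [MonoidalRightAction C A₃] (F : A₁ ⥤ A₂) (G : A₂ ⥤ A₃) [F.RightLinear C] [G.RightLinear C] :
    (F ⋙ G).RightLinear C where
  μᵣ m Y := μᵣ G (F.obj m) Y ≫ G.map (μᵣ F m Y)
  δᵣ m Y := G.map (δᵣ F m Y) ≫ δᵣ G (F.obj m) Y
  μᵣ_naturality_left f m := by
    simp [← Functor.map_comp]
  μᵣ_naturality_right X _ _ f := by
    simp [← Functor.map_comp]
  μᵣ_associativity m Y Y' := by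
    simp only [Functor.comp_map, Functor.comp_obj, Category.assoc, ← Functor.map_comp,
      μᵣ_associativity]
    simp
  δᵣ_naturality_left f m := by
    simp [← Functor.map_comp_assoc]
  δᵣ_naturality_right X _ _ f := by
    simp [← Functor.map_comp_assoc]
  δᵣ_associativity m Y Y' := by
    simp only [Functor.comp_map, Functor.comp_obj, Category.assoc, δᵣ_associativity,
      ← Functor.map_comp_assoc]
    simp
  μᵣ_comp_δᵣ m Y := by simp [← Functor.map_comp_assoc]
  δᵣ_comp_μᵣ m Y := by simp [← Functor.map_comp]

@[simp] theorem id_μₗ [MonoidalLeftAction C A₁] (X : C) (m : A₁) : μₗ (𝟭 A₁) X m = 𝟙 _ := rfl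

@[simp] theorem id_μᵣ [MonoidalRightAction C A₁] (m : A₁) (Y : C) : μᵣ (𝟭 A₁) m Y = 𝟙 _ := rfl

@[simp] theorem comp_μₗ [MonoidalLeftAction C A₁] [MonoidalLeftAction C A₂]
    [MonoidalLeftAction C A₃] (F : A₁ ⥤ A₂) (G : A₂ ⥤ A₃) [F.LeftLinear C] [G.LeftLinear C]
    (X : C) (m : A₁) : μₗ (F ⋙ G) X m = μₗ G X (F.obj m) ≫ G.map (μₗ F X m) := rfl

@[simp] theorem comp_μᵣ [MonoidalRightAction C A₁] [MonoidalRightAction C A₂]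
    [MonoidalRightAction C A₃] (F : A₁ ⥤ A₂) (G : A₂ ⥤ A₃) [F.RightLinear C] [G.RightLinear C]
    (m : A₁) (Y : C) : μᵣ (F ⋙ G) m Y = μᵣ G (F.obj m) Y ≫ G.map (μᵣ F m Y) := rfl

end comp

/-- The identity bimodule functor. -/
def idHom (M : Bimod C) : Hom M M where
  functor := 𝟭 M.carrier
  linear := {}
  compat X m Y := by
    simp

/-- The composition of bimodule functors. -/
def compHom {M N P : Bimod C} (F : Hom M N) (G : Hom N P) : Hom M P where
  functor := F.functor ⋙ G.functor
  linear := {}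
  compat X m Y := by
    have hF := congrArg G.functor.map (F.compat X m Y)
    have hG := G.compat X (F.functor.obj m) Y
    simp only [Functor.map_comp] at hF
    simp only [comp_μₗ, comp_μᵣ, Functor.comp_obj, Functor.comp_map,
      MonoidalRightAction.comp_actionHomLeft, MonoidalLeftAction.actionHomRight_comp,
      Category.assoc]
    rw [μᵣ_naturality_left_assoc, hF, reassoc_of% hG, μₗ_naturality_right_assoc]

/-- An isomorphism of bimodule functors from a natural isomorphism. -/
def isoMk {M N : Bimod C} {F G : Hom M N} (e : F.functor ≅ G.functor)
    (hl : ∀ (X : C) (m : M.carrier),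
      μₗ F.functor X m ≫ e.hom.app (X ⊙ₗ m) = X ⊴ₗ e.hom.app m ≫ μₗ G.functor X m)
    (hr : ∀ (m : M.carrier) (Y : C),
      μᵣ F.functor m Y ≫ e.hom.app (m ⊙ᵣ Y) = e.hom.app m ⊵ᵣ Y ≫ μᵣ G.functor m Y) : F ≅ G where
  hom := { nat := e.hom, left := hl, right := hr }
  inv :=
    { nat := e.inv
      left := fun X m => by
        rw [← cancel_mono (e.hom.app _), Category.assoc, Category.assoc, hl]
        simp [← MonoidalLeftAction.actionHomRight_comp_assoc]
      right := fun m Y => by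
        rw [← cancel_mono (e.hom.app _), Category.assoc, Category.assoc, hr]
        simp [← MonoidalRightAction.comp_actionHomLeft_assoc] }

/-- Left whiskering. -/
def whiskerLeftHom {M N P : Bimod C} (F : Hom M N) {G H : Hom N P} (η : G ⟶ H) :
    compHom F G ⟶ compHom F H where
  nat := Functor.whiskerLeft F.functor η.nat
  left X m := by
    change (_ ≫ G.functor.map _) ≫ η.nat.app _ = X ⊴ₗ η.nat.app (F.functor.obj m) ≫ _ ≫
      H.functor.map _
    rw [Category.assoc, η.nat.naturality, ← Category.assoc, η.left, Category.assoc]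
  right m Y := by
    change (_ ≫ G.functor.map _) ≫ η.nat.app _ = η.nat.app (F.functor.obj m) ⊵ᵣ Y ≫ _ ≫
      H.functor.map _
    rw [Category.assoc, η.nat.naturality, ← Category.assoc, η.right, Category.assoc]

/-- Right whiskering. -/
def whiskerRightHom {M N P : Bimod C} {F G : Hom M N} (η : F ⟶ G) (H : Hom N P) :
    compHom F H ⟶ compHom G H where
  nat := Functor.whiskerRight η.nat H.functor
  left X m := by
    change (_ ≫ H.functor.map _) ≫ H.functor.map _ = X ⊴ₗ H.functor.map (η.nat.app m) ≫ _ ≫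
      H.functor.map _
    rw [Category.assoc, ← H.functor.map_comp, η.left, H.functor.map_comp,
      μₗ_naturality_right_assoc]
  right m Y := by
    change (_ ≫ H.functor.map _) ≫ H.functor.map _ = H.functor.map (η.nat.app m) ⊵ᵣ Y ≫ _ ≫
      H.functor.map _
    rw [Category.assoc, ← H.functor.map_comp, η.right, H.functor.map_comp,
      μᵣ_naturality_left_assoc]

instance : CategoryStruct (Bimod C) where
  Hom := Hom
  id := idHom
  comp F G := compHom F G

instance homCat (M N : Bimod C) : Category (M ⟶ N) := inferInstanceAs (Category (Hom M N))

/-- The 2-category of `C`-`C`-bimodule categories, bimodule functors and bimodule natural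
transformations. -/
instance : Bicategory (Bimod C) where
  homCategory M N := homCat M N
  whiskerLeft F _ _ η := whiskerLeftHom F η
  whiskerRight η H := whiskerRightHom η H
  associator F G H := isoMk (Functor.associator F.functor G.functor H.functor)
    (fun X m => by
      change (μₗ H.functor X (G.functor.obj (F.functor.obj m)) ≫ H.functor.map
        (μₗ G.functor X (F.functor.obj m) ≫ G.functor.map (μₗ F.functor X m))) ≫ 𝟙 _ =
        X ⊴ₗ 𝟙 (H.functor.obj (G.functor.obj (F.functor.obj m))) ≫
          (μₗ H.functor X (G.functor.obj (F.functor.obj m)) ≫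
          H.functor.map (μₗ G.functor X (F.functor.obj m))) ≫
            H.functor.map (G.functor.map (μₗ F.functor X m))
      simp)
    (fun m Y => by
      change (μᵣ H.functor (G.functor.obj (F.functor.obj m)) Y ≫ H.functor.map
        (μᵣ G.functor (F.functor.obj m) Y ≫ G.functor.map (μᵣ F.functor m Y))) ≫ 𝟙 _ =
        𝟙 (H.functor.obj (G.functor.obj (F.functor.obj m))) ⊵ᵣ Y ≫
          (μᵣ H.functor (G.functor.obj (F.functor.obj m)) Y ≫
          H.functor.map (μᵣ G.functor (F.functor.obj m) Y)) ≫
            H.functor.map (G.functor.map (μᵣ F.functor m Y))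
      simp)
  leftUnitor F := isoMk F.functor.leftUnitor
    (fun X m => by
      change (μₗ F.functor X m ≫ F.functor.map (𝟙 _)) ≫ 𝟙 _ =
        X ⊴ₗ 𝟙 (F.functor.obj m) ≫ μₗ F.functor X m
      simp)
    (fun m Y => by
      change (μᵣ F.functor m Y ≫ F.functor.map (𝟙 _)) ≫ 𝟙 _ =
        𝟙 (F.functor.obj m) ⊵ᵣ Y ≫ μᵣ F.functor m Y
      simp)
  rightUnitor F := isoMk F.functor.rightUnitor
    (fun X m => by
      change (𝟙 _ ≫ μₗ F.functor X m) ≫ 𝟙 _ = X ⊴ₗ 𝟙 (F.functor.obj m) ≫ μₗ F.functor X m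
      simp)
    (fun m Y => by
      change (𝟙 _ ≫ μᵣ F.functor m Y) ≫ 𝟙 _ = 𝟙 (F.functor.obj m) ⊵ᵣ Y ≫ μᵣ F.functor m Y
      simp)
  whiskerLeft_id F G := hom₂_ext fun m => rfl
  whiskerLeft_comp F _ _ _ η θ := hom₂_ext fun m => rfl
  id_whiskerLeft η := hom₂_ext fun m => by
    change η.nat.app m = 𝟙 _ ≫ η.nat.app m ≫ 𝟙 _
    simp
  comp_whiskerLeft F G H H' η := hom₂_ext fun m => by
    change η.nat.app _ = 𝟙 _ ≫ η.nat.app _ ≫ 𝟙 _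
    simp
  id_whiskerRight F G := hom₂_ext fun m => G.functor.map_id _
  comp_whiskerRight η θ G := hom₂_ext fun m => G.functor.map_comp _ _
  whiskerRight_id η := hom₂_ext fun m => by
    change η.nat.app m = 𝟙 _ ≫ η.nat.app m ≫ 𝟙 _
    simp
  whiskerRight_comp η G H := hom₂_ext fun m => by
    change H.functor.map _ = 𝟙 _ ≫ H.functor.map (G.functor.map (η.nat.app m)) ≫ 𝟙 _
    simp
  whisker_assoc F G G' η H := hom₂_ext fun m => by
    change H.functor.map _ = 𝟙 _ ≫ H.functor.map (η.nat.app _) ≫ 𝟙 _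
    simp; rfl
  whisker_exchange {M N P F G H K} η θ := hom₂_ext fun m => by
    exact (θ.nat.naturality (η.nat.app m)).symm
  pentagon F G H K := hom₂_ext fun m => by
    change K.functor.map (𝟙 _) ≫ 𝟙 _ ≫ 𝟙 _ = 𝟙 _ ≫ 𝟙 _
    simp
  triangle F G := hom₂_ext fun m => by
    change 𝟙 _ ≫ 𝟙 _ = G.functor.map (𝟙 _)
    simp

end Bimod
end Bimodule

/-! ### The bimodule categories `M_F` -/

section Twist

open scoped MonoidalLeftAction MonoidalRightAction
open Functor.LaxMonoidal Functor.OplaxMonoidal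

variable {C : Type u} [Category.{v} C] [Abelian C] [Linear ℂ C] [MonoidalCategory C]

/-- The right action `m ⊙ Y = m ⊗ F(Y)` of `C` on itself. -/
@[reducible] def twistRightAction (F : TensorEnd C) : MonoidalRightAction C C where
  actionObj m Y := m ⊗ F.functor.obj Y
  actionHomRight m _ _ f := m ◁ F.functor.map f
  actionHomLeft f Y := f ▷ F.functor.obj Y
  actionAssocIso m Y Y' :=
    whiskerLeftIso m (Functor.Monoidal.μIso F.functor Y Y').symm ≪≫ (α_ _ _ _).symm
  actionUnitIso m := whiskerLeftIso m (Functor.Monoidal.εIso F.functor).symm ≪≫ ρ_ m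
  actionHomRight_id c d := by simp
  id_actionHomLeft c d := by simp
  actionHom_comp f₁ f₂ g₁ g₂ := by
    simp only [Functor.map_comp, MonoidalCategory.whiskerLeft_comp, comp_whiskerRight,
      Category.assoc]
    rw [whisker_exchange_assoc]
  actionAssocIso_hom_naturality f g h := by
    simp only [MonoidalCategory.tensorHom_def, Functor.map_comp,
      MonoidalCategory.whiskerLeft_comp, Category.assoc, Iso.trans_hom, whiskerLeftIso_hom,
      Iso.symm_hom, Functor.Monoidal.μIso_inv, comp_whiskerRight]
    rw [← MonoidalCategory.whiskerLeft_comp_assoc _ (F.functor.map (_ ◁ h)), ← δ_natural_right,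
      MonoidalCategory.whiskerLeft_comp_assoc,
      ← MonoidalCategory.whiskerLeft_comp_assoc _ (F.functor.map (g ▷ _)), ← δ_natural_left,
      MonoidalCategory.whiskerLeft_comp_assoc, ← whisker_exchange_assoc]
    simp
  actionUnitIso_hom_naturality f := by
    simp [← whisker_exchange_assoc]
  actionHomRight_whiskerRight f c d := by
    simp
    rw [Functor.Monoidal.map_whiskerRight]
    simp only [MonoidalCategory.whiskerLeft_comp]
  whiskerRight_actionHomLeft c _ _ f d := by
    simp
    rw [Functor.Monoidal.map_whiskerLeft]
    simp only [MonoidalCategory.whiskerLeft_comp]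
  actionHom_associator c₁ c₂ c₃ d := by
    have h := congrArg (d ◁ ·) (Functor.OplaxMonoidal.associativity F.functor c₁ c₂ c₃)
    simp only [MonoidalCategory.whiskerLeft_comp] at h
    simp only [Iso.trans_hom, whiskerLeftIso_hom, Iso.symm_hom, Functor.Monoidal.μIso_inv,
      Category.assoc, comp_whiskerRight]
    have e : (α_ d (F.functor.obj c₁) (F.functor.obj (c₂ ⊗ c₃))).inv ≫
        (d ⊗ F.functor.obj c₁) ◁ δ F.functor c₂ c₃ =
          d ◁ F.functor.obj c₁ ◁ δ F.functor c₂ c₃ ≫ (α_ _ _ _).inv := by simp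
    rw [reassoc_of% e, ← reassoc_of% h]
    simp
  actionHom_leftUnitor c d := by
    simp [-Functor.LaxMonoidal.left_unitality]
    rw [Functor.Monoidal.map_leftUnitor]
    simp only [MonoidalCategory.whiskerLeft_comp]
  actionHom_rightUnitor c d := by
    change d ◁ F.functor.map (ρ_ c).hom = (d ◁ δ F.functor c (𝟙_ C) ≫ (α_ _ _ _).inv) ≫
      (d ⊗ F.functor.obj c) ◁ η F.functor ≫ (ρ_ (d ⊗ F.functor.obj c)).hom
    rw [Functor.Monoidal.map_rightUnitor, Category.assoc, ← associator_inv_naturality_right_assoc,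
      ← MonoidalCategory.whiskerLeft_rightUnitor, MonoidalCategory.whiskerLeft_comp,
      MonoidalCategory.whiskerLeft_comp]

theorem TensorEnd.Hom.delta {F G : TensorEnd C} (τ : F ⟶ G) (X Y : C) :
    τ.nat.app (X ⊗ Y) ≫ δ G.functor X Y =
      δ F.functor X Y ≫ τ.nat.app X ▷ F.functor.obj Y ≫ G.functor.obj X ◁ τ.nat.app Y := by
  rw [← cancel_mono (μ G.functor X Y), ← cancel_epi (μ F.functor X Y)]
  have h := NatTrans.IsMonoidal.tensor (τ := τ.nat) X Y
  simp only [MonoidalCategory.tensorHom_def, Category.assoc] at h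
  simp [h]

theorem TensorEnd.Hom.eta {F G : TensorEnd C} (τ : F ⟶ G) :
    τ.nat.app (𝟙_ C) ≫ η G.functor = η F.functor := by
  rw [← cancel_epi (ε F.functor)]
  have h := NatTrans.IsMonoidal.unit (τ := τ.nat)
  simp [reassoc_of% h]

theorem TensorEnd.hom_inv_app {F G : TensorEnd C} (θ : F ≅ G) (X : C) :
    θ.hom.nat.app X ≫ θ.inv.nat.app X = 𝟙 _ := by
  rw [← NatTrans.comp_app, ← TensorEnd.comp_nat, θ.hom_inv_id]
  rfl

variable [MonoidalPreadditive C] [MonoidalLinear ℂ C]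

instance tensorLeft_isCLinear (X : C) : IsCLinear (tensorLeft X) where

instance tensorRight_isCLinear (X : C) : IsCLinear (tensorRight X) where

/-- The bimodule category `M_F`: the category `C` with `X ⊙ m = X ⊗ m` and `m ⊙ Y = m ⊗ F(Y)`. -/
def twist [IsFiniteSemisimple C] (F : TensorEnd C) : Bimod C where
  carrier := C
  leftAction := selfLeftAction C
  rightAction := twistRightAction F
  left_linear_obj X := inferInstanceAs (IsCLinear (tensorLeft X))
  left_linear_flip m := inferInstanceAs (IsCLinear (tensorRight m))
  right_linear_obj Y := inferInstanceAs (IsCLinear (tensorRight (F.functor.obj Y)))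
  right_linear_flip m := inferInstanceAs (IsCLinear (F.functor ⋙ tensorLeft m))
  mid X m Y := α_ X m (F.functor.obj Y)
  mid_naturality_left f m Y := associator_naturality_left f m _
  mid_naturality_mid X _ _ h Y := associator_naturality_middle X h _
  mid_naturality_right X m _ _ k := associator_naturality_right X m _
  left_pentagon X X' m Y := MonoidalCategory.pentagon X X' m _
  right_pentagon X m Y Y' := by
    change ((X ⊗ m) ◁ δ F.functor Y Y' ≫ (α_ _ _ _).inv) ≫ (α_ _ _ _).hom ▷ F.functor.obj Y' ≫
      (α_ _ _ _).hom = (α_ _ _ _).hom ≫ X ◁ (m ◁ δ F.functor Y Y' ≫ (α_ _ _ _).inv)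
    simp
  left_triangle m Y := MonoidalCategory.leftUnitor_whiskerRight m _
  right_triangle X m := by
    change (X ⊗ m) ◁ η F.functor ≫ (ρ_ (X ⊗ m)).hom =
      (α_ _ _ _).hom ≫ X ◁ (m ◁ η F.functor ≫ (ρ_ m).hom)
    simp

variable [IsFiniteSemisimple C]

variable (C) in
/-- The regular bimodule category `C`. -/
abbrev regular : Bimod C := twist (𝟙_ (TensorEnd C))

/-- The identity functor of `C`, as a functor `M_F ⥤ M_G`. -/
def twistId (F G : TensorEnd C) : (twist F).carrier ⥤ (twist G).carrier := 𝟭 C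

/-- The right module structure on the identity functor `M_F ⟶ M_G` given by `θ : F ≅ G`. -/
@[reducible] def twistHomRight {F G : TensorEnd C} (θ : F ≅ G) :
    (twistId F G).RightLinear C :=
  { μᵣ := fun (m Y : C) => m ◁ θ.inv.nat.app Y
    δᵣ := fun (m Y : C) => m ◁ θ.hom.nat.app Y
    μᵣ_naturality_right := fun (d : C) _ _ f => by
      change d ◁ G.functor.map f ≫ d ◁ _ = d ◁ _ ≫ d ◁ F.functor.map f
      rw [← MonoidalCategory.whiskerLeft_comp, ← MonoidalCategory.whiskerLeft_comp,
        θ.inv.nat.naturality]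
    μᵣ_naturality_left := fun f c => by
      exact (@whisker_exchange C _ _ _ _ _ _ f (θ.inv.nat.app c)).symm
    μᵣ_associativity := fun (d : C) c c' => by
      change d ◁ θ.inv.nat.app _ ≫ d ◁ δ F.functor c c' ≫ (α_ _ _ _).inv =
        (d ◁ δ G.functor c c' ≫ (α_ _ _ _).inv) ≫ (d ◁ θ.inv.nat.app c) ▷ _ ≫
          (d ⊗ _) ◁ θ.inv.nat.app c'
      rw [← MonoidalCategory.whiskerLeft_comp_assoc, TensorEnd.Hom.delta]
      simp
    μᵣ_unitality := fun (d : C) => by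
      change d ◁ η G.functor ≫ (ρ_ d).hom = d ◁ θ.inv.nat.app _ ≫ d ◁ η F.functor ≫ (ρ_ d).hom
      rw [← MonoidalCategory.whiskerLeft_comp_assoc, TensorEnd.Hom.eta]
    δᵣ_naturality_right := fun (d : C) _ _ f => by
      change d ◁ F.functor.map f ≫ d ◁ _ = d ◁ _ ≫ d ◁ G.functor.map f
      rw [← MonoidalCategory.whiskerLeft_comp, ← MonoidalCategory.whiskerLeft_comp,
        θ.hom.nat.naturality]
    δᵣ_naturality_left := fun f c => by
      exact (@whisker_exchange C _ _ _ _ _ _ f (θ.hom.nat.app c)).symm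
    δᵣ_associativity := fun (d : C) c c' => by
      change d ◁ θ.hom.nat.app _ ≫ d ◁ δ G.functor c c' ≫ (α_ _ _ _).inv =
        (d ◁ δ F.functor c c' ≫ (α_ _ _ _).inv) ≫ (d ⊗ F.functor.obj c) ◁ θ.hom.nat.app c' ≫
          (d ◁ θ.hom.nat.app c) ▷ G.functor.obj c'
      rw [← MonoidalCategory.whiskerLeft_comp_assoc, TensorEnd.Hom.delta, ← whisker_exchange]
      simp
    δᵣ_unitality_inv := fun (d : C) => by
      change (ρ_ d).inv ≫ d ◁ ε G.functor =
        ((ρ_ d).inv ≫ d ◁ ε F.functor) ≫ d ◁ θ.hom.nat.app (𝟙_ C)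
      rw [Category.assoc, ← MonoidalCategory.whiskerLeft_comp,
        NatTrans.IsMonoidal.unit (τ := θ.hom.nat)]
    μᵣ_comp_δᵣ := fun (d : C) c => by
      change d ◁ θ.inv.nat.app c ≫ d ◁ θ.hom.nat.app c = 𝟙 (d ⊗ _)
      rw [← MonoidalCategory.whiskerLeft_comp]
      exact (congrArg (d ◁ ·) (TensorEnd.hom_inv_app θ.symm c)).trans
        (MonoidalCategory.whiskerLeft_id _ _)
    δᵣ_comp_μᵣ := fun (d : C) c => by
      change d ◁ θ.hom.nat.app c ≫ d ◁ θ.inv.nat.app c = 𝟙 (d ⊗ _)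
      rw [← MonoidalCategory.whiskerLeft_comp]
      exact (congrArg (d ◁ ·) (TensorEnd.hom_inv_app θ c)).trans
        (MonoidalCategory.whiskerLeft_id _ _) }

/-- The bimodule equivalence `M_θ : M_F ⟶ M_G`: the identity functor of `C` with the identity left
module structure and the right module structure given by `θ`. -/
def twistHom {F G : TensorEnd C} (θ : F ≅ G) : twist F ⟶ twist G :=
  { functor := twistId F G
    linear := inferInstanceAs (IsCLinear (𝟭 C))
    left := (Bimod.leftLinearId : (𝟭 C).LeftLinear C)
    right := twistHomRight θ
    compat := fun X (m : C) Y => by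
      change 𝟙 (X ⊗ m) ▷ G.functor.obj Y ≫ (X ⊗ m) ◁ θ.inv.nat.app Y ≫ (α_ X m _).hom =
        (α_ X m _).hom ≫ X ◁ m ◁ θ.inv.nat.app Y ≫ 𝟙 _
      simp : Bimod.Hom (twist F) (twist G) }

end Twist

/-! ### Relative tensor products of bimodule categories -/

section RelTensor

open scoped MonoidalLeftAction MonoidalRightAction

variable {C : Type u} [Category.{v} C] [Abelian C] [Linear ℂ C] [MonoidalCategory C]

/-- A `C`-balanced functor `M × N ⥤ A` to a `ℂ`-linear abelian category: a bilinear bifunctor `B`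
with natural isomorphisms `B (m ⊙ X, n) ≅ B (m, X ⊙ n)` coherent with associativity and unit.
(Since `M` and `N` are semisimple, `B` is automatically exact in each variable.) -/
structure BalancedFunctor (M N : Bimod C) (A : Type u) [Category.{v} A] [Abelian A]
    [Linear ℂ A] where
  functor : M.carrier ⥤ N.carrier ⥤ A
  linear_obj : ∀ m, IsCLinear (functor.obj m)
  linear_flip : ∀ n, IsCLinear (functor.flip.obj n)
  balance : ∀ (m : M.carrier) (X : C) (n : N.carrier),
    (functor.obj (m ⊙ᵣ X)).obj n ≅ (functor.obj m).obj (X ⊙ₗ n)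
  naturality_left : ∀ {m m' : M.carrier} (f : m ⟶ m') (X : C) (n : N.carrier),
    (functor.map (f ⊵ᵣ X)).app n ≫ (balance m' X n).hom =
      (balance m X n).hom ≫ (functor.map f).app (X ⊙ₗ n)
  naturality_mid : ∀ (m : M.carrier) {X X' : C} (f : X ⟶ X') (n : N.carrier),
    (functor.map (m ⊴ᵣ f)).app n ≫ (balance m X' n).hom =
      (balance m X n).hom ≫ (functor.obj m).map (f ⊵ₗ n)
  naturality_right : ∀ (m : M.carrier) (X : C) {n n' : N.carrier} (f : n ⟶ n'),
    (functor.obj (m ⊙ᵣ X)).map f ≫ (balance m X n').hom =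
      (balance m X n).hom ≫ (functor.obj m).map (X ⊴ₗ f)
  pentagon : ∀ (m : M.carrier) (X Y : C) (n : N.carrier),
    (functor.map (αᵣ m X Y).hom).app n ≫ (balance (m ⊙ᵣ X) Y n).hom ≫
        (balance m X (Y ⊙ₗ n)).hom =
      (balance m (X ⊗ Y) n).hom ≫ (functor.obj m).map (αₗ X Y n).hom
  triangle : ∀ (m : M.carrier) (n : N.carrier),
    (functor.map (ρᵣ m).hom).app n =
      (balance m (𝟙_ C) n).hom ≫ (functor.obj m).map (λₗ n).hom

namespace BalancedFunctor

variable {M N : Bimod C} {A : Type u} [Category.{v} A] [Abelian A] [Linear ℂ A]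

/-- A balanced natural transformation. -/
@[ext]
structure Hom (B B' : BalancedFunctor M N A) where
  nat : B.functor ⟶ B'.functor
  balance : ∀ (m : M.carrier) (X : C) (n : N.carrier),
    (nat.app (m ⊙ᵣ X)).app n ≫ (B'.balance m X n).hom =
      (B.balance m X n).hom ≫ (nat.app m).app (X ⊙ₗ n)

instance : Category (BalancedFunctor M N A) where
  Hom := Hom
  id B := { nat := 𝟙 _, balance := by simp }
  comp f g :=
    { nat := f.nat ≫ g.nat
      balance := fun m X n => by
        simp only [NatTrans.comp_app, Category.assoc]
        rw [g.balance, ← Category.assoc, f.balance, Category.assoc] }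

variable (A) in
/-- The category of `ℂ`-linear functors. -/
abbrev LinFunctor (A' : Type u) [Category.{v} A'] [Abelian A'] [Linear ℂ A'] :=
  ObjectProperty.FullSubcategory (fun G : A ⥤ A' => IsCLinear G)

/-- Composing a balanced functor with a linear functor. -/
def postcompObj (B : BalancedFunctor M N A) {A' : Type u} [Category.{v} A'] [Abelian A']
    [Linear ℂ A'] (G : A ⥤ A') [IsCLinear G] : BalancedFunctor M N A' where
  functor := B.functor ⋙ (Functor.whiskeringRight N.carrier A A').obj G
  linear_obj m :=
    have := B.linear_obj m
    inferInstanceAs (IsCLinear (B.functor.obj m ⋙ G))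
  linear_flip n :=
    have := B.linear_flip n
    inferInstanceAs (IsCLinear (B.functor.flip.obj n ⋙ G))
  balance m X n := G.mapIso (B.balance m X n)
  naturality_left f X n := by simp [← Functor.map_comp, B.naturality_left]
  naturality_mid m _ _ f n := by simp [← Functor.map_comp, B.naturality_mid]
  naturality_right m X _ _ f := by simp [← Functor.map_comp, B.naturality_right]
  pentagon m X Y n := by simp [← Functor.map_comp, B.pentagon]
  triangle m n := by simp [← Functor.map_comp, B.triangle]

/-- Composition with a balanced functor `B`, from linear functors to balanced functors. -/
def postcomp (B : BalancedFunctor M N A) (A' : Type u) [Category.{v} A'] [Abelian A']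
    [Linear ℂ A'] : LinFunctor A A' ⥤ BalancedFunctor M N A' where
  obj G := @postcompObj _ _ _ _ _ _ _ _ _ _ _ B _ _ _ _ G.obj G.property
  map {G G'} τ :=
    { nat := Functor.whiskerLeft B.functor ((Functor.whiskeringRight N.carrier A A').map τ.hom)
      balance := fun m X n => (τ.hom.naturality (B.balance m X n).hom).symm }

/-- A balanced functor is universal if every balanced functor factors through it by a linear
functor, uniquely in the 2-categorical sense. -/
def IsUniversal (B : BalancedFunctor M N A) : Prop :=
  ∀ (A' : Type u) [Category.{v} A'] [Abelian A'] [Linear ℂ A'], (B.postcomp A').IsEquivalence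

end BalancedFunctor

/-- A balanced functor `M × N ⥤ P` of `C`-`C`-bimodule categories: a balanced functor which
is a functor of left module categories in the first variable and of right module categories in
the second variable, with compatible structures. -/
structure BalancedBimodFunctor (M N P : Bimod C) extends BalancedFunctor M N P.carrier where
  left : ∀ (X : C) (m : M.carrier) (n : N.carrier),
    X ⊙ₗ (functor.obj m).obj n ≅ (functor.obj (X ⊙ₗ m)).obj n
  right : ∀ (m : M.carrier) (n : N.carrier) (Y : C),
    (functor.obj m).obj n ⊙ᵣ Y ≅ (functor.obj m).obj (n ⊙ᵣ Y)
  left_naturality : ∀ {X X' : C} (f : X ⟶ X') {m m' : M.carrier} (g : m ⟶ m')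
      {n n' : N.carrier} (h : n ⟶ n'),
    (f ⊙ₗₘ ((functor.map g).app n ≫ (functor.obj m').map h)) ≫ (left X' m' n').hom =
      (left X m n).hom ≫ (functor.map (f ⊙ₗₘ g)).app n ≫ (functor.obj (X' ⊙ₗ m')).map h
  right_naturality : ∀ {m m' : M.carrier} (g : m ⟶ m') {n n' : N.carrier} (h : n ⟶ n')
      {Y Y' : C} (k : Y ⟶ Y'),
    (((functor.map g).app n ≫ (functor.obj m').map h) ⊙ᵣₘ k) ≫ (right m' n' Y').hom =
      (right m n Y).hom ≫ (functor.map g).app (n ⊙ᵣ Y) ≫ (functor.obj m').map (h ⊙ᵣₘ k)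
  left_assoc : ∀ (X X' : C) (m : M.carrier) (n : N.carrier),
    (left (X ⊗ X') m n).hom ≫ (functor.map (αₗ X X' m).hom).app n =
      (αₗ X X' ((functor.obj m).obj n)).hom ≫ X ⊴ₗ (left X' m n).hom ≫
        (left X (X' ⊙ₗ m) n).hom
  left_unit : ∀ (m : M.carrier) (n : N.carrier),
    (λₗ ((functor.obj m).obj n)).hom =
      (left (𝟙_ C) m n).hom ≫ (functor.map (λₗ m).hom).app n
  right_assoc : ∀ (m : M.carrier) (n : N.carrier) (Y Y' : C),
    (right m n (Y ⊗ Y')).hom ≫ (functor.obj m).map (αᵣ n Y Y').hom =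
      (αᵣ ((functor.obj m).obj n) Y Y').hom ≫ (right m n Y).hom ⊵ᵣ Y' ≫
        (right m (n ⊙ᵣ Y) Y').hom
  right_unit : ∀ (m : M.carrier) (n : N.carrier),
    (ρᵣ ((functor.obj m).obj n)).hom =
      (right m n (𝟙_ C)).hom ≫ (functor.obj m).map (ρᵣ n).hom
  left_balance : ∀ (X : C) (m : M.carrier) (Y : C) (n : N.carrier),
    X ⊴ₗ (balance m Y n).hom ≫ (left X m (Y ⊙ₗ n)).hom =
      (left X (m ⊙ᵣ Y) n).hom ≫ (functor.map (M.mid X m Y).inv).app n ≫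
        (balance (X ⊙ₗ m) Y n).hom
  balance_right : ∀ (m : M.carrier) (X : C) (n : N.carrier) (Y : C),
    (balance m X n).hom ⊵ᵣ Y ≫ (right m (X ⊙ₗ n) Y).hom ≫
        (functor.obj m).map (N.mid X n Y).hom =
      (right (m ⊙ᵣ X) n Y).hom ≫ (balance m X (n ⊙ᵣ Y)).hom
  left_right : ∀ (X : C) (m : M.carrier) (n : N.carrier) (Y : C),
    (left X m n).hom ⊵ᵣ Y ≫ (right (X ⊙ₗ m) n Y).hom =
      (P.mid X ((functor.obj m).obj n) Y).hom ≫ X ⊴ₗ (right m n Y).hom ≫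
        (left X m (n ⊙ᵣ Y)).hom

/-- `P` is a relative tensor product `M ⊠_C N` of `C`-`C`-bimodule categories. -/
def IsRelTensor (M N P : Bimod C) : Prop :=
  ∃ B : BalancedBimodFunctor M N P, B.toBalancedFunctor.IsUniversal

end RelTensor

/-! ### The categorical 2-groups `BrPic` and `Out`, and their homotopy groups -/

section Homotopy

/-- Two objects of a bicategory are equivalent. -/
def bicategorySetoid (B : Type*) [Bicategory B] : Setoid B where
  r a b := ∃ (f : a ⟶ b) (g : b ⟶ a), Nonempty (f ≫ g ≅ 𝟙 a) ∧ Nonempty (g ≫ f ≅ 𝟙 b)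
  iseqv :=
    { refl := fun _ => ⟨𝟙 _, 𝟙 _, ⟨Bicategory.leftUnitor _⟩, ⟨Bicategory.leftUnitor _⟩⟩
      symm := fun ⟨f, g, h, h'⟩ => ⟨g, f, h', h⟩
      trans := fun ⟨f, g, ⟨h⟩, ⟨h'⟩⟩ ⟨f₁, g₁, ⟨h₁⟩, ⟨h₁'⟩⟩ =>
        ⟨f ≫ f₁, g₁ ≫ g,
          ⟨Bicategory.associator _ _ _ ≪≫ Bicategory.whiskerLeftIso f ((Bicategory.associator _ _ _).symm ≪≫ Bicategory.whiskerRightIso h₁ g ≪≫ Bicategory.leftUnitor g) ≪≫ h⟩,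
          ⟨Bicategory.associator _ _ _ ≪≫ Bicategory.whiskerLeftIso g₁ ((Bicategory.associator _ _ _).symm ≪≫ Bicategory.whiskerRightIso h' f₁ ≪≫ Bicategory.leftUnitor f₁)
            ≪≫ h₁'⟩⟩ }

/-- `π₀` of a bicategory: objects up to equivalence. -/
def BiPiZero (B : Type*) [Bicategory B] := Quotient (bicategorySetoid B)

/-- The class of an object in `π₀` of a bicategory. -/
def biPiZeroMk {B : Type*} [Bicategory B] (b : B) : BiPiZero B := Quotient.mk (bicategorySetoid B) b

/-- `π₁` of a bicategory at an object: isomorphism classes of auto-equivalences, under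
composition. -/
abbrev BiPiOne {B : Type*} [Bicategory B] (b : B) := (Skeleton (EndMonoidal b))ˣ

/-- `π₂` of a bicategory at an object: automorphisms of the identity 1-morphism. -/
abbrev BiPiTwo {B : Type*} [Bicategory B] (b : B) := Aut (𝟙 b)

variable {C : Type u} [Category.{v} C] [Abelian C] [Linear ℂ C] [MonoidalCategory C]
  [MonoidalPreadditive C] [MonoidalLinear ℂ C] [IsFiniteSemisimple C]

/-- An invertible bimodule category: one with a two-sided inverse under `⊠_C`. -/
def IsInvertibleBimod (M : Bimod C) : Prop :=
  ∃ N : Bimod C, IsRelTensor M N (regular C) ∧ IsRelTensor N M (regular C)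

/-- An invertible bimodule category which is equivalent to `C` as a left module category. -/
structure IsOuter (M : Bimod C) : Prop where
  isInvertible : IsInvertibleBimod M
  exists_equivalence : ∃ (F : M.carrier ⥤ C) (_ : F.LeftLinear C), IsCLinear F ∧ F.IsEquivalence

variable (C) in
/-- The Brauer-Picard 2-category of `C`: invertible bimodule categories, bimodule functors and
bimodule natural transformations. (Only the invertible 1- and 2-morphisms, which form the
categorical 2-group, matter for the homotopy groups.) -/
abbrev BrPic :=
  Bicategory.InducedBicategory (Bimod C) (Subtype.val : {M : Bimod C // IsInvertibleBimod M} → _)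

variable (C) in
/-- The full sub-2-category of `BrPic C` on the bimodule categories which are equivalent to `C` as
left module categories. -/
abbrev OutBicat :=
  Bicategory.InducedBicategory (Bimod C) (Subtype.val : {M : Bimod C // IsOuter M} → _)

/-- The unit object of `BrPic C`. -/
def brPicUnit (h : IsInvertibleBimod (regular C)) : BrPic C := ⟨regular C, h⟩

/-- The unit object of `OutBicat C`. -/
def outUnit (h : IsOuter (regular C)) : OutBicat C := ⟨regular C, h⟩

/-- The class in `π₀` of `Out` of an object. -/
def outMk (M : Bimod C) (hM : IsOuter M) : BiPiZero (OutBicat C) :=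
  biPiZeroMk (B := OutBicat C) ⟨M, hM⟩

/-- The class in `π₁` of `Out` is that of the bimodule functor `F`. -/
def IsOutClass (h : IsOuter (regular C)) (φ : BiPiOne (outUnit h)) (F : regular C ⟶ regular C) :
    Prop :=
  (φ : Skeleton (EndMonoidal (outUnit h))) =
    toSkeleton (C := EndMonoidal (outUnit h)) (Bicategory.InducedBicategory.mkHom F)

/-- The class in `π₁` of `BrPic` is that of the bimodule functor `F`. -/
def IsBrPicClass (h : IsInvertibleBimod (regular C)) (φ : BiPiOne (brPicUnit h))
    (F : regular C ⟶ regular C) : Prop :=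
  (φ : Skeleton (EndMonoidal (brPicUnit h))) =
    toSkeleton (C := EndMonoidal (brPicUnit h)) (Bicategory.InducedBicategory.mkHom F)

/-- The object `F(𝟙)` for a bimodule functor `F` from `C` to itself. -/
def unitImage (F : regular C ⟶ regular C) : C := Bimod.Hom.functor F |>.obj (𝟙_ C)

/-- The component at `𝟙` of an element of `π₂` of `Out`. -/
def unitComponent (h : IsOuter (regular C)) (η : BiPiTwo (outUnit h)) : 𝟙_ C ⟶ 𝟙_ C :=
  (Bimod.Hom₂.nat η.hom.hom).app (𝟙_ C)

/-- The group structure `G` on `π₀` of `Out` is induced by the relative tensor product: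
any two objects of `Out` have a relative tensor product in `Out`, whose class is the product. -/
def IsTensorProductLaw (G : Group (BiPiZero (OutBicat C))) : Prop :=
  ∀ (M N : Bimod C) (hM : IsOuter M) (hN : IsOuter N),
    (∃ P : Bimod C, IsOuter P ∧ IsRelTensor M N P) ∧
      ∀ (P : Bimod C) (hP : IsOuter P), IsRelTensor M N P →
        G.mul (outMk M hM) (outMk N hN) = outMk P hP

end Homotopy

/-! ### The groups `U(C)` and `Out(C)` -/

section Groups

variable (C : Type u) [Category.{v} C] [Abelian C] [Linear ℂ C] [MonoidalCategory C]

/-- The isomorphism classes of simple objects of `C`. -/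
abbrev SimpleClass := {s : Skeleton C // ∃ X : C, Simple X ∧ toSkeleton X = s}

variable {C} in
/-- The component at `X` of an element of `π₁` of `EqCat C`, i.e. of a monoidal automorphism of the
identity functor. -/
def idComponent (θ : PiOne (EqCat C)) (X : C) : X ⟶ X := (EqCat.iso θ.hom).hom.nat.app X

variable {C} in
/-- The isomorphism class of a simple object. -/
def simpleClass (X : C) (hX : Simple X) : SimpleClass C := ⟨toSkeleton X, X, hX, rfl⟩

/-- The universal grading group `U(C)`: the group generated by the isomorphism classes `[X]` of
simple objects, with a relation `[X] [Y] = [Z]` whenever the simple object `Z` occurs in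
`X ⊗ Y`. -/
abbrev UGroup :=
  PresentedGroup {r : FreeGroup (SimpleClass C) | ∃ (X Y Z : C) (hX : Simple X) (hY : Simple Y)
    (hZ : Simple Z) (f : Z ⟶ X ⊗ Y), f ≠ 0 ∧ r = FreeGroup.of (simpleClass X hX) *
      FreeGroup.of (simpleClass Y hY) * (FreeGroup.of (simpleClass Z hZ))⁻¹}

variable [MonoidalPreadditive C] [MonoidalLinear ℂ C] [RigidCategory C]

/-- The set of inner classes in `Eq(C)`: those of the tensor auto-equivalences `F_g`. -/
def innerSet : Set (EqGroup C) :=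
  {x | ∃ g : InvCat C, (x : Skeleton (TensorEnd C)) = toSkeleton ((conj C).obj g).tensorEnd}

/-- The group `Out(C)` of tensor auto-equivalences of `C` modulo inner ones. -/
abbrev OutGroup := EqGroup C ⧸ Subgroup.normalClosure (innerSet C)

end Groups
end OuterSequence

end

open OuterSequence

set_option linter.unusedSectionVars false

/-! A bimodule functor out of M_F is determined by the image p of the unit object. Left linearity
forces it to be X ↦ X ⊙ p, and the right module structure amounts to natural isomorphisms p ⊙ Y ≅
F(Y) ⊙ p, coherent with the tensor product and the unit. Such a p with its crossing isomorphisms is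
a `Frame` of M over F. The functor given by a frame is an equivalence exactly when p generates, that
is, when X ↦ X ⊙ p is an equivalence. Three facts about frames carry the proof.

Existence: any generator p of M carries a frame over some tensor functor, since p ⊙ Y has the form
F(Y) ⊙ p and faithfulness of X ↦ X ⊙ p transports the coherence of M to F (`Generator.frame`). A
bimodule category equivalent to C as a left module category has a generator, so every object of Out
is some M_F.

Uniqueness: two frames at the same generator have isomorphic tensor functors
(`Frame.exists_iso_of_eq`). An invertible object g is a generator of M_G with a frame over F_g ∘ G.
Hence M_F and M_G are equivalent if and only if F ≅ F_g ∘ G for some invertible g, and F_{g ⊗ h} ≅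
F_g ∘ F_h needs no computation. In the regular bimodule a frame over the identity functor is a
half-braiding, so bimodule endofunctors of C are objects of the Drinfeld center.

Products: a balanced functor B on M × N is determined by its restriction B(-, p) to a generator p of
N, because the balancing moves X from X ⊙ p into the first variable. So B is universal once B(-, p)
is an equivalence, and conversely when p carries a frame. It follows that M_{F ∘ G} is a relative
tensor product of M_F and M_G, and that any relative tensor product carries a generating frame over
F ∘ G (`prodFrame`); this is the group law on π₀ of Out.

That an invertible M gives an auto-equivalence F needs the fusion hypotheses. With B : N × M → C
universal and n chosen with B(n, p) ≅ 𝟙, one gets Y ≅ B(n ⊙ F(Y), p). The action on n ≠ 0 is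
faithful, by rigidity and simplicity of 𝟙, so F is fully faithful; a fully faithful linear
endofunctor of a finite semisimple category permutes the simple classes and is an equivalence.

Exactness then splits into short observations. Automorphisms of 𝟙 are scalars, so conjugation is
trivial on π₁, δ₂ is bijective and m₁ is injective. A bimodule endofunctor fixing 𝟙 is a twist of
the identity by some θ. An invertible g is the value at 𝟙 of a bimodule auto-equivalence exactly
when it carries a frame over the identity, that is when F_g ≅ id. The fibres of F ↦ [M_F] are the
cosets of the conjugations. Finally, a monoidal automorphism of the identity acts on each simple
object by a scalar, and monoidality says that these scalars form a character of the universal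
grading group. -/

noncomputable section

namespace OuterSequence

/-! ### Module structures on functors -/

section ModuleFunctor

open scoped MonoidalLeftAction MonoidalRightAction
open Functor.LaxLeftLinear Functor.LaxRightLinear Functor.OplaxLeftLinear Functor.OplaxRightLinear

variable {C : Type*} [Category* C] [MonoidalCategory C]
  {A : Type*} [Category* A] {B : Type*} [Category* B]

/-- A left module structure on a functor from a coherent family of isomorphisms. -/
@[reducible] def leftLinearOfIso [MonoidalLeftAction C A] [MonoidalLeftAction C B] (F : A ⥤ B)
    (e : ∀ (X : C) (a : A), X ⊙ₗ F.obj a ≅ F.obj (X ⊙ₗ a))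
    (natural_left : ∀ {X X' : C} (f : X ⟶ X') (a : A),
      f ⊵ₗ F.obj a ≫ (e X' a).hom = (e X a).hom ≫ F.map (f ⊵ₗ a))
    (natural_right : ∀ (X : C) {a a' : A} (f : a ⟶ a'),
      X ⊴ₗ F.map f ≫ (e X a').hom = (e X a).hom ≫ F.map (X ⊴ₗ f))
    (assoc : ∀ (X X' : C) (a : A), (e (X ⊗ X') a).hom ≫ F.map (αₗ X X' a).hom =
      (αₗ X X' (F.obj a)).hom ≫ X ⊴ₗ (e X' a).hom ≫ (e X (X' ⊙ₗ a)).hom)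
    (unit : ∀ a : A, (λₗ (F.obj a)).hom = (e (𝟙_ C) a).hom ≫ F.map (λₗ a).hom) :
    F.LeftLinear C where
  μₗ X a := (e X a).hom
  δₗ X a := (e X a).inv
  μₗ_naturality_left := natural_left
  μₗ_naturality_right := natural_right
  μₗ_associativity := assoc
  μₗ_unitality := unit
  δₗ_naturality_left f a := by
    rw [Iso.comp_inv_eq, Category.assoc, natural_left, Iso.inv_hom_id_assoc]
  δₗ_naturality_right X _ _ f := by
    rw [Iso.comp_inv_eq, Category.assoc, natural_right, Iso.inv_hom_id_assoc]
  δₗ_associativity X X' a := by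
    rw [Iso.inv_comp_eq, reassoc_of% (assoc X X' a)]
    simp
  δₗ_unitality_inv a := by
    rw [← cancel_epi (λₗ[C] (F.obj a)).hom, Iso.hom_inv_id, unit]
    simp [← Functor.map_comp_assoc]
  μₗ_comp_δₗ X a := (e X a).hom_inv_id
  δₗ_comp_μₗ X a := (e X a).inv_hom_id

/-- A right module structure on a functor from a coherent family of isomorphisms. -/
@[reducible] def rightLinearOfIso [MonoidalRightAction C A] [MonoidalRightAction C B] (F : A ⥤ B)
    (e : ∀ (a : A) (X : C), F.obj a ⊙ᵣ X ≅ F.obj (a ⊙ᵣ X))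
    (natural_right : ∀ (a : A) {X X' : C} (f : X ⟶ X'),
      F.obj a ⊴ᵣ f ≫ (e a X').hom = (e a X).hom ≫ F.map (a ⊴ᵣ f))
    (natural_left : ∀ {a a' : A} (f : a ⟶ a') (X : C),
      F.map f ⊵ᵣ X ≫ (e a' X).hom = (e a X).hom ≫ F.map (f ⊵ᵣ X))
    (assoc : ∀ (a : A) (X X' : C), (e a (X ⊗ X')).hom ≫ F.map (αᵣ a X X').hom =
      (αᵣ (F.obj a) X X').hom ≫ (e a X).hom ⊵ᵣ X' ≫ (e (a ⊙ᵣ X) X').hom)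
    (unit : ∀ a : A, (ρᵣ (F.obj a)).hom = (e a (𝟙_ C)).hom ≫ F.map (ρᵣ a).hom) :
    F.RightLinear C where
  μᵣ a X := (e a X).hom
  δᵣ a X := (e a X).inv
  μᵣ_naturality_left := natural_left
  μᵣ_naturality_right := natural_right
  μᵣ_associativity := assoc
  μᵣ_unitality := unit
  δᵣ_naturality_left f a := by
    rw [Iso.comp_inv_eq, Category.assoc, natural_left, Iso.inv_hom_id_assoc]
  δᵣ_naturality_right X _ _ f := by
    rw [Iso.comp_inv_eq, Category.assoc, natural_right, Iso.inv_hom_id_assoc]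
  δᵣ_associativity a X X' := by
    rw [Iso.inv_comp_eq]
    rw [reassoc_of% (assoc a X X')]
    simp
  δᵣ_unitality_inv a := by
    rw [← cancel_epi (ρᵣ[C] (F.obj a)).hom, Iso.hom_inv_id, unit]
    simp [← Functor.map_comp_assoc]
  μᵣ_comp_δᵣ a X := (e a X).hom_inv_id
  δᵣ_comp_μᵣ a X := (e a X).inv_hom_id

/-- The action of an object on an isomorphism. -/
@[simps] def leftActIso [MonoidalLeftAction C A] (X : C) {a b : A} (e : a ≅ b) :
    X ⊙ₗ a ≅ X ⊙ₗ b where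
  hom := X ⊴ₗ e.hom
  inv := X ⊴ₗ e.inv

/-- The action of an isomorphism on an object. -/
@[simps] def leftActIso' [MonoidalLeftAction C A] {X Y : C} (e : X ≅ Y) (a : A) :
    X ⊙ₗ a ≅ Y ⊙ₗ a where
  hom := e.hom ⊵ₗ a
  inv := e.inv ⊵ₗ a

/-- The right action of an object on an isomorphism. -/
@[simps] def rightActIso [MonoidalRightAction C A] {a b : A} (e : a ≅ b) (X : C) :
    a ⊙ᵣ X ≅ b ⊙ᵣ X where
  hom := e.hom ⊵ᵣ X
  inv := e.inv ⊵ᵣ X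

/-- The right action of an isomorphism on an object. -/
@[simps] def rightActIso' [MonoidalRightAction C A] (a : A) {X Y : C} (e : X ≅ Y) :
    a ⊙ᵣ X ≅ a ⊙ᵣ Y where
  hom := a ⊴ᵣ e.hom
  inv := a ⊴ᵣ e.inv

section Left

variable [MonoidalLeftAction C A] [MonoidalLeftAction C B] (e : A ≌ B) [e.functor.LeftLinear C]

/-- The isomorphisms `X ⊙ e⁻¹ b ≅ e⁻¹ (X ⊙ b)`. -/
def leftInverseIso (X : C) (b : B) : X ⊙ₗ e.inverse.obj b ≅ e.inverse.obj (X ⊙ₗ b) :=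
  e.functor.preimageIso
    ((Functor.LeftLinear.μₗIso e.functor X (e.inverse.obj b)).symm ≪≫
      leftActIso X (e.counitIso.app b) ≪≫
      (e.counitIso.app (X ⊙ₗ b)).symm)

theorem map_leftInverseIso (X : C) (b : B) :
    e.functor.map (leftInverseIso e X b).hom =
      δₗ e.functor X (e.inverse.obj b) ≫ X ⊴ₗ e.counit.app b ≫ e.counitInv.app (X ⊙ₗ b) := by
  simp [leftInverseIso]

/-- The inverse of an equivalence of left module categories is a left module functor. -/
@[reducible] def leftLinearInverse : e.inverse.LeftLinear C :=
  leftLinearOfIso e.inverse (leftInverseIso e)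
    (fun f b => e.functor.map_injective (by
      simp only [Functor.map_comp, map_leftInverseIso, δₗ_naturality_left_assoc, Category.assoc]
      rw [← MonoidalLeftAction.action_exchange_assoc]
      simp))
    (fun X _ _ f => e.functor.map_injective (by
      simp only [Functor.map_comp, map_leftInverseIso, δₗ_naturality_right_assoc, Category.assoc]
      rw [← MonoidalLeftAction.actionHomRight_comp_assoc]
      simp))
    (fun X X' b => e.functor.map_injective (by
      have h : X ⊴ₗ e.counitInv.app (X' ⊙ₗ b) ≫ X ⊴ₗ e.counit.app (X' ⊙ₗ b) = 𝟙 _ := by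
        rw [← MonoidalLeftAction.actionHomRight_comp]; simp
      simp only [Functor.map_comp, map_leftInverseIso, δₗ_naturality_right_assoc, Category.assoc]
      simp [reassoc_of% h]))
    (fun b => e.functor.map_injective (by
      simp only [Functor.map_comp, map_leftInverseIso, Category.assoc]
      simp))

end Left

section Right

variable [MonoidalRightAction C A] [MonoidalRightAction C B] (e : A ≌ B)
  [e.functor.RightLinear C]

/-- The isomorphisms `e⁻¹ b ⊙ X ≅ e⁻¹ (b ⊙ X)`. -/
def rightInverseIso (b : B) (X : C) : e.inverse.obj b ⊙ᵣ X ≅ e.inverse.obj (b ⊙ᵣ X) :=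
  e.functor.preimageIso
    ((Functor.RightLinear.μᵣIso e.functor (e.inverse.obj b) X).symm ≪≫
      rightActIso (e.counitIso.app b) X ≪≫
      (e.counitIso.app (b ⊙ᵣ X)).symm)

theorem map_rightInverseIso (b : B) (X : C) :
    e.functor.map (rightInverseIso e b X).hom =
      δᵣ e.functor (e.inverse.obj b) X ≫ e.counit.app b ⊵ᵣ X ≫ e.counitInv.app (b ⊙ᵣ X) := by
  simp [rightInverseIso]

/-- The inverse of an equivalence of right module categories is a right module functor. -/
@[reducible] def rightLinearInverse : e.inverse.RightLinear C :=
  rightLinearOfIso e.inverse (rightInverseIso e)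
    (fun b _ _ f => e.functor.map_injective (by
      simp only [Functor.map_comp, map_rightInverseIso, δᵣ_naturality_right_assoc, Category.assoc]
      rw [MonoidalRightAction.action_exchange_assoc]
      simp))
    (fun f X => e.functor.map_injective (by
      simp only [Functor.map_comp, map_rightInverseIso, δᵣ_naturality_left_assoc, Category.assoc]
      rw [← MonoidalRightAction.comp_actionHomLeft_assoc]
      simp))
    (fun b X X' => e.functor.map_injective (by
      have h : e.counitInv.app (b ⊙ᵣ X) ⊵ᵣ X' ≫ e.counit.app (b ⊙ᵣ X) ⊵ᵣ X' = 𝟙 _ := by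
        rw [← MonoidalRightAction.comp_actionHomLeft]; simp
      simp only [Functor.map_comp, map_rightInverseIso, δᵣ_naturality_left_assoc, Category.assoc]
      simp [reassoc_of% h]))
    (fun b => e.functor.map_injective (by
      simp only [Functor.map_comp, map_rightInverseIso, Category.assoc]
      simp))

end Right

end ModuleFunctor

end OuterSequence
end

noncomputable section

namespace OuterSequence

/-! ### Equivalences of bimodule categories -/

section BimoduleEquivalence

open scoped MonoidalLeftAction MonoidalRightAction
open Functor.LaxLeftLinear Functor.LaxRightLinear Functor.OplaxLeftLinear Functor.OplaxRightLinear

variable {C : Type u} [Category.{v} C] [Abelian C] [Linear ℂ C] [MonoidalCategory C]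

namespace Bimod

variable {M N : Bimod C}

/-- The compatibility axiom with all structure maps inverted. This is the form that appears when the
inverse of a bimodule equivalence is examined after applying the equivalence. -/
theorem Hom.compat_inv (Φ : Hom M N) (X : C) (m : M.carrier) (Y : C) :
    δᵣ Φ.functor (X ⊙ₗ m) Y ≫ δₗ Φ.functor X m ⊵ᵣ Y ≫ (N.mid X (Φ.functor.obj m) Y).hom =
      Φ.functor.map (M.mid X m Y).hom ≫ δₗ Φ.functor X (m ⊙ᵣ Y) ≫ X ⊴ₗ δᵣ Φ.functor m Y := by
  have h := Φ.compat X m Y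
  rw [← cancel_epi (μᵣ Φ.functor (X ⊙ₗ m) Y), ← cancel_epi (μₗ Φ.functor X m ⊵ᵣ Y),
    reassoc_of% h]
  simp [← MonoidalRightAction.comp_actionHomLeft_assoc,
    ← MonoidalLeftAction.actionHomRight_comp]

section

variable (Φ : Hom M N) [Φ.functor.IsEquivalence]

/-- The inverse of a bimodule equivalence. -/
def invHom : Hom N M :=
  let e := Φ.functor.asEquivalence
  letI : e.functor.LeftLinear C := Φ.left
  letI : e.functor.RightLinear C := Φ.right
  haveI : e.functor.Additive := Φ.linear.toAdditive
  haveI : e.functor.Linear ℂ := Φ.linear.toLinear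
  { functor := e.inverse
    linear := { toAdditive := e.inverse_additive, toLinear := inferInstance }
    left := leftLinearInverse e
    right := rightLinearInverse e
    -- After applying the equivalence the transported structure maps have explicit formulas. Inner
    -- counits cancel in `h₁` and `h₂`, and what remains is `compat_inv` together with naturality of
    -- the middle associativity along the counit.
    compat := fun X n Y => e.functor.map_injective (by
      have h : δᵣ e.functor (X ⊙ₗ e.inverse.obj n) Y ≫
          δₗ e.functor X (e.inverse.obj n) ⊵ᵣ Y ≫ (N.mid X _ Y).hom =
          e.functor.map (M.mid X (e.inverse.obj n) Y).hom ≫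
            δₗ e.functor X (e.inverse.obj n ⊙ᵣ Y) ≫ X ⊴ₗ δᵣ e.functor (e.inverse.obj n) Y :=
        Φ.compat_inv X (e.inverse.obj n) Y
      change e.functor.map ((leftInverseIso e X n).hom ⊵ᵣ Y ≫
        (rightInverseIso e (X ⊙ₗ n) Y).hom ≫ e.inverse.map (N.mid X n Y).hom) =
        e.functor.map ((M.mid X (e.inverse.obj n) Y).hom ≫
          X ⊴ₗ (rightInverseIso e n Y).hom ≫ (leftInverseIso e X (n ⊙ᵣ Y)).hom)
      have h₁ : e.counitInv.app (X ⊙ₗ n) ⊵ᵣ Y ≫ e.counit.app (X ⊙ₗ n) ⊵ᵣ Y = 𝟙 _ := by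
        rw [← MonoidalRightAction.comp_actionHomLeft]; simp
      have h₂ : X ⊴ₗ e.counitInv.app (n ⊙ᵣ Y) ≫ X ⊴ₗ e.counit.app (n ⊙ᵣ Y) = 𝟙 _ := by
        rw [← MonoidalLeftAction.actionHomRight_comp]; simp
      have h₃ : e.counitInv.app ((X ⊙ₗ n) ⊙ᵣ Y) ≫ e.functor.map (e.inverse.map (N.mid X n Y).hom) =
          (N.mid X n Y).hom ≫ e.counitInv.app _ := by simp
      have h₄ := N.mid_naturality_mid X (e.counit.app n) Y
      have h₅ := δᵣ_naturality_left e.functor (leftInverseIso e X n).hom Y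
      have h₆ := δₗ_naturality_right e.functor X (rightInverseIso e n Y).hom
      simp only [Functor.map_comp, map_rightInverseIso, map_leftInverseIso, Category.assoc] at h₅ h₆ ⊢
      simp only [reassoc_of% h₅, reassoc_of% h₆, MonoidalRightAction.comp_actionHomLeft,
        MonoidalLeftAction.actionHomRight_comp, Category.assoc, reassoc_of% h₁, reassoc_of% h₂]
      erw [h₃, reassoc_of% h₄, reassoc_of% h]) }

instance : (invHom Φ).functor.IsEquivalence :=
  inferInstanceAs Φ.functor.asEquivalence.inverse.IsEquivalence

/-- A bimodule equivalence followed by its inverse. -/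
def homInvIso : compHom Φ (invHom Φ) ≅ idHom M :=
  let e := Φ.functor.asEquivalence
  letI : e.functor.LeftLinear C := Φ.left
  letI : e.functor.RightLinear C := Φ.right
  isoMk e.unitIso.symm
    -- Again compared after the equivalence: a triangle identity removes the unit against the
    -- counit, and naturality of the left structure does the rest.
    (fun X m => e.functor.map_injective (by
      change e.functor.map (((leftInverseIso e X (e.functor.obj m)).hom ≫
        e.inverse.map (μₗ e.functor X m)) ≫ e.unitInv.app _) =
          e.functor.map (X ⊴ₗ e.unitInv.app m ≫ 𝟙 _)
      simp only [Functor.map_comp, map_leftInverseIso, Category.assoc,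
        Category.comp_id]
      have h₁ : e.counitInv.app (X ⊙ₗ e.functor.obj m) ≫
          e.functor.map (e.inverse.map (μₗ e.functor X m)) =
            μₗ e.functor X m ≫ e.counitInv.app (e.functor.obj (X ⊙ₗ m)) :=
        (e.counitInv.naturality _).symm
      have h₂ : e.counitInv.app (e.functor.obj (X ⊙ₗ m)) ≫ e.functor.map (e.unitInv.app (X ⊙ₗ m)) =
          𝟙 (e.functor.obj (X ⊙ₗ m)) := by simp
      have h₃ : X ⊴ₗ e.functor.map (e.unitInv.app m) ≫ μₗ e.functor X m = _ :=
        μₗ_naturality_right e.functor X (e.unitInv.app m)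
      rw [reassoc_of% h₁, h₂, Category.comp_id, e.counit_app_functor, h₃]
      simp))
    (fun m Y => e.functor.map_injective (by
      change e.functor.map (((rightInverseIso e (e.functor.obj m) Y).hom ≫
        e.inverse.map (μᵣ e.functor m Y)) ≫ e.unitInv.app _) =
          e.functor.map (e.unitInv.app m ⊵ᵣ Y ≫ 𝟙 _)
      simp only [Functor.map_comp, map_rightInverseIso, Category.assoc,
        Category.comp_id]
      have h₁ : e.counitInv.app (e.functor.obj m ⊙ᵣ Y) ≫
          e.functor.map (e.inverse.map (μᵣ e.functor m Y)) =
            μᵣ e.functor m Y ≫ e.counitInv.app (e.functor.obj (m ⊙ᵣ Y)) :=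
        (e.counitInv.naturality _).symm
      have h₂ : e.counitInv.app (e.functor.obj (m ⊙ᵣ Y)) ≫ e.functor.map (e.unitInv.app (m ⊙ᵣ Y)) =
          𝟙 (e.functor.obj (m ⊙ᵣ Y)) := by simp
      have h₃ : e.functor.map (e.unitInv.app m) ⊵ᵣ Y ≫ μᵣ e.functor m Y = _ :=
        μᵣ_naturality_left e.functor (e.unitInv.app m) Y
      rw [reassoc_of% h₁, h₂, Category.comp_id, e.counit_app_functor, h₃]
      simp))

/-- The inverse of a bimodule equivalence followed by the equivalence. -/
def invHomIso : compHom (invHom Φ) Φ ≅ idHom N :=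
  let e := Φ.functor.asEquivalence
  letI : e.functor.LeftLinear C := Φ.left
  letI : e.functor.RightLinear C := Φ.right
  isoMk e.counitIso
    (fun X n => by
      change (μₗ e.functor X (e.inverse.obj n) ≫ e.functor.map (leftInverseIso e X n).hom) ≫
        e.counit.app _ = X ⊴ₗ e.counit.app n ≫ 𝟙 _
      simp [map_leftInverseIso])
    (fun n Y => by
      change (μᵣ e.functor (e.inverse.obj n) Y ≫ e.functor.map (rightInverseIso e n Y).hom) ≫
        e.counit.app _ = e.counit.app n ⊵ᵣ Y ≫ 𝟙 _
      simp [map_rightInverseIso])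

omit [Φ.functor.IsEquivalence] in
theorem isEquivalence_of_iso_id {Ψ : Hom N M} (e : compHom Φ Ψ ≅ idHom M)
    (e' : compHom Ψ Φ ≅ idHom N) : Φ.functor.IsEquivalence := by
  let toNat {A B : Bimod C} {F G : Hom A B} (e : F ≅ G) : F.functor ≅ G.functor :=
    { hom := e.hom.nat
      inv := e.inv.nat
      hom_inv_id := congrArg Hom₂.nat e.hom_inv_id
      inv_hom_id := congrArg Hom₂.nat e.inv_hom_id }
  exact (CategoryTheory.Equivalence.mk Φ.functor Ψ.functor (toNat e).symm
    (toNat e')).isEquivalence_functor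

end
end Bimod
end BimoduleEquivalence

/-! ### Frames -/

section Frame

open scoped MonoidalLeftAction MonoidalRightAction
open Functor.LaxMonoidal Functor.OplaxMonoidal

variable {C : Type u} [Category.{v} C] [Abelian C] [Linear ℂ C] [MonoidalCategory C]

theorem Bimod.left_pentagon_inv (M : Bimod C) (X X' : C) (m : M.carrier) (Y : C) :
    (αₗ X X' m).inv ⊵ᵣ Y ≫ (M.mid (X ⊗ X') m Y).hom =
      (M.mid X (X' ⊙ₗ m) Y).hom ≫ X ⊴ₗ (M.mid X' m Y).hom ≫ (αₗ X X' (m ⊙ᵣ Y)).inv := by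
  rw [← cancel_epi ((αₗ X X' m).hom ⊵ᵣ Y), reassoc_of% (M.left_pentagon X X' m Y)]
  simp

theorem leftAct_assoc_inv {A : Type*} [Category* A] [MonoidalLeftAction C A] (X Y Z : C) (a : A) :
    X ⊴ₗ (αₗ Y Z a).inv ≫ (αₗ X (Y ⊗ Z) a).inv =
      (αₗ X Y (Z ⊙ₗ a)).inv ≫ (αₗ (X ⊗ Y) Z a).inv ≫ (α_ X Y Z).hom ⊵ₗ a := by
  have h := MonoidalLeftAction.associator_actionHom X Y Z a
  rw [← cancel_mono (αₗ X (Y ⊗ Z) a).hom, ← cancel_mono (X ⊴ₗ (αₗ Y Z a).hom)]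
  simp only [Category.assoc, h]
  simp

/-- An object of a bimodule category which intertwines the right action with the left action
twisted by a tensor functor. -/
structure Frame (M : Bimod C) (F : TensorEnd C) where
  pt : M.carrier
  cross : ∀ Y : C, pt ⊙ᵣ Y ≅ F.functor.obj Y ⊙ₗ pt
  natural : ∀ {Y Y' : C} (f : Y ⟶ Y'),
    pt ⊴ᵣ f ≫ (cross Y').hom = (cross Y).hom ≫ F.functor.map f ⊵ₗ pt
  tensor : ∀ Y Y' : C, (cross (Y ⊗ Y')).hom = (αᵣ pt Y Y').hom ≫ (cross Y).hom ⊵ᵣ Y' ≫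
    (M.mid (F.functor.obj Y) pt Y').hom ≫ F.functor.obj Y ⊴ₗ (cross Y').hom ≫
      (αₗ (F.functor.obj Y) (F.functor.obj Y') pt).inv ≫ μ F.functor Y Y' ⊵ₗ pt
  unit : (cross (𝟙_ C)).hom = (ρᵣ pt).hom ≫ (λₗ[C] pt).inv ≫ ε F.functor ⊵ₗ pt

namespace Frame

variable {M : Bimod C} {F : TensorEnd C} (φ : Frame M F)

/-- The functor `X ↦ X ⊙ pt`. -/
def functor : C ⥤ M.carrier := (MonoidalLeftAction.curriedAction C M.carrier).flip.obj φ.pt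

/-- The isomorphisms `(m ⊙ pt) ⊙ Y ≅ (m ⊗ F(Y)) ⊙ pt`. -/
def rightIso (m Y : C) : (m ⊙ₗ φ.pt) ⊙ᵣ Y ≅ (m ⊗ F.functor.obj Y) ⊙ₗ φ.pt :=
  M.mid m φ.pt Y ≪≫ leftActIso m (φ.cross Y) ≪≫ (αₗ m (F.functor.obj Y) φ.pt).symm

theorem rightIso_hom (m Y : C) : (φ.rightIso m Y).hom =
    (M.mid m φ.pt Y).hom ≫ m ⊴ₗ (φ.cross Y).hom ≫ (αₗ m (F.functor.obj Y) φ.pt).inv := rfl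

theorem rightIso_natural_right (m : C) {Y Y' : C} (f : Y ⟶ Y') :
    (m ⊙ₗ φ.pt) ⊴ᵣ f ≫ (φ.rightIso m Y').hom =
      (φ.rightIso m Y).hom ≫ (m ◁ F.functor.map f) ⊵ₗ φ.pt := by
  simp only [rightIso_hom]
  rw [reassoc_of% (M.mid_naturality_right m φ.pt f),
    ← MonoidalLeftAction.actionHomRight_comp_assoc, φ.natural]
  simp

theorem rightIso_natural_left {m m' : C} (f : m ⟶ m') (Y : C) :
    (f ⊵ₗ φ.pt) ⊵ᵣ Y ≫ (φ.rightIso m' Y).hom =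
      (φ.rightIso m Y).hom ≫ (f ▷ F.functor.obj Y) ⊵ₗ φ.pt := by
  simp only [rightIso_hom]
  rw [reassoc_of% (M.mid_naturality_left f φ.pt Y),
    ← MonoidalLeftAction.action_exchange_assoc]
  simp

/-- The right pentagon of M brings both actions next to the generator, where the tensor axiom of the
frame applies. Its μ cancels the δ in the associator of the twisted right action. -/
theorem rightIso_assoc (m Y Y' : C) : (φ.rightIso m (Y ⊗ Y')).hom ≫
    (m ◁ δ F.functor Y Y' ≫ (α_ m (F.functor.obj Y) (F.functor.obj Y')).inv) ⊵ₗ φ.pt =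
      (αᵣ (m ⊙ₗ φ.pt) Y Y').hom ≫ (φ.rightIso m Y).hom ⊵ᵣ Y' ≫
        (φ.rightIso (m ⊗ F.functor.obj Y) Y').hom := by
  have h₁ := M.right_pentagon m φ.pt Y Y'
  have h₂ := M.mid_naturality_mid m (φ.cross Y).hom Y'
  have h₃ := M.left_pentagon_inv m (F.functor.obj Y) φ.pt Y'
  simp only [rightIso_hom, φ.tensor, MonoidalRightAction.comp_actionHomLeft, Category.assoc,
    reassoc_of% h₃, reassoc_of% h₂, reassoc_of% h₁]
  simp
  have h₅ := leftAct_assoc_inv m (F.functor.obj Y) (F.functor.obj Y') φ.pt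
  have h₆ : m ⊴ₗ μ F.functor Y Y' ⊵ₗ φ.pt ≫ m ⊴ₗ δ F.functor Y Y' ⊵ₗ φ.pt = 𝟙 _ := by
    rw [← MonoidalLeftAction.actionHomRight_comp, ← MonoidalLeftAction.comp_actionHomLeft]
    simp
  rw [reassoc_of% h₆, reassoc_of% h₅]
  simp

theorem rightIso_unit (m : C) : (ρᵣ (m ⊙ₗ φ.pt)).hom =
    (φ.rightIso m (𝟙_ C)).hom ≫ (m ◁ η F.functor ≫ (ρ_ m).hom) ⊵ₗ φ.pt := by
  simp only [rightIso_hom, φ.unit, M.right_triangle]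
  simp
  have h : m ⊴ₗ ε F.functor ⊵ₗ φ.pt ≫ m ⊴ₗ η F.functor ⊵ₗ φ.pt = 𝟙 _ := by
    rw [← MonoidalLeftAction.actionHomRight_comp, ← MonoidalLeftAction.comp_actionHomLeft]
    simp
  rw [reassoc_of% h]
  simp

/-- Only pentagons of M and of its left action enter; no frame axiom is needed. -/
theorem rightIso_compat (X m Y : C) : (αₗ X m φ.pt).inv ⊵ᵣ Y ≫ (φ.rightIso (X ⊗ m) Y).hom ≫
    (α_ X m (F.functor.obj Y)).hom ⊵ₗ φ.pt =
      (M.mid X (m ⊙ₗ φ.pt) Y).hom ≫ X ⊴ₗ (φ.rightIso m Y).hom ≫ (αₗ X _ φ.pt).inv := by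
  have h₁ := M.left_pentagon_inv X m φ.pt Y
  simp only [rightIso_hom, Category.assoc, reassoc_of% h₁]
  simp
  rw [leftAct_assoc_inv]

variable [MonoidalPreadditive C] [MonoidalLinear ℂ C] [IsFiniteSemisimple C]

/-- The bimodule functor `X ↦ X ⊙ pt` given by a frame. -/
def toHom : Bimod.Hom (twist F) M where
  functor := φ.functor
  linear := M.left_linear_flip φ.pt
  left := @leftLinearOfIso C _ _ C _ M.carrier _ (selfLeftAction C) M.leftAction φ.functor
    (fun X m => (αₗ X m φ.pt).symm)
    (fun f a => by change _ ⊵ₗ (_ ⊙ₗ φ.pt) ≫ _ = _ ≫ (f ▷ _) ⊵ₗ φ.pt; simp)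
    (fun X _ _ f => by change X ⊴ₗ (f ⊵ₗ φ.pt) ≫ _ = _ ≫ (X ◁ f) ⊵ₗ φ.pt; simp)
    (fun X X' a => by
      change (αₗ (X ⊗ X') a φ.pt).inv ≫ (α_ X X' a).hom ⊵ₗ φ.pt = (αₗ X X' (a ⊙ₗ φ.pt)).hom ≫
        X ⊴ₗ (αₗ X' a φ.pt).inv ≫ (αₗ X (X' ⊗ a) φ.pt).inv
      rw [leftAct_assoc_inv, Iso.hom_inv_id_assoc])
    (fun a => by
      change (λₗ[C] (a ⊙ₗ φ.pt)).hom = (αₗ _ _ _).inv ≫ (λ_ a).hom ⊵ₗ φ.pt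
      simp)
  right := @rightLinearOfIso C _ _ C _ M.carrier _ (twistRightAction F) M.rightAction φ.functor
    φ.rightIso φ.rightIso_natural_right φ.rightIso_natural_left φ.rightIso_assoc φ.rightIso_unit
  compat X m Y := φ.rightIso_compat X m Y

end Frame
end Frame

end OuterSequence
end

noncomputable section

namespace OuterSequence

/-! ### From bimodule functors on M_F to frames -/

section HomFrame

open scoped MonoidalLeftAction MonoidalRightAction
open Functor.LaxMonoidal Functor.OplaxMonoidal
open Functor.LaxLeftLinear Functor.LaxRightLinear Functor.OplaxLeftLinear Functor.OplaxRightLinear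

variable {C : Type u} [Category.{v} C] [Abelian C] [Linear ℂ C] [MonoidalCategory C]
  [MonoidalPreadditive C] [MonoidalLinear ℂ C] [IsFiniteSemisimple C]

namespace TwistHom

variable {M : Bimod C} {F : TensorEnd C} (Φ : Bimod.Hom (twist F) M)

/-- The functor underlying a bimodule functor on `M_F`, as a functor on `C`. -/
def fn : C ⥤ M.carrier := Φ.functor

/-- The left module structure, in terms of the tensor product of `C`. -/
def L (X m : C) : X ⊙ₗ (fn Φ).obj m ≅ (fn Φ).obj (X ⊗ m) :=
  Functor.LeftLinear.μₗIso Φ.functor X (d := m)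

/-- The right module structure, in terms of the tensor product of `C`. -/
def R (m Y : C) : (fn Φ).obj m ⊙ᵣ Y ≅ (fn Φ).obj (m ⊗ F.functor.obj Y) :=
  Functor.RightLinear.μᵣIso Φ.functor (d := m) Y

/-- The carrier of M_F is C itself, so the module functor axioms of Φ can be expressed with the
tensor product, associator and unitors of C. The lemmas up to `compat` record them in this form. -/
theorem L_natural_left {X X' : C} (f : X ⟶ X') (m : C) :
    f ⊵ₗ (fn Φ).obj m ≫ (L Φ X' m).hom = (L Φ X m).hom ≫ (fn Φ).map (f ▷ m) :=
  μₗ_naturality_left Φ.functor f (d := m)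

theorem L_natural_right (X : C) {m m' : C} (f : m ⟶ m') :
    X ⊴ₗ (fn Φ).map f ≫ (L Φ X m').hom = (L Φ X m).hom ≫ (fn Φ).map (X ◁ f) :=
  μₗ_naturality_right Φ.functor X (d := m) (d' := m') f

theorem L_assoc (X X' m : C) :
    (L Φ (X ⊗ X') m).hom ≫ (fn Φ).map (α_ X X' m).hom =
      (αₗ X X' ((fn Φ).obj m)).hom ≫ X ⊴ₗ (L Φ X' m).hom ≫ (L Φ X (X' ⊗ m)).hom :=
  μₗ_associativity Φ.functor X X' (d := m)

theorem L_unit (m : C) :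
    (λₗ[C] ((fn Φ).obj m)).hom = (L Φ (𝟙_ C) m).hom ≫ (fn Φ).map (λ_ m).hom :=
  μₗ_unitality Φ.functor (d := m)

theorem R_natural_right (m : C) {Y Y' : C} (f : Y ⟶ Y') :
    (fn Φ).obj m ⊴ᵣ f ≫ (R Φ m Y').hom = (R Φ m Y).hom ≫ (fn Φ).map (m ◁ F.functor.map f) :=
  μᵣ_naturality_right Φ.functor (d := m) f

theorem R_natural_left {m m' : C} (f : m ⟶ m') (Y : C) :
    (fn Φ).map f ⊵ᵣ Y ≫ (R Φ m' Y).hom = (R Φ m Y).hom ≫ (fn Φ).map (f ▷ F.functor.obj Y) :=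
  μᵣ_naturality_left Φ.functor (d := m) (d' := m') f Y

theorem R_assoc (m Y Y' : C) :
    (R Φ m (Y ⊗ Y')).hom ≫
        (fn Φ).map (m ◁ δ F.functor Y Y' ≫ (α_ m (F.functor.obj Y) (F.functor.obj Y')).inv) =
      (αᵣ ((fn Φ).obj m) Y Y').hom ≫ (R Φ m Y).hom ⊵ᵣ Y' ≫ (R Φ (m ⊗ F.functor.obj Y) Y').hom :=
  μᵣ_associativity Φ.functor (d := m) Y Y'

theorem R_unit (m : C) :
    (ρᵣ[C] ((fn Φ).obj m)).hom =
      (R Φ m (𝟙_ C)).hom ≫ (fn Φ).map (m ◁ η F.functor ≫ (ρ_ m).hom) :=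
  μᵣ_unitality Φ.functor (d := m)

theorem compat (X m Y : C) :
    (L Φ X m).hom ⊵ᵣ Y ≫ (R Φ (X ⊗ m) Y).hom ≫ (fn Φ).map (α_ X m (F.functor.obj Y)).hom =
      (M.mid X ((fn Φ).obj m) Y).hom ≫ X ⊴ₗ (R Φ m Y).hom ≫
        (L Φ X (m ⊗ F.functor.obj Y)).hom :=
  Φ.compat X m Y

theorem compat_inv (X m Y : C) :
    (L Φ X m).inv ⊵ᵣ Y ≫ (M.mid X ((fn Φ).obj m) Y).hom ≫ X ⊴ₗ (R Φ m Y).hom =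
      (R Φ (X ⊗ m) Y).hom ≫ (fn Φ).map (α_ X m (F.functor.obj Y)).hom ≫
        (L Φ X (m ⊗ F.functor.obj Y)).inv := by
  rw [← cancel_epi ((L Φ X m).hom ⊵ᵣ Y), reassoc_of% (compat Φ X m Y)]
  simp

theorem L_inv_natural_left {X X' : C} (f : X ⟶ X') (m : C) :
    (L Φ X m).inv ≫ f ⊵ₗ (fn Φ).obj m = (fn Φ).map (f ▷ m) ≫ (L Φ X' m).inv := by
  rw [Iso.inv_comp_eq, ← reassoc_of% (L_natural_left Φ f m)]
  simp

theorem L_inv_natural_right (X : C) {m m' : C} (f : m ⟶ m') :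
    (L Φ X m).inv ≫ X ⊴ₗ (fn Φ).map f = (fn Φ).map (X ◁ f) ≫ (L Φ X m').inv := by
  rw [Iso.inv_comp_eq, ← reassoc_of% (L_natural_right Φ X f)]
  simp

theorem L_inv_assoc (X X' m : C) :
    (L Φ X (X' ⊗ m)).inv ≫ X ⊴ₗ (L Φ X' m).inv ≫ (αₗ X X' ((fn Φ).obj m)).inv =
      (fn Φ).map (α_ X X' m).inv ≫ (L Φ (X ⊗ X') m).inv := by
  rw [← cancel_epi (L Φ X (X' ⊗ m)).hom, ← cancel_epi (X ⊴ₗ (L Φ X' m).hom),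
    ← cancel_epi (αₗ X X' ((fn Φ).obj m)).hom]
  have h := reassoc_of% (L_assoc Φ X X' m)
  rw [← h ((fn Φ).map (α_ X X' m).inv ≫ (L Φ (X ⊗ X') m).inv), ← Functor.map_comp_assoc]
  simp

/-- The isomorphisms `Φ(𝟙) ⊙ Y ≅ F(Y) ⊙ Φ(𝟙)`. -/
def cross (Y : C) : (fn Φ).obj (𝟙_ C) ⊙ᵣ Y ≅ F.functor.obj Y ⊙ₗ (fn Φ).obj (𝟙_ C) :=
  R Φ (𝟙_ C) Y ≪≫ (fn Φ).mapIso (λ_ (F.functor.obj Y) ≪≫ (ρ_ (F.functor.obj Y)).symm) ≪≫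
    (L Φ (F.functor.obj Y) (𝟙_ C)).symm

theorem cross_hom (Y : C) : (cross Φ Y).hom = (R Φ (𝟙_ C) Y).hom ≫
    (fn Φ).map ((λ_ (F.functor.obj Y)).hom ≫ (ρ_ (F.functor.obj Y)).inv) ≫
      (L Φ (F.functor.obj Y) (𝟙_ C)).inv := rfl

/-- The frame given by the image of the unit object. -/
def frame : Frame M F where
  pt := (fn Φ).obj (𝟙_ C)
  cross := cross Φ
  natural {Y Y'} f := by
    simp only [cross_hom, Category.assoc, L_inv_natural_left]
    rw [reassoc_of% (R_natural_right Φ (𝟙_ C) f)]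
    simp only [← Functor.map_comp_assoc]
    simp
  tensor Y Y' := by
    have h := R_assoc Φ (𝟙_ C) Y Y'
    simp only [cross_hom, MonoidalRightAction.comp_actionHomLeft, Category.assoc,
      MonoidalLeftAction.actionHomRight_comp, reassoc_of% (compat_inv Φ (F.functor.obj Y) (𝟙_ C) Y'),
      reassoc_of% (L_inv_natural_right Φ), reassoc_of% (R_natural_left Φ)]
    rw [← reassoc_of% h, reassoc_of% (L_inv_assoc Φ), L_inv_natural_left]
    simp only [← Functor.map_comp_assoc]
    -- All coherence isomorphisms of C collapse here, leaving δ followed by μ, which is the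
    -- identity.
    have e : (𝟙_ C ◁ δ F.functor Y Y' ≫ (α_ (𝟙_ C) (F.functor.obj Y) (F.functor.obj Y')).inv) ≫
        (((λ_ (F.functor.obj Y)).hom ≫ (ρ_ (F.functor.obj Y)).inv) ▷ F.functor.obj Y' ≫
          (α_ (F.functor.obj Y) (𝟙_ C) (F.functor.obj Y')).hom ≫
            F.functor.obj Y ◁ ((λ_ (F.functor.obj Y')).hom ≫ (ρ_ (F.functor.obj Y')).inv) ≫
              (α_ (F.functor.obj Y) (F.functor.obj Y') (𝟙_ C)).inv) ≫ μ F.functor Y Y' ▷ 𝟙_ C =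
        (λ_ _).hom ≫ (δ F.functor Y Y' ≫ μ F.functor Y Y') ≫ (ρ_ _).inv := by monoidal
    simp only [Category.assoc] at e ⊢
    rw [e]
    simp
  unit := by
    simp only [cross_hom, R_unit, Category.assoc]
    have h : (λₗ[C] ((fn Φ).obj (𝟙_ C))).inv =
        (fn Φ).map (λ_ (𝟙_ C)).inv ≫ (L Φ (𝟙_ C) (𝟙_ C)).inv := by
      rw [← cancel_epi (λₗ[C] ((fn Φ).obj (𝟙_ C))).hom, Iso.hom_inv_id, L_unit]
      simp [← Functor.map_comp_assoc]
    rw [h]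
    simp only [Category.assoc, L_inv_natural_left]
    simp only [← Functor.map_comp_assoc]
    have e : (𝟙_ C ◁ η F.functor ≫ (ρ_ (𝟙_ C)).hom) ≫ (λ_ (𝟙_ C)).inv ≫ ε F.functor ▷ 𝟙_ C =
        (λ_ _).hom ≫ (η F.functor ≫ ε F.functor) ≫ (ρ_ _).inv := by monoidal
    simp only [Category.assoc] at e ⊢
    rw [e]
    simp

/-- The isomorphisms `X ⊙ Φ(𝟙) ≅ Φ(X)`. -/
def frameNatIso : (frame Φ).functor ≅ fn Φ :=
  NatIso.ofComponents (fun m : C => L Φ m (𝟙_ C) ≪≫ (fn Φ).mapIso (ρ_ m))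
    (fun {X Y : C} f => by
      change f ⊵ₗ (fn Φ).obj (𝟙_ C) ≫ (L Φ Y (𝟙_ C)).hom ≫ (fn Φ).map (ρ_ Y).hom =
        ((L Φ X (𝟙_ C)).hom ≫ (fn Φ).map (ρ_ X).hom) ≫ (fn Φ).map f
      rw [reassoc_of% (L_natural_left Φ f)]
      simp [← Functor.map_comp])

/-- A bimodule functor on `M_F` is determined by its frame. -/
def frameIso : (frame Φ).toHom ≅ Φ :=
  Bimod.isoMk (frameNatIso Φ)
    (fun X (m : C) => by
      change (αₗ X m ((fn Φ).obj (𝟙_ C))).inv ≫ (L Φ (X ⊗ m) (𝟙_ C)).hom ≫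
        (fn Φ).map (ρ_ (X ⊗ m)).hom = X ⊴ₗ ((L Φ m (𝟙_ C)).hom ≫ (fn Φ).map (ρ_ m).hom) ≫
          (L Φ X m).hom
      have h := L_assoc Φ X m (𝟙_ C)
      rw [Iso.inv_comp_eq, MonoidalLeftAction.actionHomRight_comp, Category.assoc,
        L_natural_right, ← reassoc_of% h]
      simp [← Functor.map_comp])
    (fun (m : C) Y => by
      change ((M.mid m ((fn Φ).obj (𝟙_ C)) Y).hom ≫ m ⊴ₗ (cross Φ Y).hom ≫ (αₗ _ _ _).inv) ≫
        (L Φ (m ⊗ F.functor.obj Y) (𝟙_ C)).hom ≫ (fn Φ).map (ρ_ (m ⊗ F.functor.obj Y)).hom =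
          ((L Φ m (𝟙_ C)).hom ≫ (fn Φ).map (ρ_ m).hom) ⊵ᵣ Y ≫ (R Φ m Y).hom
      have h₁ := L_assoc Φ m (F.functor.obj Y) (𝟙_ C)
      have h₂ : m ⊴ₗ (L Φ (F.functor.obj Y) (𝟙_ C)).inv ≫ (αₗ _ _ _).inv ≫
          (L Φ (m ⊗ F.functor.obj Y) (𝟙_ C)).hom = (L Φ _ _).hom ≫ (fn Φ).map (α_ _ _ _).inv := by
        rw [← cancel_mono ((fn Φ).map (α_ m (F.functor.obj Y) (𝟙_ C)).hom)]
        simp only [Category.assoc, h₁]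
        simp [← Functor.map_comp]
      simp only [cross_hom, MonoidalLeftAction.actionHomRight_comp, Category.assoc,
        MonoidalRightAction.comp_actionHomLeft, reassoc_of% h₂, R_natural_left,
        reassoc_of% (L_natural_right Φ)]
      rw [← reassoc_of% (compat Φ m (𝟙_ C) Y)]
      simp only [← Functor.map_comp]
      congr 3
      monoidal)

end TwistHom
end HomFrame

end OuterSequence
end

noncomputable section

namespace OuterSequence

/-! ### Balanced functors -/

section Balanced

open scoped MonoidalLeftAction MonoidalRightAction
open Functor.LaxLeftLinear Functor.LaxRightLinear Functor.OplaxLeftLinear Functor.OplaxRightLinear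

variable {C : Type u} [Category.{v} C] [Abelian C] [Linear ℂ C] [MonoidalCategory C]

namespace BalancedFunctor

variable {M N M' N' : Bimod C} {A : Type u} [Category.{v} A] [Abelian A] [Linear ℂ A]

/-- Bifunctoriality: morphisms in the two variables act independently. -/
theorem exchange (B : BalancedFunctor M N A) {m m' : M.carrier} (f : m ⟶ m') {n n' : N.carrier}
    (g : n ⟶ n') : (B.functor.obj m).map g ≫ (B.functor.map f).app n' =
      (B.functor.map f).app n ≫ (B.functor.obj m').map g :=
  (B.functor.map f).naturality g

theorem Hom.exchange {B B' : BalancedFunctor M N A} (α : Hom B B') {m m' : M.carrier} (f : m ⟶ m')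
    (n : N.carrier) : (B.functor.map f).app n ≫ (α.nat.app m').app n =
      (α.nat.app m).app n ≫ (B'.functor.map f).app n :=
  NatTrans.congr_app (α.nat.naturality f) n

/-- The underlying bifunctor of a precomposition. -/
def precompFunctor (B : BalancedFunctor M' N' A) (Φ : M.carrier ⥤ M'.carrier)
    (Ψ : N.carrier ⥤ N'.carrier) : M.carrier ⥤ N.carrier ⥤ A :=
  Φ ⋙ B.functor ⋙ (Functor.whiskeringLeft _ _ _).obj Ψ

/-- Precomposition of a balanced functor with module functors. -/
def precomp (B : BalancedFunctor M' N' A) (Φ : M.carrier ⥤ M'.carrier) [IsCLinear Φ]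
    [Φ.RightLinear C] (Ψ : N.carrier ⥤ N'.carrier) [IsCLinear Ψ] [Ψ.LeftLinear C] :
    BalancedFunctor M N A where
  functor := B.precompFunctor Φ Ψ
  linear_obj m :=
    have := B.linear_obj (Φ.obj m)
    inferInstanceAs (IsCLinear (Ψ ⋙ B.functor.obj (Φ.obj m)))
  linear_flip n :=
    have := B.linear_flip (Ψ.obj n)
    inferInstanceAs (IsCLinear (Φ ⋙ B.functor.flip.obj (Ψ.obj n)))
  balance m X n :=
    (B.functor.mapIso (Functor.RightLinear.μᵣIso Φ m X).symm).app (Ψ.obj n) ≪≫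
      B.balance (Φ.obj m) X (Ψ.obj n) ≪≫
        (B.functor.obj (Φ.obj m)).mapIso (Functor.LeftLinear.μₗIso Ψ X n)
  naturality_left {m m'} f X n := by
    change (B.functor.map (Φ.map (f ⊵ᵣ X))).app (Ψ.obj n) ≫ (B.functor.map (δᵣ Φ m' X)).app _ ≫
      (B.balance _ _ _).hom ≫ (B.functor.obj _).map (μₗ Ψ X n) =
        ((B.functor.map (δᵣ Φ m X)).app _ ≫ (B.balance _ _ _).hom ≫
          (B.functor.obj _).map (μₗ Ψ X n)) ≫ (B.functor.map (Φ.map f)).app _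
    rw [← NatTrans.comp_app_assoc, ← Functor.map_comp, δᵣ_naturality_left, Functor.map_comp,
      NatTrans.comp_app_assoc, reassoc_of% (B.naturality_left (Φ.map f) X (Ψ.obj n))]
    simp only [Category.assoc, B.exchange]
  naturality_mid m X X' f n := by
    change (B.functor.map (Φ.map (m ⊴ᵣ f))).app (Ψ.obj n) ≫ (B.functor.map (δᵣ Φ m X')).app _ ≫
      (B.balance _ _ _).hom ≫ (B.functor.obj _).map (μₗ Ψ X' n) =
        ((B.functor.map (δᵣ Φ m X)).app _ ≫ (B.balance _ _ _).hom ≫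
          (B.functor.obj _).map (μₗ Ψ X n)) ≫ (B.functor.obj _).map (Ψ.map (f ⊵ₗ n))
    rw [← NatTrans.comp_app_assoc, ← Functor.map_comp, δᵣ_naturality_right, Functor.map_comp,
      NatTrans.comp_app_assoc, reassoc_of% (B.naturality_mid (Φ.obj m) f (Ψ.obj n))]
    simp only [Category.assoc, ← Functor.map_comp, μₗ_naturality_left]
  naturality_right m X n n' f := by
    change (B.functor.obj (Φ.obj (m ⊙ᵣ X))).map (Ψ.map f) ≫ (B.functor.map (δᵣ Φ m X)).app _ ≫
      (B.balance _ _ _).hom ≫ (B.functor.obj _).map (μₗ Ψ X n') =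
        ((B.functor.map (δᵣ Φ m X)).app _ ≫ (B.balance _ _ _).hom ≫
          (B.functor.obj _).map (μₗ Ψ X n)) ≫ (B.functor.obj _).map (Ψ.map (X ⊴ₗ f))
    rw [reassoc_of% (B.exchange (δᵣ Φ m X) (Ψ.map f)),
      reassoc_of% (B.naturality_right (Φ.obj m) X (Ψ.map f))]
    simp only [Category.assoc, ← Functor.map_comp, μₗ_naturality_right]
  pentagon m X Y n := by
    have h := B.pentagon (Φ.obj m) X Y (Ψ.obj n)
    have h₁ := B.naturality_right (Φ.obj m) X (μₗ Ψ Y n)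
    have h₂ := B.naturality_left (δᵣ Φ m X) Y (Ψ.obj n)
    have h₃ := B.exchange (δᵣ Φ m X) (μₗ Ψ Y n)
    have h₄ := congrArg (fun f => (B.functor.map f).app (Ψ.obj n)) (δᵣ_associativity Φ m X Y)
    have h₅ := congrArg (B.functor.obj (Φ.obj m)).map (μₗ_associativity Ψ X Y n)
    simp only [Functor.map_comp, NatTrans.comp_app] at h₄ h₅
    change (B.functor.map (Φ.map (αᵣ m X Y).hom)).app (Ψ.obj n) ≫
      ((B.functor.map (δᵣ Φ (m ⊙ᵣ X) Y)).app _ ≫ (B.balance _ _ _).hom ≫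
        (B.functor.obj _).map (μₗ Ψ Y n)) ≫
      ((B.functor.map (δᵣ Φ m X)).app _ ≫ (B.balance _ _ _).hom ≫
        (B.functor.obj _).map (μₗ Ψ X (Y ⊙ₗ n))) =
      ((B.functor.map (δᵣ Φ m (X ⊗ Y))).app _ ≫ (B.balance _ _ _).hom ≫
        (B.functor.obj _).map (μₗ Ψ (X ⊗ Y) n)) ≫ (B.functor.obj _).map (Ψ.map (αₗ X Y n).hom)
    simp only [Category.assoc, h₅]
    rw [reassoc_of% h₃, reassoc_of% h₁, ← reassoc_of% h₂, ← reassoc_of% h₄, ← reassoc_of% h]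
  triangle m n := by
    have h := B.triangle (Φ.obj m) (Ψ.obj n)
    change (B.functor.map (Φ.map (ρᵣ m).hom)).app (Ψ.obj n) =
      ((B.functor.map (δᵣ Φ m (𝟙_ C))).app _ ≫ (B.balance _ _ _).hom ≫
        (B.functor.obj _).map (μₗ Ψ (𝟙_ C) n)) ≫ (B.functor.obj _).map (Ψ.map (λₗ n).hom)
    rw [Category.assoc, Category.assoc, ← Functor.map_comp, ← μₗ_unitality, ← h,
      ← δᵣ_unitality_hom, Functor.map_comp, NatTrans.comp_app]

section Act

variable [MonoidalPreadditive C] [MonoidalLinear ℂ C] [IsFiniteSemisimple C]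

theorem act_natural_right (m : M.carrier) (X : C) {n n' : C} (f : n ⟶ n') :
    (m ⊙ᵣ X) ⊴ᵣ f ≫ (αᵣ m X n').inv = (αᵣ m X n).inv ≫ m ⊴ᵣ (X ◁ f) := by
  simp

/-- The right action of `C` on `M`, as a balanced functor `M × M_F ⥤ M`. -/
def act (M : Bimod C) (F : TensorEnd C) : BalancedFunctor M (twist F) M.carrier where
  functor := (MonoidalRightAction.curriedAction C M.carrier).flip
  linear_obj m := M.right_linear_flip m
  linear_flip n := M.right_linear_obj n
  balance m X n := (αᵣ m X n).symm
  naturality_left f X (n : C) := by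
    change (f ⊵ᵣ X) ⊵ᵣ n ≫ (αᵣ _ X n).inv = (αᵣ _ X n).inv ≫ f ⊵ᵣ (X ⊗ n)
    simp
  naturality_mid m _ _ f (n : C) := by
    change (m ⊴ᵣ f) ⊵ᵣ n ≫ (αᵣ _ _ n).inv = (αᵣ _ _ n).inv ≫ m ⊴ᵣ (f ▷ n)
    simp
  naturality_right m X _ _ f := act_natural_right m X f
  pentagon m X Y (n : C) := by
    change (αᵣ m X Y).hom ⊵ᵣ n ≫ (αᵣ (m ⊙ᵣ X) Y n).inv ≫ (αᵣ m X (Y ⊗ n)).inv =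
      (αᵣ m (X ⊗ Y) n).inv ≫ m ⊴ᵣ (α_ X Y n).hom
    have h := MonoidalRightAction.actionHom_associator X Y n m
    rw [Iso.eq_inv_comp, ← reassoc_of% h]
    simp
  triangle m (n : C) := by
    change (ρᵣ m).hom ⊵ᵣ n = (αᵣ m (𝟙_ C) n).inv ≫ m ⊴ᵣ (λ_ n).hom
    simp

end Act

/-! #### Evaluation at a generator -/

variable (A) in
/-- Evaluation of balanced functors at an object of the second bimodule category. -/
def evalAt (M : Bimod C) (pt : N.carrier) : BalancedFunctor M N A ⥤ M.carrier ⥤ A where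
  obj B := B.functor.flip.obj pt
  map α := { app := fun m => (α.nat.app m).app pt, naturality := fun _ _ f => α.exchange f pt }

variable {pt : N.carrier}

/-- The balancing moves X from the second variable to the first, so the component at (m, X ⊙ pt) is
a conjugate of the one at (m ⊙ X, pt). This is why evaluation at a generator loses nothing. -/
theorem hom_gen {B B' : BalancedFunctor M N A} (α : B ⟶ B') (m : M.carrier) (X : C) :
    (α.nat.app m).app (X ⊙ₗ pt) =
      (B.balance m X pt).inv ≫ (α.nat.app (m ⊙ᵣ X)).app pt ≫ (B'.balance m X pt).hom := by
  rw [α.balance, Iso.inv_hom_id_assoc]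

variable (pt) [hpt : (MonoidalLeftAction.actionRight (C := C) pt).IsEquivalence]

/-- An object of `C` whose action on the generator gives the object `n`. -/
def genObj (n : N.carrier) : C := (MonoidalLeftAction.actionRight (C := C) pt).objPreimage n

/-- Every object is isomorphic to the action of an object of `C` on the generator. -/
def genIso (n : N.carrier) : genObj (C := C) pt n ⊙ₗ pt ≅ n :=
  (MonoidalLeftAction.actionRight (C := C) pt).objObjPreimageIso n

/-- Every n is isomorphic to some X ⊙ pt, where `hom_gen` recovers the component from those at `pt`.
-/
instance : (evalAt A M pt).Faithful where
  map_injective {B B'} α α' h := by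
    have h₁ (m : M.carrier) : (α.nat.app m).app pt = (α'.nat.app m).app pt := NatTrans.congr_app h m
    refine Hom.ext (NatTrans.ext (funext fun m => NatTrans.ext (funext fun n => ?_)))
    rw [← cancel_epi ((B.functor.obj m).map (genIso pt n).hom), (α.nat.app m).naturality,
      (α'.nat.app m).naturality, hom_gen, hom_gen, h₁]

section Lift

variable {B B' : BalancedFunctor M N A}
  (β : B.functor.flip.obj pt ⟶ B'.functor.flip.obj pt)

/-- The component at `X ⊙ pt` of the extension of a natural transformation. -/
def liftGen (m : M.carrier) (X : C) :
    (B.functor.obj m).obj (X ⊙ₗ pt) ⟶ (B'.functor.obj m).obj (X ⊙ₗ pt) :=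
  (B.balance m X pt).inv ≫ β.app (m ⊙ᵣ X) ≫ (B'.balance m X pt).hom

theorem liftGen_natural_left {m m' : M.carrier} (f : m ⟶ m') (X : C) :
    (B.functor.map f).app _ ≫ liftGen pt β m' X = liftGen pt β m X ≫ (B'.functor.map f).app _ := by
  have h := β.naturality (f ⊵ᵣ X)
  change (B.functor.map _).app pt ≫ _ = _ ≫ (B'.functor.map _).app pt at h
  unfold liftGen
  rw [← cancel_epi (B.balance m X pt).hom, ← reassoc_of% (B.naturality_left f X pt)]
  simp only [Category.assoc, Iso.hom_inv_id_assoc]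
  rw [reassoc_of% h, B'.naturality_left]

theorem liftGen_natural_right (m : M.carrier) {X X' : C} (f : X ⟶ X') :
    (B.functor.obj m).map (f ⊵ₗ pt) ≫ liftGen pt β m X' =
      liftGen pt β m X ≫ (B'.functor.obj m).map (f ⊵ₗ pt) := by
  have h := β.naturality (m ⊴ᵣ f)
  change (B.functor.map _).app pt ≫ _ = _ ≫ (B'.functor.map _).app pt at h
  unfold liftGen
  rw [← cancel_epi (B.balance m X pt).hom, ← reassoc_of% (B.naturality_mid m f pt)]
  simp only [Category.assoc, Iso.hom_inv_id_assoc]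
  rw [reassoc_of% h, B'.naturality_mid]

/-- Since X ↦ X ⊙ pt is full, every morphism X ⊙ pt ⟶ X' ⊙ pt comes from C, so naturality in C is
enough. -/
theorem liftGen_natural (m : M.carrier) {X X' : C} (f : X ⊙ₗ pt ⟶ X' ⊙ₗ pt) :
    (B.functor.obj m).map f ≫ liftGen pt β m X' = liftGen pt β m X ≫ (B'.functor.obj m).map f := by
  obtain ⟨g, rfl⟩ := (MonoidalLeftAction.actionRight (C := C) pt).map_surjective f
  exact liftGen_natural_right pt β m g

/-- The extension of a natural transformation of functors on `M`, at an object of `N`. -/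
def liftApp (m : M.carrier) (n : N.carrier) : (B.functor.obj m).obj n ⟶ (B'.functor.obj m).obj n :=
  (B.functor.obj m).map (genIso pt n).inv ≫ liftGen pt β m _ ≫
    (B'.functor.obj m).map (genIso pt n).hom

/-- The extension does not depend on the chosen presentation `genIso` of n: any morphism from an
object X ⊙ pt may be used instead. -/
theorem map_liftApp (m : M.carrier) {X : C} {n : N.carrier} (f : X ⊙ₗ pt ⟶ n) :
    (B.functor.obj m).map f ≫ liftApp pt β m n =
      liftGen pt β m X ≫ (B'.functor.obj m).map f := by
  unfold liftApp
  have h := liftGen_natural pt β m (f ≫ (genIso pt n).inv)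
  rw [← Functor.map_comp_assoc, reassoc_of% h, ← Functor.map_comp]
  simp

theorem liftApp_natural_right (m : M.carrier) {n n' : N.carrier} (f : n ⟶ n') :
    (B.functor.obj m).map f ≫ liftApp pt β m n' =
      liftApp pt β m n ≫ (B'.functor.obj m).map f := by
  rw [← cancel_epi ((B.functor.obj m).map (genIso pt n).hom), ← Functor.map_comp_assoc,
    map_liftApp, reassoc_of% (map_liftApp pt β m (genIso pt n).hom), Functor.map_comp]

theorem liftApp_natural_left {m m' : M.carrier} (f : m ⟶ m') (n : N.carrier) :
    (B.functor.map f).app n ≫ liftApp pt β m' n =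
      liftApp pt β m n ≫ (B'.functor.map f).app n := by
  unfold liftApp
  rw [← reassoc_of% (B.exchange f), Category.assoc, Category.assoc, B'.exchange,
    reassoc_of% (liftGen_natural_left pt β f)]

/-- The presentation of `pt` by the unitor 𝟙 ⊙ pt ≅ pt replaces the chosen one, and the triangle
axioms turn the balancing over 𝟙 into the right unitor of m. -/
theorem liftApp_pt (m : M.carrier) : liftApp pt β m pt = β.app m := by
  rw [← cancel_epi ((B.functor.obj m).map (λₗ[C] pt).hom), map_liftApp]
  have h := β.naturality (ρᵣ[C] m).hom
  change (B.functor.map _).app pt ≫ _ = _ ≫ (B'.functor.map _).app pt at h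
  rw [B.triangle, B'.triangle] at h
  unfold liftGen
  rw [← cancel_epi (B.balance m (𝟙_ C) pt).hom]
  simp only [Category.assoc, Iso.hom_inv_id_assoc] at h ⊢
  exact h.symm

/-- With n presented as Z ⊙ pt, both sides become values of β. The pentagons of B and B' compare
balancing X and then Z with balancing X ⊗ Z, and naturality of β at the associator identifies the
two. -/
theorem liftApp_balance (m : M.carrier) (X : C) (n : N.carrier) :
    liftApp pt β (m ⊙ᵣ X) n ≫ (B'.balance m X n).hom =
      (B.balance m X n).hom ≫ liftApp pt β m (X ⊙ₗ n) := by
  let i := genIso (C := C) pt n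
  let Z := genObj (C := C) pt n
  have h₁ := map_liftApp pt β (m ⊙ᵣ X) (X := Z) i.hom
  -- The object X ⊙ n is presented by X ⊗ Z, not by its own chosen preimage; `map_liftApp` permits
  -- this.
  have h₂ := map_liftApp pt β m (X := X ⊗ Z) ((αₗ X Z pt).hom ≫ X ⊴ₗ i.hom)
  have h₃ := B.naturality_right m X i.hom
  have h₄ := B'.naturality_right m X i.hom
  have h₅ := B.pentagon m X Z pt
  have h₆ := B'.pentagon m X Z pt
  have h₇ := β.naturality (αᵣ m X Z).hom
  change (B.functor.map _).app pt ≫ _ = _ ≫ (B'.functor.map _).app pt at h₇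
  rw [← cancel_epi ((B.functor.obj (m ⊙ᵣ X)).map i.hom), reassoc_of% h₁, reassoc_of% h₃, h₄,
    ← cancel_epi (B.balance (m ⊙ᵣ X) Z pt).hom,
    ← cancel_epi ((B.functor.map (αᵣ m X Z).hom).app pt), reassoc_of% h₅]
  rw [Functor.map_comp, Category.assoc] at h₂
  rw [h₂]
  unfold liftGen
  simp only [Category.assoc, Iso.hom_inv_id_assoc, Functor.map_comp]
  rw [reassoc_of% h₇, reassoc_of% h₆]

/-- The extension of a natural transformation of functors on `M`. -/
def lift : B ⟶ B' where
  nat :=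
    { app := fun m => { app := liftApp pt β m, naturality := fun _ _ => liftApp_natural_right pt β m }
      naturality := fun _ _ f => NatTrans.ext (funext (liftApp_natural_left pt β f)) }
  balance := liftApp_balance pt β

end Lift

/-- The lift restricts to the given transformation by `liftApp_pt`. -/
instance : (evalAt A M pt).Full where
  map_surjective β := ⟨lift pt β, NatTrans.ext (funext (liftApp_pt pt β))⟩

end BalancedFunctor

end Balanced
end OuterSequence
end

noncomputable section

namespace OuterSequence

/-! ### Universality tested at a generator -/

section Universal

open scoped MonoidalLeftAction MonoidalRightAction

variable {C : Type u} [Category.{v} C] [Abelian C] [Linear ℂ C] [MonoidalCategory C]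

namespace BalancedFunctor

variable {M N : Bimod C} {A : Type u} [Category.{v} A] [Abelian A] [Linear ℂ A]
  (B : BalancedFunctor M N A) (pt : N.carrier)
  [hpt : (MonoidalLeftAction.actionRight (C := C) pt).IsEquivalence]

instance (n : N.carrier) : IsCLinear (B.functor.flip.obj n) := B.linear_flip n

theorem isCLinear_inv {A₁ A₂ : Type*} [Category* A₁] [Category* A₂]
    [Preadditive A₁] [Preadditive A₂] [Linear ℂ A₁] [Linear ℂ A₂]
    (F : A₁ ⥤ A₂) [IsCLinear F] [F.IsEquivalence] : IsCLinear F.inv :=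
  have : F.asEquivalence.functor.Additive := inferInstanceAs F.Additive
  have : F.asEquivalence.functor.Linear ℂ := inferInstanceAs (F.Linear ℂ)
  { toAdditive := F.asEquivalence.inverse_additive
    toLinear := inferInstanceAs (F.asEquivalence.inverse.Linear ℂ) }

/-- A balanced functor is universal if its restriction to a generator is an equivalence. -/
theorem isUniversal_of_isEquivalence [hK : (B.functor.flip.obj pt).IsEquivalence] :
    B.IsUniversal := by
  intro A' _ _ _
  let K := B.functor.flip.obj pt
  have hK : K.IsEquivalence := hK
  let W := (Functor.whiskeringLeft _ _ A').obj K
  have hW : W.IsEquivalence := inferInstance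
  -- Composition with B followed by evaluation at the generator is precomposition with K. This is
  -- fully faithful because K is an equivalence, and evaluation is faithful, so composition with B
  -- is fully faithful.
  have key {G G' : LinFunctor A A'} (τ : G ⟶ G') :
      (evalAt A' M pt).map ((B.postcomp A').map τ) = W.map τ.hom := rfl
  refine { faithful := ⟨fun {G G'} τ τ' h => ?_⟩, full := ⟨fun {G G'} α => ?_⟩,
           essSurj := ⟨fun B' => ?_⟩ }
  · exact ObjectProperty.hom_ext _ (W.map_injective
      (congrArg (evalAt A' M pt).map h))
  · refine ⟨ObjectProperty.homMk (W.preimage ((evalAt A' M pt).map α)), ?_⟩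
    refine (evalAt A' M pt).map_injective ?_
    exact (key _).trans (W.map_preimage _)
  -- The only possible factorization of B': it is fixed by its restriction along K.
  · let G : A ⥤ A' := K.inv ⋙ B'.functor.flip.obj pt
    have : IsCLinear K := B.linear_flip pt
    have : IsCLinear K.inv := isCLinear_inv K
    have hG : IsCLinear G := inferInstanceAs (IsCLinear (K.inv ⋙ B'.functor.flip.obj pt))
    let e : K ⋙ G ≅ B'.functor.flip.obj pt :=
      (Functor.associator _ _ _).symm ≪≫
        Functor.isoWhiskerRight K.asEquivalence.unitIso.symm _ ≪≫ Functor.leftUnitor _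
    exact ⟨⟨G, hG⟩, ⟨(evalAt A' M pt).preimageIso e⟩⟩

/-- The restriction of a universal balanced functor to a generator is an equivalence. -/
theorem isEquivalence_of_isUniversal (hB : B.IsUniversal) (B₀ : BalancedFunctor M N M.carrier)
    (e : B₀.functor.flip.obj pt ≅ 𝟭 M.carrier) : (B.functor.flip.obj pt).IsEquivalence := by
  let K := B.functor.flip.obj pt
  have h₁ := hB M.carrier
  have h₂ := hB A
  -- R is the factorization of B₀ through B. Evaluated at the generator, it satisfies R ∘ K ≅ id, so
  -- R is the candidate inverse of K.
  let R := (B.postcomp M.carrier).objPreimage B₀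
  have : IsCLinear R.obj := R.property
  have : IsCLinear K := B.linear_flip pt
  let e₁ : K ⋙ R.obj ≅ 𝟭 M.carrier :=
    (evalAt M.carrier M pt).mapIso ((B.postcomp M.carrier).objObjPreimageIso B₀) ≪≫ e
  let S : LinFunctor A A := ⟨R.obj ⋙ K, inferInstanceAs (IsCLinear (R.obj ⋙ K))⟩
  let I : LinFunctor A A := ⟨𝟭 A, inferInstanceAs (IsCLinear (𝟭 A))⟩
  -- For the other composite, K R K ≅ K says that K R and the identity give the same functor after
  -- composing with B and evaluating at the generator. Both operations are fully faithful, hence K R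
  -- ≅ id.
  let e₂ : (evalAt A M pt).obj ((B.postcomp A).obj S) ≅ (evalAt A M pt).obj ((B.postcomp A).obj I) :=
    ((Functor.associator _ _ _).symm ≪≫ Functor.isoWhiskerRight e₁ K ≪≫ Functor.leftUnitor _ ≪≫
      (Functor.rightUnitor _).symm : K ⋙ (R.obj ⋙ K) ≅ K ⋙ 𝟭 A)
  let e₃ : S ≅ I := (B.postcomp A).preimageIso ((evalAt A M pt).preimageIso e₂)
  exact (CategoryTheory.Equivalence.mk K R.obj e₁.symm
    ((ObjectProperty.ι _).mapIso e₃)).isEquivalence_functor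

end BalancedFunctor

end Universal

/-! ### Universality and generating frames -/

section FrameUniversal

open scoped MonoidalLeftAction MonoidalRightAction

variable {C : Type u} [Category.{v} C] [Abelian C] [Linear ℂ C] [MonoidalCategory C]
  [MonoidalPreadditive C] [MonoidalLinear ℂ C] [IsFiniteSemisimple C]

/-- A frame is generating if `X ↦ X ⊙ pt` is an equivalence. -/
class Frame.IsGenerating {M : Bimod C} {F : TensorEnd C} (φ : Frame M F) : Prop where
  isEquivalence : (MonoidalLeftAction.actionRight (C := C) φ.pt).IsEquivalence

attribute [instance] Frame.IsGenerating.isEquivalence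

instance {M : Bimod C} {F : TensorEnd C} (φ : Frame M F) [h : φ.IsGenerating] :
    φ.toHom.functor.IsEquivalence := h.isEquivalence

/-- The image of the generator under the inverse of the equivalence given by a generating frame. -/
def Frame.invPt {M : Bimod C} {F : TensorEnd C} (φ : Frame M F) [φ.IsGenerating] : C :=
  (Bimod.invHom φ.toHom).functor.obj φ.pt

/-- The inverse of the equivalence given by a generating frame takes the generator to the unit. -/
def Frame.invPtIso {M : Bimod C} {F : TensorEnd C} (φ : Frame M F) [φ.IsGenerating] :
    φ.invPt ≅ 𝟙_ C :=
  φ.toHom.functor.inv.mapIso (λₗ[C] φ.pt).symm ≪≫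
    (φ.toHom.functor.asEquivalence.unitIso.app (𝟙_ C : C)).symm

/-- Evaluation at the generator, of the balanced functor `M × N ⥤ M` given by a frame. -/
def evalActIso (M : Bimod C) {N : Bimod C} {G : TensorEnd C} (ψ : Frame N G) [ψ.IsGenerating] :
    ((BalancedFunctor.act M G).precomp (𝟭 _) (Bimod.invHom ψ.toHom).functor).functor.flip.obj ψ.pt ≅
      𝟭 M.carrier :=
  NatIso.ofComponents (fun m => rightActIso' m ψ.invPtIso ≪≫ ρᵣ m) (fun {m m'} f => by
    have h {Z : C} (e : Z ≅ 𝟙_ C) : f ⊵ᵣ Z ≫ m' ⊴ᵣ e.hom ≫ (ρᵣ m').hom =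
        (m ⊴ᵣ e.hom ≫ (ρᵣ m).hom) ≫ f := by
      rw [Category.assoc, MonoidalRightAction.actionUnitIso_hom_naturality,
        ← MonoidalRightAction.action_exchange_assoc]
    exact h ψ.invPtIso)

/-- The required test functor is (m, n) ↦ m ⊙ Ψ⁻¹(n), where Ψ is the equivalence given by ψ. Since
Ψ⁻¹ sends the generator to 𝟙, this restricts to the identity of M. -/
theorem Frame.isEquivalence_eval {M N : Bimod C} {G : TensorEnd C} (ψ : Frame N G)
    [ψ.IsGenerating] {A : Type u} [Category.{v} A] [Abelian A] [Linear ℂ A]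
    (B : BalancedFunctor M N A) (hB : B.IsUniversal) :
    (B.functor.flip.obj ψ.pt).IsEquivalence :=
  B.isEquivalence_of_isUniversal ψ.pt hB _ (evalActIso M ψ)

end FrameUniversal
end OuterSequence
end

noncomputable section

namespace OuterSequence

/-! ### Balanced functors of bimodule categories -/

section BalancedBimod

open scoped MonoidalLeftAction MonoidalRightAction
open Functor.LaxMonoidal Functor.OplaxMonoidal
open Functor.LaxLeftLinear Functor.LaxRightLinear Functor.OplaxLeftLinear Functor.OplaxRightLinear

variable {C : Type u} [Category.{v} C] [Abelian C] [Linear ℂ C] [MonoidalCategory C]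

namespace BalancedBimodFunctor

variable {M N P : Bimod C} (B : BalancedBimodFunctor M N P)

theorem left_natural_X {X X' : C} (f : X ⟶ X') (m : M.carrier) (n : N.carrier) :
    f ⊵ₗ (B.functor.obj m).obj n ≫ (B.left X' m n).hom =
      (B.left X m n).hom ≫ (B.functor.map (f ⊵ₗ m)).app n := by
  simpa using B.left_naturality f (𝟙 m) (𝟙 n)

theorem left_natural_m (X : C) {m m' : M.carrier} (f : m ⟶ m') (n : N.carrier) :
    X ⊴ₗ (B.functor.map f).app n ≫ (B.left X m' n).hom =
      (B.left X m n).hom ≫ (B.functor.map (X ⊴ₗ f)).app n := by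
  simpa using B.left_naturality (𝟙 X) f (𝟙 n)

theorem left_natural_n (X : C) (m : M.carrier) {n n' : N.carrier} (f : n ⟶ n') :
    X ⊴ₗ (B.functor.obj m).map f ≫ (B.left X m n').hom =
      (B.left X m n).hom ≫ (B.functor.obj (X ⊙ₗ m)).map f := by
  simpa using B.left_naturality (𝟙 X) (𝟙 m) f

theorem right_natural_m {m m' : M.carrier} (f : m ⟶ m') (n : N.carrier) (Y : C) :
    (B.functor.map f).app n ⊵ᵣ Y ≫ (B.right m' n Y).hom =
      (B.right m n Y).hom ≫ (B.functor.map f).app (n ⊙ᵣ Y) := by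
  simpa using B.right_naturality f (𝟙 n) (𝟙 Y)

theorem right_natural_n (m : M.carrier) {n n' : N.carrier} (f : n ⟶ n') (Y : C) :
    (B.functor.obj m).map f ⊵ᵣ Y ≫ (B.right m n' Y).hom =
      (B.right m n Y).hom ≫ (B.functor.obj m).map (f ⊵ᵣ Y) := by
  simpa using B.right_naturality (𝟙 m) f (𝟙 Y)

theorem right_natural_Y (m : M.carrier) (n : N.carrier) {Y Y' : C} (f : Y ⟶ Y') :
    (B.functor.obj m).obj n ⊴ᵣ f ≫ (B.right m n Y').hom =
      (B.right m n Y).hom ≫ (B.functor.obj m).map (n ⊴ᵣ f) := by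
  simpa using B.right_naturality (𝟙 m) (𝟙 n) f

/-! ### The frame of a relative tensor product -/

section Frame

variable {G : TensorEnd C} (ψ : Frame N G)

/-- The isomorphisms `B(m, pt) ⊙ Y ≅ B(m ⊙ G(Y), pt)` given by a frame of `N`. -/
def rightGen (m : M.carrier) (Y : C) :
    (B.functor.obj m).obj ψ.pt ⊙ᵣ Y ≅ (B.functor.obj (m ⊙ᵣ G.functor.obj Y)).obj ψ.pt :=
  B.right m ψ.pt Y ≪≫ (B.functor.obj m).mapIso (ψ.cross Y) ≪≫
    (B.balance m (G.functor.obj Y) ψ.pt).symm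

theorem rightGen_hom (m : M.carrier) (Y : C) : (B.rightGen ψ m Y).hom =
    (B.right m ψ.pt Y).hom ≫ (B.functor.obj m).map (ψ.cross Y).hom ≫
      (B.balance m (G.functor.obj Y) ψ.pt).inv := rfl

theorem balance_inv_natural_left {m m' : M.carrier} (f : m ⟶ m') (X : C) (n : N.carrier) :
    (B.balance m X n).inv ≫ (B.functor.map (f ⊵ᵣ X)).app n =
      (B.functor.map f).app (X ⊙ₗ n) ≫ (B.balance m' X n).inv := by
  rw [Iso.inv_comp_eq, ← reassoc_of% (B.naturality_left f X n)]
  simp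

theorem balance_inv_natural_mid (m : M.carrier) {X X' : C} (f : X ⟶ X') (n : N.carrier) :
    (B.balance m X n).inv ≫ (B.functor.map (m ⊴ᵣ f)).app n =
      (B.functor.obj m).map (f ⊵ₗ n) ≫ (B.balance m X' n).inv := by
  rw [Iso.inv_comp_eq, ← reassoc_of% (B.naturality_mid m f n)]
  simp

/-- This and the next four lemmas say that B(-, pt) intertwines the action of G(Y) on M with the
action of Y on P, coherently with tensor products, the unit and the left actions. -/
theorem rightGen_natural_left {m m' : M.carrier} (f : m ⟶ m') (Y : C) :
    (B.functor.map f).app ψ.pt ⊵ᵣ Y ≫ (B.rightGen ψ m' Y).hom =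
      (B.rightGen ψ m Y).hom ≫ (B.functor.map (f ⊵ᵣ G.functor.obj Y)).app ψ.pt := by
  simp only [rightGen_hom, Category.assoc, balance_inv_natural_left]
  rw [reassoc_of% (B.right_natural_m f ψ.pt Y),
    reassoc_of% (B.exchange f (ψ.cross Y).hom)]

theorem rightGen_natural_right (m : M.carrier) {Y Y' : C} (f : Y ⟶ Y') :
    (B.functor.obj m).obj ψ.pt ⊴ᵣ f ≫ (B.rightGen ψ m Y').hom =
      (B.rightGen ψ m Y).hom ≫ (B.functor.map (m ⊴ᵣ G.functor.map f)).app ψ.pt := by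
  simp only [rightGen_hom, Category.assoc, balance_inv_natural_mid]
  rw [reassoc_of% (B.right_natural_Y m ψ.pt f), ← Functor.map_comp_assoc, ψ.natural,
    Functor.map_comp_assoc]

/-- The crossing of Y ⊗ Y' decomposes by the tensor axiom of ψ. The middle associativity of N is
absorbed by `balance_right`, the two balancings combine by the pentagon, and μ cancels δ. -/
theorem rightGen_tensor (m : M.carrier) (Y Y' : C) :
    (B.rightGen ψ m (Y ⊗ Y')).hom ≫ (B.functor.map (m ⊴ᵣ δ G.functor Y Y' ≫
        (αᵣ m (G.functor.obj Y) (G.functor.obj Y')).hom)).app ψ.pt =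
      (αᵣ ((B.functor.obj m).obj ψ.pt) Y Y').hom ≫ (B.rightGen ψ m Y).hom ⊵ᵣ Y' ≫
        (B.rightGen ψ (m ⊙ᵣ G.functor.obj Y) Y').hom := by
  have h₁ := B.right_assoc m ψ.pt Y Y'
  have h₂ := B.right_natural_n m (ψ.cross Y).hom Y'
  have h₃ := B.balance_right m (G.functor.obj Y) ψ.pt Y'
  have h₄ := B.naturality_right m (G.functor.obj Y) (ψ.cross Y').hom
  have h₅ := B.pentagon m (G.functor.obj Y) (G.functor.obj Y') ψ.pt
  have h₆ := reassoc_of% (B.balance_inv_natural_mid m (δ G.functor Y Y') ψ.pt)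
  have h₇ : (B.functor.obj m).map (μ G.functor Y Y' ⊵ₗ ψ.pt) ≫
      (B.functor.obj m).map (δ G.functor Y Y' ⊵ₗ ψ.pt) = 𝟙 _ := by
    rw [← Functor.map_comp, ← MonoidalLeftAction.comp_actionHomLeft]
    simp
  have h₈ : (B.functor.obj m).map (αₗ (G.functor.obj Y) (G.functor.obj Y') ψ.pt).inv ≫
      (B.balance m (G.functor.obj Y ⊗ G.functor.obj Y') ψ.pt).inv ≫
        (B.functor.map (αᵣ m (G.functor.obj Y) (G.functor.obj Y')).hom).app ψ.pt =
      (B.balance m (G.functor.obj Y) (G.functor.obj Y' ⊙ₗ ψ.pt)).inv ≫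
        (B.balance (m ⊙ᵣ G.functor.obj Y) (G.functor.obj Y') ψ.pt).inv := by
    rw [← cancel_mono (B.balance (m ⊙ᵣ G.functor.obj Y) (G.functor.obj Y') ψ.pt).hom,
      ← cancel_mono (B.balance m (G.functor.obj Y) (G.functor.obj Y' ⊙ₗ ψ.pt)).hom]
    simp only [Category.assoc, h₅]
    simp [← Functor.map_comp]
  have h₉ : (B.right m (G.functor.obj Y ⊙ₗ ψ.pt) Y').hom ≫
      (B.functor.obj m).map (N.mid (G.functor.obj Y) ψ.pt Y').hom =
        (B.balance m (G.functor.obj Y) ψ.pt).inv ⊵ᵣ Y' ≫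
          (B.right (m ⊙ᵣ G.functor.obj Y) ψ.pt Y').hom ≫
            (B.balance m (G.functor.obj Y) (ψ.pt ⊙ᵣ Y')).hom := by
    rw [← h₃, MonoidalRightAction.inv_hom_actionHomLeft_assoc]
  simp only [rightGen_hom, ψ.tensor, Functor.map_comp, NatTrans.comp_app, Category.assoc, h₆,
    reassoc_of% h₇, reassoc_of% h₁, ← reassoc_of% h₂, reassoc_of% h₉, ← reassoc_of% h₄, h₈,
    MonoidalRightAction.comp_actionHomLeft, Iso.hom_inv_id_assoc]

theorem rightGen_unit (m : M.carrier) :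
    (B.rightGen ψ m (𝟙_ C)).hom ≫ (B.functor.map (m ⊴ᵣ η G.functor ≫ (ρᵣ m).hom)).app ψ.pt =
      (ρᵣ ((B.functor.obj m).obj ψ.pt)).hom := by
  have h₁ := reassoc_of% (B.balance_inv_natural_mid m (η G.functor) ψ.pt)
  have h₂ : (B.functor.obj m).map (ε G.functor ⊵ₗ ψ.pt) ≫
      (B.functor.obj m).map (η G.functor ⊵ₗ ψ.pt) = 𝟙 _ := by
    rw [← Functor.map_comp, ← MonoidalLeftAction.comp_actionHomLeft]
    simp
  simp only [rightGen_hom, ψ.unit, Functor.map_comp, NatTrans.comp_app, Category.assoc, h₁,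
    reassoc_of% h₂, B.triangle, Iso.inv_hom_id_assoc, B.right_unit]
  simp [← Functor.map_comp]

/-- Each of the three factors of `rightGen` commutes with the left structure: the right structure by
`left_right`, the crossing by naturality, the balancing by `left_balance`. -/
theorem rightGen_compat (X : C) (m : M.carrier) (Y : C) :
    (B.left X m ψ.pt).hom ⊵ᵣ Y ≫ (B.rightGen ψ (X ⊙ₗ m) Y).hom ≫
        (B.functor.map (M.mid X m (G.functor.obj Y)).hom).app ψ.pt =
      (P.mid X ((B.functor.obj m).obj ψ.pt) Y).hom ≫ X ⊴ₗ (B.rightGen ψ m Y).hom ≫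
        (B.left X (m ⊙ᵣ G.functor.obj Y) ψ.pt).hom := by
  have h₁ := B.left_right X m ψ.pt Y
  have h₂ := B.left_natural_n X m (ψ.cross Y).hom
  have h₃ := B.left_balance X m (G.functor.obj Y) ψ.pt
  have h₄ : (B.left X m (G.functor.obj Y ⊙ₗ ψ.pt)).hom ≫
      (B.balance (X ⊙ₗ m) (G.functor.obj Y) ψ.pt).inv ≫
        (B.functor.map (M.mid X m (G.functor.obj Y)).hom).app ψ.pt =
      X ⊴ₗ (B.balance m (G.functor.obj Y) ψ.pt).inv ≫
        (B.left X (m ⊙ᵣ G.functor.obj Y) ψ.pt).hom := by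
    rw [← cancel_epi (X ⊴ₗ (B.balance m (G.functor.obj Y) ψ.pt).hom), reassoc_of% h₃]
    simp [← NatTrans.comp_app, ← Functor.map_comp]
  simp only [rightGen_hom, Category.assoc, reassoc_of% h₁, ← reassoc_of% h₂, h₄,
    MonoidalLeftAction.actionHomRight_comp]

variable {F : TensorEnd C} (φ : Frame M F)

/-- The isomorphisms `B(pt, pt) ⊙ Y ≅ F(G(Y)) ⊙ B(pt, pt)`. -/
def prodCross (Y : C) : (B.functor.obj φ.pt).obj ψ.pt ⊙ᵣ Y ≅
    F.functor.obj (G.functor.obj Y) ⊙ₗ (B.functor.obj φ.pt).obj ψ.pt :=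
  B.rightGen ψ φ.pt Y ≪≫ (B.functor.mapIso (φ.cross (G.functor.obj Y))).app ψ.pt ≪≫
    (B.left (F.functor.obj (G.functor.obj Y)) φ.pt ψ.pt).symm

theorem prodCross_hom (Y : C) : (B.prodCross ψ φ Y).hom = (B.rightGen ψ φ.pt Y).hom ≫
    (B.functor.map (φ.cross (G.functor.obj Y)).hom).app ψ.pt ≫
      (B.left (F.functor.obj (G.functor.obj Y)) φ.pt ψ.pt).inv := rfl

theorem left_inv_natural_X {X X' : C} (f : X ⟶ X') (m : M.carrier) (n : N.carrier) :
    (B.left X m n).inv ≫ f ⊵ₗ (B.functor.obj m).obj n =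
      (B.functor.map (f ⊵ₗ m)).app n ≫ (B.left X' m n).inv := by
  rw [Iso.inv_comp_eq, ← reassoc_of% (B.left_natural_X f m n)]
  simp

/-- The product of frames of `M` and `N` is a frame of a relative tensor product. -/
def prodFrame : Frame P (F ⊗ G) where
  pt := (B.functor.obj φ.pt).obj ψ.pt
  cross := B.prodCross ψ φ
  natural {Y Y'} f := by
    change _ = (B.prodCross ψ φ Y).hom ≫ F.functor.map (G.functor.map f) ⊵ₗ _
    have h := congrArg (fun g => (B.functor.map g).app ψ.pt) (φ.natural (G.functor.map f))
    simp only [Functor.map_comp, NatTrans.comp_app] at h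
    simp only [prodCross_hom, Category.assoc, left_inv_natural_X, ← reassoc_of% h]
    rw [reassoc_of% (B.rightGen_natural_right ψ φ.pt f)]
  tensor Y Y' := by
    change (B.prodCross ψ φ (Y ⊗ Y')).hom = (αᵣ _ Y Y').hom ≫ (B.prodCross ψ φ Y).hom ⊵ᵣ Y' ≫
      (P.mid (F.functor.obj (G.functor.obj Y)) _ Y').hom ≫
        F.functor.obj (G.functor.obj Y) ⊴ₗ (B.prodCross ψ φ Y').hom ≫
      (αₗ (F.functor.obj (G.functor.obj Y)) (F.functor.obj (G.functor.obj Y')) _).inv ≫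
        (μ F.functor _ _ ≫ F.functor.map (μ G.functor Y Y')) ⊵ₗ _
    -- The tensor axiom of φ applies to G(Y) ⊗ G(Y') and not to G(Y ⊗ Y'); naturality of the
    -- crossing along δ bridges the two.
    have h₀ : (φ.cross (G.functor.obj (Y ⊗ Y'))).hom = (φ.pt ⊴ᵣ δ G.functor Y Y') ≫
        (φ.cross (G.functor.obj Y ⊗ G.functor.obj Y')).hom ≫
          F.functor.map (μ G.functor Y Y') ⊵ₗ φ.pt := by
      rw [reassoc_of% (φ.natural (δ G.functor Y Y')), ← MonoidalLeftAction.comp_actionHomLeft,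
        ← Functor.map_comp]
      simp
    have h₁ := B.rightGen_tensor ψ φ.pt Y Y'
    have h₂ := B.rightGen_natural_left ψ (φ.cross (G.functor.obj Y)).hom Y'
    have h₃ := B.rightGen_compat ψ (F.functor.obj (G.functor.obj Y)) φ.pt Y'
    have h₄ := B.left_natural_m (F.functor.obj (G.functor.obj Y)) (φ.cross (G.functor.obj Y')).hom
      ψ.pt
    have h₅ := B.left_assoc (F.functor.obj (G.functor.obj Y)) (F.functor.obj (G.functor.obj Y'))
      φ.pt ψ.pt
    have h₆ : (B.left (F.functor.obj (G.functor.obj Y)) φ.pt ψ.pt).inv ⊵ᵣ Y' ≫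
        (P.mid (F.functor.obj (G.functor.obj Y)) _ Y').hom ≫
          F.functor.obj (G.functor.obj Y) ⊴ₗ (B.rightGen ψ φ.pt Y').hom =
        (B.rightGen ψ (F.functor.obj (G.functor.obj Y) ⊙ₗ φ.pt) Y').hom ≫
          (B.functor.map (M.mid (F.functor.obj (G.functor.obj Y)) φ.pt
            (G.functor.obj Y')).hom).app ψ.pt ≫ (B.left _ _ _).inv := by
      rw [← cancel_epi ((B.left (F.functor.obj (G.functor.obj Y)) φ.pt ψ.pt).hom ⊵ᵣ Y'),
        reassoc_of% h₃]
      simp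
    have h₇ : (B.left (F.functor.obj (G.functor.obj Y)) (φ.pt ⊙ᵣ G.functor.obj Y') ψ.pt).inv ≫
        F.functor.obj (G.functor.obj Y) ⊴ₗ
          (B.functor.map (φ.cross (G.functor.obj Y')).hom).app ψ.pt =
        (B.functor.map (F.functor.obj (G.functor.obj Y) ⊴ₗ
          (φ.cross (G.functor.obj Y')).hom)).app ψ.pt ≫ (B.left _ _ _).inv := by
      rw [Iso.inv_comp_eq, ← reassoc_of% h₄]
      simp
    have h₈ : (B.left (F.functor.obj (G.functor.obj Y)) (F.functor.obj (G.functor.obj Y') ⊙ₗ φ.pt)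
          ψ.pt).inv ≫ F.functor.obj (G.functor.obj Y) ⊴ₗ
            (B.left (F.functor.obj (G.functor.obj Y')) φ.pt ψ.pt).inv ≫
        (αₗ (F.functor.obj (G.functor.obj Y)) (F.functor.obj (G.functor.obj Y'))
          ((B.functor.obj φ.pt).obj ψ.pt)).inv =
        (B.functor.map (αₗ _ _ φ.pt).inv).app ψ.pt ≫ (B.left _ _ _).inv := by
      rw [← cancel_epi (B.left _ _ _).hom, ← cancel_epi (_ ⊴ₗ (B.left _ _ _).hom),
        ← cancel_epi (αₗ _ _ _).hom]
      rw [← (reassoc_of% h₅) ((B.functor.map (αₗ _ _ φ.pt).inv).app ψ.pt ≫ (B.left _ _ _).inv),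
        ← NatTrans.comp_app_assoc, ← Functor.map_comp]
      simp
    simp only [prodCross_hom, h₀, φ.tensor, Functor.map_comp, NatTrans.comp_app, Category.assoc,
      MonoidalRightAction.comp_actionHomLeft, MonoidalLeftAction.actionHomRight_comp,
      MonoidalLeftAction.comp_actionHomLeft] at h₁ ⊢
    rw [reassoc_of% h₁, reassoc_of% h₆, ← reassoc_of% h₂, reassoc_of% h₇, reassoc_of% h₈]
    simp only [reassoc_of% (B.left_inv_natural_X), left_inv_natural_X]
  unit := by
    change (B.prodCross ψ φ (𝟙_ C)).hom = (ρᵣ _).hom ≫ (λₗ[C] _).inv ≫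
      (ε F.functor ≫ F.functor.map (ε G.functor)) ⊵ₗ _
    have h₀ : (φ.cross (G.functor.obj (𝟙_ C))).hom = (φ.pt ⊴ᵣ η G.functor) ≫
        (φ.cross (𝟙_ C)).hom ≫ F.functor.map (ε G.functor) ⊵ₗ φ.pt := by
      rw [reassoc_of% (φ.natural (η G.functor)), ← MonoidalLeftAction.comp_actionHomLeft,
        ← Functor.map_comp]
      simp
    have h₁ := B.rightGen_unit ψ φ.pt
    have h₂ : (λₗ[C] ((B.functor.obj φ.pt).obj ψ.pt)).inv =
        (B.functor.map (λₗ[C] φ.pt).inv).app ψ.pt ≫ (B.left (𝟙_ C) φ.pt ψ.pt).inv := by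
      rw [← cancel_epi (λₗ[C] ((B.functor.obj φ.pt).obj ψ.pt)).hom, Iso.hom_inv_id, B.left_unit,
        Category.assoc]
      simp [← NatTrans.comp_app_assoc, ← Functor.map_comp]
    simp only [prodCross_hom, h₀, φ.unit, Functor.map_comp, NatTrans.comp_app, Category.assoc,
      MonoidalLeftAction.comp_actionHomLeft] at h₁ ⊢
    simp only [← h₁, h₂, Category.assoc, reassoc_of% (B.left_inv_natural_X), left_inv_natural_X]

end Frame

/-- A balanced functor with compatible module structures which are natural in each variable. -/
def ofNatural (B : BalancedFunctor M N P.carrier)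
    (left : ∀ (X : C) (m : M.carrier) (n : N.carrier),
      X ⊙ₗ (B.functor.obj m).obj n ≅ (B.functor.obj (X ⊙ₗ m)).obj n)
    (right : ∀ (m : M.carrier) (n : N.carrier) (Y : C),
      (B.functor.obj m).obj n ⊙ᵣ Y ≅ (B.functor.obj m).obj (n ⊙ᵣ Y))
    (left_natural_X : ∀ {X X' : C} (f : X ⟶ X') (m : M.carrier) (n : N.carrier),
      f ⊵ₗ (B.functor.obj m).obj n ≫ (left X' m n).hom =
        (left X m n).hom ≫ (B.functor.map (f ⊵ₗ m)).app n)
    (left_natural_m : ∀ (X : C) {m m' : M.carrier} (f : m ⟶ m') (n : N.carrier),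
      X ⊴ₗ (B.functor.map f).app n ≫ (left X m' n).hom =
        (left X m n).hom ≫ (B.functor.map (X ⊴ₗ f)).app n)
    (left_natural_n : ∀ (X : C) (m : M.carrier) {n n' : N.carrier} (f : n ⟶ n'),
      X ⊴ₗ (B.functor.obj m).map f ≫ (left X m n').hom =
        (left X m n).hom ≫ (B.functor.obj (X ⊙ₗ m)).map f)
    (right_natural_m : ∀ {m m' : M.carrier} (f : m ⟶ m') (n : N.carrier) (Y : C),
      (B.functor.map f).app n ⊵ᵣ Y ≫ (right m' n Y).hom =
        (right m n Y).hom ≫ (B.functor.map f).app (n ⊙ᵣ Y))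
    (right_natural_n : ∀ (m : M.carrier) {n n' : N.carrier} (f : n ⟶ n') (Y : C),
      (B.functor.obj m).map f ⊵ᵣ Y ≫ (right m n' Y).hom =
        (right m n Y).hom ≫ (B.functor.obj m).map (f ⊵ᵣ Y))
    (right_natural_Y : ∀ (m : M.carrier) (n : N.carrier) {Y Y' : C} (f : Y ⟶ Y'),
      (B.functor.obj m).obj n ⊴ᵣ f ≫ (right m n Y').hom =
        (right m n Y).hom ≫ (B.functor.obj m).map (n ⊴ᵣ f))
    (left_assoc : ∀ (X X' : C) (m : M.carrier) (n : N.carrier),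
      (left (X ⊗ X') m n).hom ≫ (B.functor.map (αₗ X X' m).hom).app n =
        (αₗ X X' ((B.functor.obj m).obj n)).hom ≫ X ⊴ₗ (left X' m n).hom ≫
          (left X (X' ⊙ₗ m) n).hom)
    (left_unit : ∀ (m : M.carrier) (n : N.carrier), (λₗ ((B.functor.obj m).obj n)).hom =
      (left (𝟙_ C) m n).hom ≫ (B.functor.map (λₗ m).hom).app n)
    (right_assoc : ∀ (m : M.carrier) (n : N.carrier) (Y Y' : C),
      (right m n (Y ⊗ Y')).hom ≫ (B.functor.obj m).map (αᵣ n Y Y').hom =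
        (αᵣ ((B.functor.obj m).obj n) Y Y').hom ≫ (right m n Y).hom ⊵ᵣ Y' ≫
          (right m (n ⊙ᵣ Y) Y').hom)
    (right_unit : ∀ (m : M.carrier) (n : N.carrier), (ρᵣ ((B.functor.obj m).obj n)).hom =
      (right m n (𝟙_ C)).hom ≫ (B.functor.obj m).map (ρᵣ n).hom)
    (left_balance : ∀ (X : C) (m : M.carrier) (Y : C) (n : N.carrier),
      X ⊴ₗ (B.balance m Y n).hom ≫ (left X m (Y ⊙ₗ n)).hom =
        (left X (m ⊙ᵣ Y) n).hom ≫ (B.functor.map (M.mid X m Y).inv).app n ≫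
          (B.balance (X ⊙ₗ m) Y n).hom)
    (balance_right : ∀ (m : M.carrier) (X : C) (n : N.carrier) (Y : C),
      (B.balance m X n).hom ⊵ᵣ Y ≫ (right m (X ⊙ₗ n) Y).hom ≫
          (B.functor.obj m).map (N.mid X n Y).hom =
        (right (m ⊙ᵣ X) n Y).hom ≫ (B.balance m X (n ⊙ᵣ Y)).hom)
    (left_right : ∀ (X : C) (m : M.carrier) (n : N.carrier) (Y : C),
      (left X m n).hom ⊵ᵣ Y ≫ (right (X ⊙ₗ m) n Y).hom =
        (P.mid X ((B.functor.obj m).obj n) Y).hom ≫ X ⊴ₗ (right m n Y).hom ≫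
          (left X m (n ⊙ᵣ Y)).hom) : BalancedBimodFunctor M N P where
  toBalancedFunctor := B
  left := left
  right := right
  left_naturality {X X'} f {m m'} g {n n'} h := by
    rw [MonoidalLeftAction.actionHom_def, MonoidalLeftAction.actionHom_def, Category.assoc,
      MonoidalLeftAction.actionHomRight_comp, Category.assoc, left_natural_n,
      reassoc_of% left_natural_m, reassoc_of% left_natural_X]
    simp
  right_naturality {m m'} g {n n'} h {Y Y'} k := by
    rw [MonoidalRightAction.actionHom_def, MonoidalRightAction.actionHom_def, Category.assoc,
      MonoidalRightAction.comp_actionHomLeft, Category.assoc, right_natural_Y,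
      reassoc_of% right_natural_n, reassoc_of% right_natural_m]
    simp
  left_assoc := left_assoc
  left_unit := left_unit
  right_assoc := right_assoc
  right_unit := right_unit
  left_balance := left_balance
  balance_right := balance_right
  left_right := left_right

/-! ### Transport of balanced bimodule functors along bimodule functors -/

section Precomp

variable {M' N' : Bimod C} (Φ : Bimod.Hom M' M) (Ψ : Bimod.Hom N' N)

/-- Compatibility with the middle associativity inverted, the shape that occurs in the
`left_balance` axiom. -/
theorem _root_.OuterSequence.Bimod.Hom.compat_left_inv {M' : Bimod C} (Φ : Bimod.Hom M' M)
    (X : C) (m : M'.carrier) (Y : C) :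
    X ⊴ₗ δᵣ Φ.functor m Y ≫ (M.mid X (Φ.functor.obj m) Y).inv ≫ μₗ Φ.functor X m ⊵ᵣ Y =
      μₗ Φ.functor X (m ⊙ᵣ Y) ≫ Φ.functor.map (M'.mid X m Y).inv ≫ δᵣ Φ.functor (X ⊙ₗ m) Y := by
  have h₀ : (M.mid X (Φ.functor.obj m) Y).inv ≫ μₗ Φ.functor X m ⊵ᵣ Y ≫
      μᵣ Φ.functor (X ⊙ₗ m) Y ≫ Φ.functor.map (M'.mid X m Y).hom =
        X ⊴ₗ μᵣ Φ.functor m Y ≫ μₗ Φ.functor X (m ⊙ᵣ Y) := by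
    rw [Φ.compat X m Y, Iso.inv_hom_id_assoc]
  rw [← cancel_mono (μᵣ Φ.functor (X ⊙ₗ m) Y), ← cancel_mono (Φ.functor.map (M'.mid X m Y).hom)]
  simp only [Category.assoc, h₀]
  rw [← MonoidalLeftAction.actionHomRight_comp_assoc]
  simp [← Functor.map_comp]

/-- Precomposition with bimodule functors. -/
def precomp : BalancedBimodFunctor M' N' P :=
  ofNatural (B.toBalancedFunctor.precomp Φ.functor Ψ.functor)
    (fun X m n => B.left X (Φ.functor.obj m) (Ψ.functor.obj n) ≪≫
      (B.functor.mapIso (Functor.LeftLinear.μₗIso Φ.functor X m)).app (Ψ.functor.obj n))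
    (fun m n Y => B.right (Φ.functor.obj m) (Ψ.functor.obj n) Y ≪≫
      (B.functor.obj (Φ.functor.obj m)).mapIso (Functor.RightLinear.μᵣIso Ψ.functor n Y))
    (fun {X X'} f m n => by
      change f ⊵ₗ (B.functor.obj _).obj _ ≫ (B.left _ _ _).hom ≫ (B.functor.map _).app _ =
        ((B.left _ _ _).hom ≫ (B.functor.map (μₗ Φ.functor X m)).app _) ≫
          (B.functor.map (Φ.functor.map (f ⊵ₗ m))).app _
      rw [reassoc_of% (B.left_natural_X f)]
      simp only [Category.assoc, ← NatTrans.comp_app, ← Functor.map_comp, μₗ_naturality_left])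
    (fun X m m' f n => by
      change X ⊴ₗ (B.functor.map (Φ.functor.map f)).app _ ≫ (B.left _ _ _).hom ≫
        (B.functor.map _).app _ = ((B.left _ _ _).hom ≫ (B.functor.map (μₗ Φ.functor X m)).app _) ≫
          (B.functor.map (Φ.functor.map (X ⊴ₗ f))).app _
      rw [reassoc_of% (B.left_natural_m X (Φ.functor.map f))]
      simp only [Category.assoc, ← NatTrans.comp_app, ← Functor.map_comp, μₗ_naturality_right])
    (fun X m n n' f => by
      change X ⊴ₗ (B.functor.obj _).map (Ψ.functor.map f) ≫ (B.left _ _ _).hom ≫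
        (B.functor.map _).app _ = ((B.left _ _ _).hom ≫ (B.functor.map (μₗ Φ.functor X m)).app _) ≫
          (B.functor.obj _).map (Ψ.functor.map f)
      rw [reassoc_of% (B.left_natural_n X _ (Ψ.functor.map f)), Category.assoc]
      congr 1
      exact B.exchange _ _)
    (fun {m m'} f n Y => by
      change (B.functor.map (Φ.functor.map f)).app _ ⊵ᵣ Y ≫ (B.right _ _ _).hom ≫
        (B.functor.obj _).map _ = ((B.right _ _ _).hom ≫ (B.functor.obj _).map
          (μᵣ Ψ.functor n Y)) ≫ (B.functor.map (Φ.functor.map f)).app _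
      rw [reassoc_of% (B.right_natural_m (Φ.functor.map f)), Category.assoc]
      congr 1
      exact (B.exchange _ _).symm)
    (fun m n n' f Y => by
      change (B.functor.obj _).map (Ψ.functor.map f) ⊵ᵣ Y ≫ (B.right _ _ _).hom ≫
        (B.functor.obj _).map _ = ((B.right _ _ _).hom ≫ (B.functor.obj _).map
          (μᵣ Ψ.functor n Y)) ≫ (B.functor.obj _).map (Ψ.functor.map (f ⊵ᵣ Y))
      rw [reassoc_of% (B.right_natural_n _ (Ψ.functor.map f))]
      simp only [Category.assoc, ← Functor.map_comp, μᵣ_naturality_left])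
    (fun m n Y Y' f => by
      change (B.functor.obj _).obj _ ⊴ᵣ f ≫ (B.right _ _ _).hom ≫
        (B.functor.obj _).map _ = ((B.right _ _ _).hom ≫ (B.functor.obj _).map
          (μᵣ Ψ.functor n Y)) ≫ (B.functor.obj _).map (Ψ.functor.map (n ⊴ᵣ f))
      rw [reassoc_of% (B.right_natural_Y _ _ f)]
      simp only [Category.assoc, ← Functor.map_comp, μᵣ_naturality_right])
    (fun X X' m n => by
      have h := B.left_natural_m X (μₗ Φ.functor X' m) (Ψ.functor.obj n)
      change ((B.left _ _ _).hom ≫ (B.functor.map (μₗ Φ.functor (X ⊗ X') m)).app _) ≫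
        (B.functor.map (Φ.functor.map (αₗ X X' m).hom)).app _ = (αₗ X X' _).hom ≫
          X ⊴ₗ ((B.left _ _ _).hom ≫ (B.functor.map (μₗ Φ.functor X' m)).app _) ≫
            (B.left _ _ _).hom ≫ (B.functor.map (μₗ Φ.functor X (X' ⊙ₗ m))).app _
      rw [Category.assoc, ← NatTrans.comp_app, ← Functor.map_comp, μₗ_associativity]
      simp only [Functor.map_comp, NatTrans.comp_app, MonoidalLeftAction.actionHomRight_comp,
        Category.assoc, reassoc_of% h, reassoc_of% (B.left_assoc X X')])
    (fun m n => by
      change (λₗ _).hom = ((B.left _ _ _).hom ≫ (B.functor.map (μₗ Φ.functor (𝟙_ C) m)).app _) ≫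
        (B.functor.map (Φ.functor.map (λₗ m).hom)).app _
      rw [Category.assoc, ← NatTrans.comp_app, ← Functor.map_comp, ← μₗ_unitality, B.left_unit])
    (fun m n Y Y' => by
      have h := B.right_natural_n (Φ.functor.obj m) (μᵣ Ψ.functor n Y) Y'
      change ((B.right _ _ _).hom ≫ (B.functor.obj _).map (μᵣ Ψ.functor n (Y ⊗ Y'))) ≫
        (B.functor.obj _).map (Ψ.functor.map (αᵣ n Y Y').hom) = (αᵣ _ Y Y').hom ≫
          ((B.right _ _ _).hom ≫ (B.functor.obj _).map (μᵣ Ψ.functor n Y)) ⊵ᵣ Y' ≫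
            (B.right _ _ _).hom ≫ (B.functor.obj _).map (μᵣ Ψ.functor (n ⊙ᵣ Y) Y')
      rw [Category.assoc, ← Functor.map_comp, μᵣ_associativity]
      simp only [Functor.map_comp, MonoidalRightAction.comp_actionHomLeft,
        Category.assoc, reassoc_of% h, reassoc_of% (B.right_assoc)])
    (fun m n => by
      change (ρᵣ _).hom = ((B.right _ _ _).hom ≫ (B.functor.obj _).map (μᵣ Ψ.functor n (𝟙_ C))) ≫
        (B.functor.obj _).map (Ψ.functor.map (ρᵣ n).hom)
      rw [Category.assoc, ← Functor.map_comp, ← μᵣ_unitality, B.right_unit])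
    (fun X m Y n => by
      have h := congrArg (fun f => (B.functor.map f).app (Ψ.functor.obj n)) (Φ.compat_left_inv X m Y)
      simp only [Functor.map_comp, NatTrans.comp_app] at h
      change X ⊴ₗ ((B.functor.map (δᵣ Φ.functor m Y)).app _ ≫ (B.balance _ _ _).hom ≫
          (B.functor.obj _).map (μₗ Ψ.functor Y n)) ≫
        (B.left _ _ _).hom ≫ (B.functor.map (μₗ Φ.functor X m)).app _ =
        ((B.left _ _ _).hom ≫ (B.functor.map (μₗ Φ.functor X (m ⊙ᵣ Y))).app _) ≫
          (B.functor.map (Φ.functor.map (M'.mid X m Y).inv)).app _ ≫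
            (B.functor.map (δᵣ Φ.functor (X ⊙ₗ m) Y)).app _ ≫ (B.balance _ _ _).hom ≫
          (B.functor.obj _).map (μₗ Ψ.functor Y n)
      simp only [MonoidalLeftAction.actionHomRight_comp, Category.assoc]
      rw [reassoc_of% (B.left_natural_n X (Φ.functor.obj m) (μₗ Ψ.functor Y n)),
        reassoc_of% (B.left_balance X (Φ.functor.obj m) Y (Ψ.functor.obj n)),
        reassoc_of% (B.left_natural_m X (δᵣ Φ.functor m Y)), B.exchange,
        ← reassoc_of% (B.naturality_left (μₗ Φ.functor X m) Y (Ψ.functor.obj n)),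
        reassoc_of% h])
    (fun m X n Y => by
      have h := congrArg (B.functor.obj (Φ.functor.obj m)).map (Ψ.compat X n Y)
      simp only [Functor.map_comp] at h
      change ((B.functor.map (δᵣ Φ.functor m X)).app _ ≫ (B.balance _ _ _).hom ≫
          (B.functor.obj _).map (μₗ Ψ.functor X n)) ⊵ᵣ Y ≫
        ((B.right _ _ _).hom ≫ (B.functor.obj _).map (μᵣ Ψ.functor (X ⊙ₗ n) Y)) ≫
          (B.functor.obj _).map (Ψ.functor.map (N'.mid X n Y).hom) =
        ((B.right _ _ _).hom ≫ (B.functor.obj _).map (μᵣ Ψ.functor n Y)) ≫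
          (B.functor.map (δᵣ Φ.functor m X)).app _ ≫ (B.balance _ _ _).hom ≫
            (B.functor.obj _).map (μₗ Ψ.functor X (n ⊙ᵣ Y))
      simp only [MonoidalRightAction.comp_actionHomLeft, Category.assoc]
      rw [reassoc_of% (B.right_natural_n (Φ.functor.obj m) (μₗ Ψ.functor X n) Y), h,
        reassoc_of% (B.balance_right (Φ.functor.obj m) X (Ψ.functor.obj n) Y),
        reassoc_of% (B.right_natural_m (δᵣ Φ.functor m X)),
        reassoc_of% (B.exchange (δᵣ Φ.functor m X) (μᵣ Ψ.functor n Y)),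
        reassoc_of% (B.naturality_right (Φ.functor.obj m) X (μᵣ Ψ.functor n Y))])
    (fun X m n Y => by
      change ((B.left _ _ _).hom ≫ (B.functor.map (μₗ Φ.functor X m)).app _) ⊵ᵣ Y ≫
        (B.right _ _ _).hom ≫ (B.functor.obj _).map (μᵣ Ψ.functor n Y) =
        (P.mid X _ Y).hom ≫ X ⊴ₗ ((B.right _ _ _).hom ≫ (B.functor.obj _).map (μᵣ Ψ.functor n Y)) ≫
          (B.left _ _ _).hom ≫ (B.functor.map (μₗ Φ.functor X m)).app _
      simp only [MonoidalRightAction.comp_actionHomLeft, MonoidalLeftAction.actionHomRight_comp,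
        Category.assoc]
      rw [reassoc_of% (B.right_natural_m (μₗ Φ.functor X m)), ← B.exchange,
        reassoc_of% (B.left_right X (Φ.functor.obj m) (Ψ.functor.obj n) Y),
        ← reassoc_of% (B.left_natural_n X (Φ.functor.obj m) (μᵣ Ψ.functor n Y))])

end Precomp
end BalancedBimodFunctor
end BalancedBimod
end OuterSequence
end

noncomputable section

namespace OuterSequence

/-! ### Relative tensor products of the bimodule categories `M_F` -/

section TwistBalanced

open scoped MonoidalLeftAction MonoidalRightAction
open Functor.LaxMonoidal Functor.OplaxMonoidal

variable {C : Type u} [Category.{v} C] [Abelian C] [Linear ℂ C] [MonoidalCategory C]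

namespace TwistBalanced

variable {F G H : TensorEnd C} (θ : F ⊗ G ≅ H)

/-- The components `H(Y) ≅ F(G(Y))`. -/
def comp (Y : C) : H.functor.obj Y ≅ F.functor.obj (G.functor.obj Y) where
  hom := θ.inv.nat.app Y
  inv := θ.hom.nat.app Y
  hom_inv_id := TensorEnd.hom_inv_app θ.symm Y
  inv_hom_id := TensorEnd.hom_inv_app θ Y

theorem comp_natural {Y Y' : C} (f : Y ⟶ Y') : H.functor.map f ≫ (comp θ Y').hom =
    (comp θ Y).hom ≫ F.functor.map (G.functor.map f) :=
  θ.inv.nat.naturality f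

theorem comp_delta (Y Y' : C) : (comp θ (Y ⊗ Y')).hom ≫ F.functor.map (δ G.functor Y Y') ≫
    δ F.functor _ _ = δ H.functor Y Y' ≫ (comp θ Y).hom ▷ H.functor.obj Y' ≫
      F.functor.obj (G.functor.obj Y) ◁ (comp θ Y').hom :=
  TensorEnd.Hom.delta θ.inv Y Y'

theorem comp_eta : (comp θ (𝟙_ C)).hom ≫ F.functor.map (η G.functor) ≫ η F.functor =
    η H.functor :=
  TensorEnd.Hom.eta θ.inv

/-- The balancing `(m ⊗ F(X)) ⊗ F(n) ≅ m ⊗ F(X ⊗ n)`. -/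
def bal (F : TensorEnd C) (m X n : C) : (m ⊗ F.functor.obj X) ⊗ F.functor.obj n ≅
    m ⊗ F.functor.obj (X ⊗ n) :=
  (whiskerLeftIso m (Functor.Monoidal.μIso F.functor X n).symm ≪≫ (α_ _ _ _).symm).symm

theorem bal_hom (F : TensorEnd C) (m X n : C) : (bal F m X n).hom =
    (α_ m (F.functor.obj X) (F.functor.obj n)).hom ≫ m ◁ μ F.functor X n := rfl

/-- The right module structure `(m ⊗ F(n)) ⊗ H(Y) ≅ m ⊗ F(n ⊗ G(Y))`. -/
def right (m n Y : C) : (m ⊗ F.functor.obj n) ⊗ H.functor.obj Y ≅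
    m ⊗ F.functor.obj (n ⊗ G.functor.obj Y) :=
  whiskerLeftIso _ (comp θ Y) ≪≫ bal F m n (G.functor.obj Y)

theorem right_hom (m n Y : C) : (right θ m n Y).hom = (m ⊗ F.functor.obj n) ◁ (comp θ Y).hom ≫
    (α_ m (F.functor.obj n) (F.functor.obj (G.functor.obj Y))).hom ≫
      m ◁ μ F.functor n (G.functor.obj Y) := rfl

theorem right_natural_m {m m' : C} (f : m ⟶ m') (n Y : C) :
    (f ▷ F.functor.obj n) ▷ H.functor.obj Y ≫ (right θ m' n Y).hom =
      (right θ m n Y).hom ≫ f ▷ F.functor.obj (n ⊗ G.functor.obj Y) := by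
  simp only [right_hom, Category.assoc]
  rw [← whisker_exchange_assoc, associator_naturality_left_assoc, ← whisker_exchange]

theorem right_natural_n (m : C) {n n' : C} (f : n ⟶ n') (Y : C) :
    (m ◁ F.functor.map f) ▷ H.functor.obj Y ≫ (right θ m n' Y).hom =
      (right θ m n Y).hom ≫ m ◁ F.functor.map (f ▷ G.functor.obj Y) := by
  have h := congrArg (m ◁ ·) (μ_natural_left F.functor f (G.functor.obj Y))
  simp only [MonoidalCategory.whiskerLeft_comp] at h
  simp only [right_hom, Category.assoc, ← h]
  rw [← whisker_exchange_assoc, associator_naturality_middle_assoc]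

theorem right_natural_Y (m n : C) {Y Y' : C} (f : Y ⟶ Y') :
    (m ⊗ F.functor.obj n) ◁ H.functor.map f ≫ (right θ m n Y').hom =
      (right θ m n Y).hom ≫ m ◁ F.functor.map (n ◁ G.functor.map f) := by
  have h := congrArg (m ◁ ·) (μ_natural_right F.functor n (G.functor.map f))
  simp only [MonoidalCategory.whiskerLeft_comp] at h
  simp only [right_hom, Category.assoc, ← h]
  rw [← MonoidalCategory.whiskerLeft_comp_assoc, comp_natural, ← associator_naturality_right_assoc,
    MonoidalCategory.whiskerLeft_comp_assoc]

/-- Monoidality of θ splits H(Y ⊗ Y') into F(G(Y)) ⊗ F(G(Y')), and associativity of μ for F regroups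
the result. The two halves act on different tensor factors, so they may be exchanged. -/
theorem right_assoc (m n Y Y' : C) : (right θ m n (Y ⊗ Y')).hom ≫
    m ◁ F.functor.map (n ◁ δ G.functor Y Y' ≫
      (α_ n (G.functor.obj Y) (G.functor.obj Y')).inv) =
    ((m ⊗ F.functor.obj n) ◁ δ H.functor Y Y' ≫ (α_ _ _ _).inv) ≫
      (right θ m n Y).hom ▷ H.functor.obj Y' ≫ (right θ m (n ⊗ G.functor.obj Y) Y').hom := by
  have h : (comp θ (Y ⊗ Y')).hom ≫ F.functor.map (δ G.functor Y Y') =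
      (δ H.functor Y Y' ≫ (comp θ Y).hom ▷ H.functor.obj Y' ≫
        F.functor.obj (G.functor.obj Y) ◁ (comp θ Y').hom) ≫ μ F.functor _ _ := by
    rw [← comp_delta]
    simp
  have h₁ := congrArg (m ◁ ·) (μ_natural_right F.functor n (δ G.functor Y Y'))
  have h₂ := Functor.LaxMonoidal.associativity_inv F.functor n (G.functor.obj Y) (G.functor.obj Y')
  simp only [MonoidalCategory.whiskerLeft_comp] at h₁
  calc _ = (m ⊗ F.functor.obj n) ◁ ((comp θ (Y ⊗ Y')).hom ≫ F.functor.map (δ G.functor Y Y')) ≫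
        (α_ _ _ _).hom ≫ m ◁ (μ F.functor _ _ ≫ F.functor.map (α_ _ _ _).inv) := by
          simp only [right_hom, Functor.map_comp, MonoidalCategory.whiskerLeft_comp,
            Category.assoc, ← reassoc_of% h₁, associator_naturality_right_assoc]
    _ = (m ⊗ F.functor.obj n) ◁ (δ H.functor Y Y' ≫ (comp θ Y).hom ▷ H.functor.obj Y' ≫
          F.functor.obj (G.functor.obj Y) ◁ (comp θ Y').hom) ≫ (α_ _ _ _).hom ≫
        m ◁ (F.functor.obj n ◁ μ F.functor _ _ ≫ μ F.functor _ _ ≫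
          F.functor.map (α_ _ _ _).inv) := by
      rw [h]; monoidal
    _ = (m ⊗ F.functor.obj n) ◁ (δ H.functor Y Y' ≫ (comp θ Y).hom ▷ H.functor.obj Y') ⊗≫
        ((m ⊗ (F.functor.obj n ⊗ F.functor.obj (G.functor.obj Y))) ◁ (comp θ Y').hom ≫
          (m ◁ μ F.functor _ _) ▷ F.functor.obj (G.functor.obj Y')) ⊗≫ m ◁ μ F.functor _ _ := by
      rw [h₂]; monoidal
    _ = _ := by
      rw [whisker_exchange, right_hom, right_hom]; monoidal

theorem right_unit (m n : C) : (m ⊗ F.functor.obj n) ◁ η H.functor ≫ (ρ_ _).hom =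
    (right θ m n (𝟙_ C)).hom ≫ m ◁ F.functor.map (n ◁ η G.functor ≫ (ρ_ n).hom) := by
  have h := congrArg (m ◁ ·) (μ_natural_right F.functor n (η G.functor))
  simp only [MonoidalCategory.whiskerLeft_comp] at h
  rw [← comp_eta θ, right_hom]
  simp only [Functor.map_comp, MonoidalCategory.whiskerLeft_comp, Category.assoc, ← reassoc_of% h]
  have h' : m ◁ μ F.functor n (𝟙_ C) ≫ m ◁ δ F.functor n (𝟙_ C) = 𝟙 _ := by
    rw [← MonoidalCategory.whiskerLeft_comp, Functor.Monoidal.μ_δ, MonoidalCategory.whiskerLeft_id]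
  rw [Functor.Monoidal.map_rightUnitor]
  simp only [MonoidalCategory.whiskerLeft_comp, reassoc_of% h']
  monoidal

theorem left_balance (X m Y n : C) : X ◁ (bal F m Y n).hom ≫ (α_ X m _).inv =
    (α_ X (m ⊗ F.functor.obj Y) (F.functor.obj n)).inv ≫ (α_ X m _).inv ▷ F.functor.obj n ≫
      (bal F (X ⊗ m) Y n).hom := by
  simp [bal_hom]

/-- In essence the associativity of μ for F on X, n and G(Y), after θ has been moved past the
balancing. -/
theorem balance_right (m X n Y : C) : (bal F m X n).hom ▷ H.functor.obj Y ≫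
    (right θ m (X ⊗ n) Y).hom ≫ m ◁ F.functor.map (α_ X n (G.functor.obj Y)).hom =
      (right θ (m ⊗ F.functor.obj X) n Y).hom ≫ (bal F m X (n ⊗ G.functor.obj Y)).hom := by
  have h := Functor.LaxMonoidal.associativity F.functor X n (G.functor.obj Y)
  calc _ = (α_ _ _ _).hom ▷ _ ≫ ((m ◁ μ F.functor X n) ▷ H.functor.obj Y ≫
        (m ⊗ F.functor.obj (X ⊗ n)) ◁ (comp θ Y).hom) ≫ (α_ _ _ _).hom ≫
          m ◁ (μ F.functor _ _ ≫ F.functor.map (α_ _ _ _).hom) := by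
        simp only [bal_hom, right_hom]; monoidal
    _ = (α_ _ _ _).hom ▷ _ ≫ (m ⊗ (F.functor.obj X ⊗ F.functor.obj n)) ◁ (comp θ Y).hom ⊗≫
        m ◁ (μ F.functor X n ▷ _ ≫ μ F.functor _ _ ≫ F.functor.map (α_ _ _ _).hom) := by
      rw [← whisker_exchange]; monoidal
    _ = _ := by
      rw [h]; simp only [bal_hom, right_hom]; monoidal

theorem left_right (X m n Y : C) : (α_ X m (F.functor.obj n)).inv ▷ H.functor.obj Y ≫
    (right θ (X ⊗ m) n Y).hom = (α_ X (m ⊗ F.functor.obj n) (H.functor.obj Y)).hom ≫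
      X ◁ (right θ m n Y).hom ≫ (α_ X m _).inv := by
  simp only [right_hom]
  monoidal

end TwistBalanced

variable [MonoidalPreadditive C] [MonoidalLinear ℂ C] [IsFiniteSemisimple C]

open TwistBalanced in
/-- The balanced functor `(m, n) ↦ m ⊗ F(n)` of `C`-`C`-bimodule categories. -/
def twistBalanced {F G H : TensorEnd C} (θ : F ⊗ G ≅ H) :
    BalancedBimodFunctor (twist F) (twist G) (twist H) :=
  BalancedBimodFunctor.ofNatural (M := twist F) (N := twist G) (P := twist H)
    (BalancedFunctor.act (twist F) G)
    (fun (X m n : C) => (α_ X m (F.functor.obj n)).symm)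
    (fun (m n Y : C) => right θ m n Y)
    (fun {X X'} f (m n : C) => (associator_inv_naturality_left f m (F.functor.obj n)))
    (fun X {m m'} f (n : C) => associator_inv_naturality_middle (C := C) X f (F.functor.obj n))
    (fun X (m : C) {n n'} f => associator_inv_naturality_right (C := C) X m (F.functor.map f))
    (fun {m m'} f (n : C) Y => right_natural_m (C := C) θ f n Y)
    (fun (m : C) {n n'} f Y => right_natural_n (C := C) θ m f Y)
    (fun (m n : C) {Y Y'} f => right_natural_Y (C := C) θ m n f)
    (fun X X' (m n : C) => by
      change (α_ (X ⊗ X') m (F.functor.obj n)).inv ≫ (α_ X X' m).hom ▷ F.functor.obj n =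
        (α_ X X' _).hom ≫ X ◁ (α_ _ _ _).inv ≫ (α_ _ _ _).inv
      simp)
    (fun (m n : C) => by
      change (λ_ (m ⊗ F.functor.obj n)).hom = (α_ _ _ _).inv ≫ (λ_ m).hom ▷ F.functor.obj n
      simp)
    (fun (m n : C) Y Y' => right_assoc θ m n Y Y')
    (fun (m n : C) => right_unit θ m n)
    (fun X (m : C) Y (n : C) => left_balance X m Y n)
    (fun (m : C) X (n : C) Y => balance_right θ m X n Y)
    (fun X (m n : C) Y => left_right θ X m n Y)

end TwistBalanced
end OuterSequence
end

noncomputable section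

namespace OuterSequence

/-! ### Relative tensor products in terms of frames -/

section FrameProduct

open scoped MonoidalLeftAction MonoidalRightAction

variable {C : Type u} [Category.{v} C] [Abelian C] [Linear ℂ C] [MonoidalCategory C]

theorem isInvertible_of_iso {D : Type*} [Category* D] [MonoidalCategory D] {g h : D} (e : g ≅ h)
    (hg : IsInvertible g) : IsInvertible h := by
  obtain ⟨k, ⟨a⟩, ⟨b⟩⟩ := hg
  exact ⟨k, ⟨whiskerRightIso e.symm k ≪≫ a⟩, ⟨whiskerLeftIso k e.symm ≪≫ b⟩⟩

theorem isInvertible_unit {D : Type*} [Category* D] [MonoidalCategory D] :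
    IsInvertible (𝟙_ D) :=
  ⟨𝟙_ D, ⟨λ_ _⟩, ⟨λ_ _⟩⟩

variable [MonoidalPreadditive C] [MonoidalLinear ℂ C] [IsFiniteSemisimple C]

/-- The tautological frame of `M_F`. -/
def twistFrame (F : TensorEnd C) : Frame (twist F) F := TwistHom.frame (Bimod.idHom (twist F))

instance (F : TensorEnd C) : (twistFrame F).IsGenerating :=
  ⟨(isInvertible_unit (D := C)).tensorRight⟩

/-- The relative tensor product of bimodule categories with generating frames. -/
theorem isRelTensor_of_frames {M N : Bimod C} {F G H : TensorEnd C} (φ : Frame M F) (ψ : Frame N G)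
    [φ.IsGenerating] [ψ.IsGenerating] (θ : F ⊗ G ≅ H) : IsRelTensor M N (twist H) := by
  refine ⟨(twistBalanced θ).precomp (Bimod.invHom φ.toHom) (Bimod.invHom ψ.toHom), ?_⟩
  -- At the generator of N the balanced functor is m ↦ Φ⁻¹(m) ⊗ F(`ψ.invPt`), with Φ the equivalence
  -- given by φ. Since `ψ.invPt` ≅ 𝟙 and F preserves the unit, the second factor is isomorphic to 𝟙,
  -- so universality can be tested there.
  have h : (tensorRight (F.functor.obj ψ.invPt)).IsEquivalence :=
    (isInvertible_of_iso (Functor.Monoidal.εIso F.functor ≪≫ F.functor.mapIso ψ.invPtIso.symm)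
      isInvertible_unit).tensorRight
  have h' : (Bimod.invHom φ.toHom).functor.IsEquivalence := inferInstance
  exact BalancedFunctor.isUniversal_of_isEquivalence (A := (twist H).carrier) _ ψ.pt
    (hK := @Functor.isEquivalence_trans _ _ _ _ _ _ _ _ h' h)

/-- X ⊙ B(p, q) ≅ B(X ⊙ p, q) exhibits the action on the product generator as X ↦ X ⊙ p followed by
B(-, q). The latter is an equivalence because B is universal. -/
theorem prodFrame_isGenerating {M N P : Bimod C} {F G : TensorEnd C} (φ : Frame M F)
    (ψ : Frame N G) [φ.IsGenerating] [ψ.IsGenerating] (B : BalancedBimodFunctor M N P)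
    (hB : B.toBalancedFunctor.IsUniversal) : (B.prodFrame ψ φ).IsGenerating where
  isEquivalence := by
    have h := ψ.isEquivalence_eval _ hB
    refine Functor.isEquivalence_of_iso (F := MonoidalLeftAction.actionRight (C := C) φ.pt ⋙
      B.functor.flip.obj ψ.pt) (NatIso.ofComponents (fun X => (B.left X φ.pt ψ.pt).symm) ?_)
    intro X Y f
    exact (B.left_inv_natural_X f φ.pt ψ.pt).symm

end FrameProduct
end OuterSequence
end

noncomputable section

namespace OuterSequence

/-! ### Frames from generators -/

section GeneratorFrame

open scoped MonoidalLeftAction MonoidalRightAction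
open Functor.LaxMonoidal Functor.OplaxMonoidal

variable {C : Type u} [Category.{v} C] [Abelian C] [Linear ℂ C] [MonoidalCategory C]

namespace Generator

variable {M : Bimod C} {pt : M.carrier} {F : C ⥤ C} (c : ∀ Y : C, pt ⊙ᵣ Y ≅ F.obj Y ⊙ₗ pt)

/-- The isomorphisms `(m ⊙ pt) ⊙ Y ≅ (m ⊗ F(Y)) ⊙ pt`. -/
def rightIso (m Y : C) : (m ⊙ₗ pt) ⊙ᵣ Y ≅ (m ⊗ F.obj Y) ⊙ₗ pt :=
  M.mid m pt Y ≪≫ leftActIso m (c Y) ≪≫ (αₗ m (F.obj Y) pt).symm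

theorem rightIso_hom (m Y : C) : (rightIso c m Y).hom =
    (M.mid m pt Y).hom ≫ m ⊴ₗ (c Y).hom ≫ (αₗ m (F.obj Y) pt).inv := rfl

theorem rightIso_natural_left {m m' : C} (f : m ⟶ m') (Y : C) :
    (f ⊵ₗ pt) ⊵ᵣ Y ≫ (rightIso c m' Y).hom =
      (rightIso c m Y).hom ≫ (f ▷ F.obj Y) ⊵ₗ pt := by
  simp only [rightIso_hom]
  rw [reassoc_of% (M.mid_naturality_left f pt Y),
    ← MonoidalLeftAction.action_exchange_assoc]
  simp

theorem rightIso_compat (X m Y : C) : (αₗ X m pt).inv ⊵ᵣ Y ≫ (rightIso c (X ⊗ m) Y).hom ≫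
    (α_ X m (F.obj Y)).hom ⊵ₗ pt =
      (M.mid X (m ⊙ₗ pt) Y).hom ≫ X ⊴ₗ (rightIso c m Y).hom ≫ (αₗ X _ pt).inv := by
  have h₁ := M.left_pentagon_inv X m pt Y
  simp only [rightIso_hom, Category.assoc, reassoc_of% h₁]
  simp
  rw [leftAct_assoc_inv]

/-- The isomorphisms `pt ⊙ (Y ⊗ Y') ≅ (F(Y) ⊗ F(Y')) ⊙ pt`. -/
def tensorIso (Y Y' : C) : pt ⊙ᵣ (Y ⊗ Y') ≅ (F.obj Y ⊗ F.obj Y') ⊙ₗ pt :=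
  αᵣ pt Y Y' ≪≫ rightActIso (c Y) Y' ≪≫ rightIso c (F.obj Y) Y'

theorem tensorIso_hom (Y Y' : C) : (tensorIso c Y Y').hom =
    (αᵣ pt Y Y').hom ≫ (c Y).hom ⊵ᵣ Y' ≫ (rightIso c (F.obj Y) Y').hom := rfl

/-- The isomorphism `pt ⊙ 𝟙 ≅ 𝟙 ⊙ pt`. -/
def unitIso (pt : M.carrier) : pt ⊙ᵣ 𝟙_ C ≅ 𝟙_ C ⊙ₗ pt := ρᵣ pt ≪≫ (λₗ pt).symm

theorem unitIso_hom : (unitIso pt).hom = (ρᵣ[C] pt).hom ≫ (λₗ[C] pt).inv := rfl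

variable (hc : ∀ {Y Y' : C} (f : Y ⟶ Y'), pt ⊴ᵣ f ≫ (c Y').hom = (c Y).hom ≫ F.map f ⊵ₗ pt)

include hc in
theorem tensorIso_natural_left {Y Z : C} (f : Y ⟶ Z) (Y' : C) :
    pt ⊴ᵣ (f ▷ Y') ≫ (tensorIso c Z Y').hom =
      (tensorIso c Y Y').hom ≫ (F.map f ▷ F.obj Y') ⊵ₗ pt := by
  have h := congrArg (fun g => g ⊵ᵣ Y') (hc f)
  simp only [MonoidalRightAction.comp_actionHomLeft] at h
  simp only [tensorIso_hom, Category.assoc, ← rightIso_natural_left, ← reassoc_of% h]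
  simp

include hc in
theorem tensorIso_natural_right (Y : C) {Y' Z : C} (f : Y' ⟶ Z) :
    pt ⊴ᵣ (Y ◁ f) ≫ (tensorIso c Y Z).hom =
      (tensorIso c Y Y').hom ≫ (F.obj Y ◁ F.map f) ⊵ₗ pt := by
  have h := congrArg (fun g => F.obj Y ⊴ₗ g) (hc f)
  simp only [MonoidalLeftAction.actionHomRight_comp] at h
  have h' := M.mid_naturality_right (F.obj Y) pt f
  have h'' : (F.obj Y ⊴ₗ F.map f ⊵ₗ pt) ≫ (αₗ _ _ pt).inv =
    (αₗ _ _ pt).inv ≫ (F.obj Y ◁ F.map f) ⊵ₗ pt := by simp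
  simp only [tensorIso_hom, rightIso_hom, Category.assoc, ← h'', ← reassoc_of% h,
    ← reassoc_of% h']
  rw [← MonoidalRightAction.action_exchange_assoc]
  simp

/-- The two ways of moving `pt` past three objects agree. This follows from the pentagons of M for
any family of crossings, natural or not, and becomes the associativity of F. -/
theorem tensorIso_assoc (X Y Z : C) : (αᵣ pt (X ⊗ Y) Z).hom ≫ (tensorIso c X Y).hom ⊵ᵣ Z ≫
    (rightIso c (F.obj X ⊗ F.obj Y) Z).hom ≫ (α_ _ _ _).hom ⊵ₗ pt =
      pt ⊴ᵣ (α_ X Y Z).hom ≫ (αᵣ pt X (Y ⊗ Z)).hom ≫ (c X).hom ⊵ᵣ (Y ⊗ Z) ≫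
        (M.mid _ _ _).hom ≫ F.obj X ⊴ₗ (tensorIso c Y Z).hom ≫ (αₗ _ _ _).inv := by
  have h₁ := rightIso_compat c (F.obj X) (F.obj Y) Z
  have h₂ := M.mid_naturality_mid (F.obj X) (c Y).hom Z
  have h₃ := M.right_pentagon (F.obj X) pt Y Z
  have h₄ := MonoidalRightAction.actionHom_associator X Y Z pt
  rw [tensorIso_hom, rightIso_hom]
  simp only [MonoidalRightAction.comp_actionHomLeft, Category.assoc, h₁, reassoc_of% h₂]
  simp only [tensorIso_hom, MonoidalLeftAction.actionHomRight_comp, Category.assoc,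
    ← reassoc_of% h₃]
  rw [← reassoc_of% h₄]
  simp

variable (pt) [hpt : (MonoidalLeftAction.actionRight (C := C) pt).IsEquivalence]

/-- The functor `F` with `pt ⊙ Y ≅ F(Y) ⊙ pt`. -/
def functor : C ⥤ C :=
  (MonoidalRightAction.curriedAction C M.carrier).flip.obj pt ⋙
    (MonoidalLeftAction.actionRight (C := C) pt).inv

/-- The isomorphisms `pt ⊙ Y ≅ F(Y) ⊙ pt`. -/
def cross (Y : C) : pt ⊙ᵣ Y ≅ (functor pt).obj Y ⊙ₗ pt :=
  ((MonoidalLeftAction.actionRight (C := C) pt).asEquivalence.counitIso.app (pt ⊙ᵣ Y)).symm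

theorem cross_natural {Y Y' : C} (f : Y ⟶ Y') :
    pt ⊴ᵣ f ≫ (cross pt Y').hom = (cross pt Y).hom ≫ (functor pt).map f ⊵ₗ pt :=
  (MonoidalLeftAction.actionRight (C := C) pt).asEquivalence.counitIso.inv.naturality (pt ⊴ᵣ f)

/-- The unit isomorphism of `F`. -/
def epsIso : 𝟙_ C ≅ (functor pt).obj (𝟙_ C) :=
  (MonoidalLeftAction.actionRight (C := C) pt).preimageIso ((unitIso pt).symm ≪≫ cross pt (𝟙_ C))

theorem unit_cross : (unitIso pt).hom ≫ (epsIso pt).hom ⊵ₗ pt = (cross pt (𝟙_ C)).hom := by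
  have h : (epsIso pt).hom ⊵ₗ pt = _ :=
    (MonoidalLeftAction.actionRight (C := C) pt).map_preimage
      ((unitIso pt).symm ≪≫ cross pt (𝟙_ C)).hom
  simp [h]

/-- The tensor structure of `F`. -/
def muIso (Y Y' : C) : (functor pt).obj Y ⊗ (functor pt).obj Y' ≅ (functor pt).obj (Y ⊗ Y') :=
  (MonoidalLeftAction.actionRight (C := C) pt).preimageIso
    ((tensorIso (cross pt) Y Y').symm ≪≫ cross pt (Y ⊗ Y'))

theorem tensor_cross (Y Y' : C) : (tensorIso (cross pt) Y Y').hom ≫ (muIso pt Y Y').hom ⊵ₗ pt =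
    (cross pt (Y ⊗ Y')).hom := by
  have h : (muIso pt Y Y').hom ⊵ₗ pt = _ :=
    (MonoidalLeftAction.actionRight (C := C) pt).map_preimage
      ((tensorIso (cross pt) Y Y').symm ≪≫ cross pt (Y ⊗ Y')).hom
  simp [h]

/-- Each monoidal axiom for F is verified after acting on the generator, where crossings are
available. -/
theorem hom_ext {X Y : C} {f g : X ⟶ Y} (h : f ⊵ₗ pt = g ⊵ₗ pt) : f = g :=
  (MonoidalLeftAction.actionRight (C := C) pt).map_injective h

/-- The functor `F` is monoidal. -/
@[reducible] def monoidal : (functor pt).Monoidal :=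
  Functor.CoreMonoidal.toMonoidal
    { εIso := epsIso pt
      μIso := muIso pt
      μIso_hom_natural_left := fun {X Y} f X' => hom_ext pt (by
        have h := tensorIso_natural_left (cross pt) (cross_natural pt) f X'
        rw [MonoidalLeftAction.comp_actionHomLeft, MonoidalLeftAction.comp_actionHomLeft,
          ← cancel_epi (tensorIso (cross pt) X X').hom, ← reassoc_of% h, tensor_cross,
          reassoc_of% (tensor_cross pt X X'), cross_natural])
      μIso_hom_natural_right := fun {X Y} X' f => hom_ext pt (by
        have h := tensorIso_natural_right (cross pt) (cross_natural pt) X' f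
        rw [MonoidalLeftAction.comp_actionHomLeft, MonoidalLeftAction.comp_actionHomLeft,
          ← cancel_epi (tensorIso (cross pt) X' X).hom, ← reassoc_of% h, tensor_cross,
          reassoc_of% (tensor_cross pt X' X), cross_natural])
      associativity := fun X Y Z => hom_ext pt (by
        have h := reassoc_of% (tensorIso_assoc (cross pt) X Y Z)
        have h₁ := congrArg (fun g => g ⊵ᵣ Z) (tensor_cross pt X Y)
        have h₂ := congrArg (fun g => (functor pt).obj X ⊴ₗ g) (tensor_cross pt Y Z)
        have h₃ := tensor_cross pt (X ⊗ Y) Z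
        have h₄ := tensor_cross pt X (Y ⊗ Z)
        simp only [MonoidalLeftAction.actionHomRight_comp,
          MonoidalRightAction.comp_actionHomLeft] at h₁ h₂
        rw [tensorIso_hom] at h₃ h₄
        rw [rightIso_hom] at h₄
        simp only [Category.assoc] at h₃ h₄
        simp only [MonoidalLeftAction.comp_actionHomLeft]
        -- Precomposition with the isomorphism from `pt` acted on by (X ⊗ Y) ⊗ Z turns every μ into
        -- a crossing, via `tensor_cross`.
        rw [← cancel_epi ((αᵣ pt (X ⊗ Y) Z).hom ≫ (tensorIso (cross pt) X Y).hom ⊵ᵣ Z ≫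
          (rightIso (cross pt) ((functor pt).obj X ⊗ (functor pt).obj Y) Z).hom)]
        simp only [Category.assoc, ← reassoc_of% (rightIso_natural_left (cross pt)), reassoc_of% h₁,
          reassoc_of% h₃, h, ← cross_natural, ← h₄]
        simp [← reassoc_of% h₂])
      left_unitality := fun X => hom_ext pt (by
        have h₁ := congrArg (fun g => g ⊵ᵣ X) (unit_cross pt)
        have h₂ := tensor_cross pt (𝟙_ C) X
        simp only [MonoidalRightAction.comp_actionHomLeft, unitIso_hom, Category.assoc] at h₁
        rw [tensorIso_hom] at h₂
        simp only [Category.assoc] at h₂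
        simp only [MonoidalLeftAction.comp_actionHomLeft]
        rw [← cancel_epi ((αᵣ pt (𝟙_ C) X).hom ≫ (unitIso pt).hom ⊵ᵣ X ≫
          (rightIso (cross pt) (𝟙_ C) X).hom)]
        simp only [Category.assoc, ← reassoc_of% (rightIso_natural_left (cross pt)), unitIso_hom,
          MonoidalRightAction.comp_actionHomLeft, reassoc_of% h₁,
          reassoc_of% h₂, ← cross_natural]
        have h₃ : (λₗ[C] pt).inv ⊵ᵣ X ≫ (M.mid (𝟙_ C) pt X).hom = (λₗ (pt ⊙ᵣ X)).inv := by
          have h : (λₗ[C] pt).hom ⊵ᵣ X ≫ (λₗ (pt ⊙ᵣ X)).inv = (M.mid (𝟙_ C) pt X).hom := by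
            rw [M.left_triangle]; simp
          rw [← h]
          simp
        have h₄ := MonoidalRightAction.actionHom_leftUnitor X pt
        rw [rightIso_hom, Category.assoc, reassoc_of% h₃, h₄]
        simp)
      right_unitality := fun X => hom_ext pt (by
        have h₁ := congrArg (fun g => (functor pt).obj X ⊴ₗ g) (unit_cross pt)
        have h₂ := tensor_cross pt X (𝟙_ C)
        simp only [MonoidalLeftAction.actionHomRight_comp, unitIso_hom, Category.assoc] at h₁
        rw [tensorIso_hom, rightIso_hom] at h₂
        simp only [Category.assoc] at h₂
        have h₃ : ((functor pt).obj X ⊴ₗ (epsIso pt).hom ⊵ₗ pt) ≫ (αₗ _ _ pt).inv =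
          (αₗ _ _ pt).inv ≫ ((functor pt).obj X ◁ (epsIso pt).hom) ⊵ₗ pt := by simp
        have h₄ := M.right_triangle ((functor pt).obj X) pt
        have h₅ := MonoidalRightAction.actionHom_rightUnitor X pt
        simp only [MonoidalLeftAction.comp_actionHomLeft]
        rw [← cancel_epi ((αᵣ pt X (𝟙_ C)).hom ≫ (cross pt X).hom ⊵ᵣ (𝟙_ C) ≫ (M.mid _ _ _).hom ≫
          (functor pt).obj X ⊴ₗ (unitIso pt).hom ≫ (αₗ _ _ _).inv)]
        simp only [Category.assoc, ← reassoc_of% h₃, unitIso_hom,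
          MonoidalLeftAction.actionHomRight_comp]
        rw [reassoc_of% h₁, reassoc_of% h₂, ← cross_natural, h₅, ← reassoc_of% h₄]
        simp) }

variable [MonoidalPreadditive C] [MonoidalLinear ℂ C] [IsFiniteSemisimple C]

/-- The tensor functor `F` with `pt ⊙ Y ≅ F(Y) ⊙ pt`. -/
def tensorEnd : TensorEnd C :=
  have : IsCLinear (MonoidalLeftAction.actionRight (C := C) pt) := M.left_linear_flip pt
  have : IsCLinear (MonoidalLeftAction.actionRight (C := C) pt).inv :=
    BalancedFunctor.isCLinear_inv _
  have : IsCLinear ((MonoidalRightAction.curriedAction C M.carrier).flip.obj pt) :=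
    M.right_linear_flip pt
  @TensorEnd.mk C _ _ _ _ (functor pt) (monoidal pt)
    (inferInstanceAs (IsCLinear ((MonoidalRightAction.curriedAction C M.carrier).flip.obj pt ⋙
      (MonoidalLeftAction.actionRight (C := C) pt).inv)))

/-- The frame given by a generator. -/
def frame : Frame M (tensorEnd pt) where
  pt := pt
  cross := cross pt
  natural := cross_natural pt
  tensor Y Y' := by
    have h := tensor_cross pt Y Y'
    rw [tensorIso_hom, rightIso_hom] at h
    simp only [Category.assoc] at h
    exact h.symm
  unit := by
    have h := unit_cross pt
    rw [unitIso_hom, Category.assoc] at h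
    exact h.symm

instance : (frame pt).IsGenerating := ⟨hpt⟩

end Generator

/-- A bimodule category which is equivalent to `C` as a left module category has a generator. -/
theorem exists_generator {M : Bimod C} (F : M.carrier ⥤ C) [F.LeftLinear C] [F.IsEquivalence] :
    ∃ pt : M.carrier, (MonoidalLeftAction.actionRight (C := C) pt).IsEquivalence := by
  let pt : M.carrier := F.objPreimage (𝟙_ C)
  let e : F.obj pt ≅ 𝟙_ C := F.objObjPreimageIso (𝟙_ C)
  refine ⟨pt, ?_⟩
  -- F(X ⊙ pt) ≅ X ⊗ F(pt) ≅ X, so X ↦ X ⊙ pt is an equivalence after composition with the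
  -- equivalence F.
  have h₁ : (tensorRight (F.obj pt)).IsEquivalence :=
    (isInvertible_of_iso e.symm isInvertible_unit).tensorRight
  have h₂ : (MonoidalLeftAction.actionRight (C := C) pt ⋙ F).IsEquivalence :=
    Functor.isEquivalence_of_iso (F := tensorRight (F.obj pt))
      (NatIso.ofComponents (fun X => Functor.LeftLinear.μₗIso F X pt)
        (fun f => Functor.LaxLeftLinear.μₗ_naturality_left F f pt))
  exact Functor.isEquivalence_of_comp_right _ F

end GeneratorFrame
end OuterSequence
end

noncomputable section

namespace OuterSequence

/-! ### Semisimple categories -/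

section Semisimple

attribute [local instance] Abelian.hasFiniteBiproducts

variable {A : Type u} [Category.{v} A] [Abelian A] [Linear ℂ A] [IsFiniteSemisimple A]

/-- Some component of f into a simple summand of Z is nonzero, hence invertible by Schur's lemma;
projecting to that summand and inverting gives the retraction. -/
theorem exists_retraction_of_ne_zero {S Z : A} [Simple S] {f : S ⟶ Z} (hf : f ≠ 0) :
    ∃ r : Z ⟶ S, f ≫ r = 𝟙 S := by
  obtain ⟨n, T, hT, ⟨e⟩⟩ := IsFiniteSemisimple.semisimple Z
  by_contra! h
  refine hf ((cancel_mono e.hom).1 (biproduct.hom_ext _ _ fun i => ?_))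
  rw [zero_comp, zero_comp]
  by_contra hi
  have := hT i
  have := isIso_of_hom_simple hi
  refine h (e.hom ≫ biproduct.π T i ≫ inv ((f ≫ e.hom) ≫ biproduct.π T i)) ?_
  rw [← Category.assoc, ← Category.assoc, IsIso.hom_inv_id]

/-- Morphisms agree if they agree on simple subobjects. -/
theorem hom_ext_of_simple {X Y : A} {f g : X ⟶ Y}
    (h : ∀ (S : A) (_ : Simple S) (i : S ⟶ X), i ≫ f = i ≫ g) : f = g := by
  obtain ⟨n, T, hT, ⟨e⟩⟩ := IsFiniteSemisimple.semisimple X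
  refine (cancel_epi e.inv).1 (biproduct.hom_ext' _ _ fun i => ?_)
  rw [← Category.assoc, ← Category.assoc]
  exact h (T i) (hT i) _

/-- Endomorphisms of simple objects are scalars. -/
theorem exists_smul_of_simple {S : A} [Simple S] (f : S ⟶ S) : ∃ c : ℂ, c • 𝟙 S = f :=
  have := IsFiniteSemisimple.finite_hom S S
  endomorphism_simple_eq_smul_id ℂ f

variable (F : A ⥤ A) [F.Full] [F.Faithful] [IsCLinear F]

/-- Fully faithful functors preserve simple objects. -/
theorem simple_obj_of_fullyFaithful (S : A) [Simple S] : Simple (F.obj S) := by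
  obtain ⟨n, T, hT, ⟨e⟩⟩ := IsFiniteSemisimple.semisimple (F.obj S)
  obtain ⟨i⟩ : Nonempty (Fin n) := by
    by_contra hn
    rw [not_nonempty_iff] at hn
    refine id_nonzero S (F.map_injective ?_)
    rw [F.map_zero, ← cancel_mono e.hom]
    exact biproduct.hom_ext _ _ fun i => hn.elim i
  have := hT i
  obtain ⟨p, j, hjp⟩ : ∃ (p : F.obj S ⟶ T i) (j : T i ⟶ F.obj S), j ≫ p = 𝟙 _ :=
    ⟨e.hom ≫ biproduct.π T i, biproduct.ι T i ≫ e.inv, by simp⟩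
  obtain ⟨c, hc⟩ := exists_smul_of_simple (F.preimage (p ≫ j))
  -- F is full, so endomorphisms of F(S) come from those of the simple object S and are scalars.
  have hc' : p ≫ j = c • 𝟙 _ := by rw [← F.map_preimage (p ≫ j), ← hc, F.map_smul, F.map_id]
  have hc₀ : c ≠ 0 := by
    rintro rfl
    refine id_nonzero (T i) ?_
    calc 𝟙 (T i) = j ≫ (p ≫ j) ≫ p := by rw [Category.assoc, hjp, Category.comp_id, hjp]
      _ = 0 := by rw [hc', zero_smul, zero_comp, comp_zero]
  exact Simple.of_iso
    { hom := p
      inv := c⁻¹ • j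
      hom_inv_id := by rw [Linear.comp_smul, hc', smul_smul, inv_mul_cancel₀ hc₀, one_smul]
      inv_hom_id := by
        -- The scalar c is in fact 1: j ≫ (p ≫ j) equals j because j ≫ p = 𝟙, and equals c • j by
        -- `hc'`.
        have h : c • j = j := by
          conv_rhs => rw [← Category.id_comp j, ← hjp, Category.assoc, hc', Linear.comp_smul,
            Category.comp_id]
        have h' : c⁻¹ • j = j := by
          conv_lhs => rw [← h, smul_smul, inv_mul_cancel₀ hc₀, one_smul]
        rw [h', hjp] }

instance : Finite (SimpleClass A) := by
  obtain ⟨n, S, hS⟩ := IsFiniteSemisimple.finite_simple (A := A)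
  refine Set.Finite.to_subtype ((Set.finite_range fun i => toSkeleton (S i)).subset ?_)
  rintro _ ⟨X, hX, rfl⟩
  obtain ⟨i, ⟨e⟩⟩ := hS X hX
  exact ⟨i, Quotient.sound ⟨e.symm⟩⟩

/-- Pigeonhole: F acts injectively on the finite set of classes of simple objects, hence
surjectively. -/
theorem exists_simple_preimage (T : A) [hT : Simple T] :
    ∃ S : A, Simple S ∧ Nonempty (F.obj S ≅ T) := by
  let f : SimpleClass A → SimpleClass A := fun s =>
    have := s.2.choose_spec.1
    simpleClass (F.obj s.2.choose) (simple_obj_of_fullyFaithful F _)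
  have hf : Function.Injective f := by
    intro s t h
    obtain ⟨e⟩ := Quotient.exact (congrArg Subtype.val h)
    refine Subtype.ext ?_
    rw [← s.2.choose_spec.2, ← t.2.choose_spec.2]
    exact Quotient.sound ⟨F.preimageIso e⟩
  obtain ⟨s, hs⟩ := Finite.injective_iff_surjective.1 hf (simpleClass T hT)
  exact ⟨s.2.choose, s.2.choose_spec.1, Quotient.exact (congrArg Subtype.val hs)⟩

/-- Fully faithful endofunctors of finite semisimple categories are equivalences. -/
theorem isEquivalence_of_fullyFaithful : F.IsEquivalence where
  -- F is additive, so preimages of the simple summands of Y can be summed.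
  essSurj := ⟨fun Y => by
    obtain ⟨n, T, hT, ⟨e⟩⟩ := IsFiniteSemisimple.semisimple Y
    choose S hS hS' using fun i => have := hT i; exists_simple_preimage F (T i)
    exact ⟨⨁ S, ⟨F.mapBiproduct S ≪≫ biproduct.mapIso (fun i => (hS' i).some) ≪≫ e.symm⟩⟩⟩

end Semisimple

/-! ### Invertible bimodule categories give tensor auto-equivalences -/

section Faithful

open scoped MonoidalLeftAction MonoidalRightAction

variable {C : Type u} [Category.{v} C] [Abelian C] [Linear ℂ C] [MonoidalCategory C]
  [MonoidalPreadditive C] [MonoidalLinear ℂ C] [RigidCategory C] [IsFusionCategory C]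

instance : Simple (𝟙_ C) := IsFusionCategory.simple_unit

/-- The action on a nonzero object is faithful. -/
theorem eq_zero_of_actionHomRight_eq_zero {N : Bimod C} {n : N.carrier} (hn : 𝟙 n ≠ 0) {X Y : C}
    {f : X ⟶ Y} (hf : n ⊴ᵣ f = 0) : f = 0 := by
  by_contra h₀
  -- The mate of f is a morphism out of 𝟙; the zig-zag identity recovers f from it, so it is
  -- nonzero.
  have hg : η_ X Xᘁ ≫ f ▷ Xᘁ ≠ 0 := by
    intro h
    refine h₀ ?_
    calc f = (λ_ X).inv ≫ (η_ X Xᘁ ▷ X ≫ (α_ _ _ _).hom ≫ X ◁ ε_ X Xᘁ) ≫ (ρ_ X).hom ≫ f := by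
          rw [ExactPairing.evaluation_coevaluation]; simp
      _ = (λ_ X).inv ≫ (η_ X Xᘁ ≫ f ▷ Xᘁ) ▷ X ≫ (α_ _ _ _).hom ≫ Y ◁ ε_ X Xᘁ ≫ (ρ_ Y).hom := by
          rw [← rightUnitor_naturality, Category.assoc, Category.assoc, whisker_exchange_assoc]
          simp
      _ = 0 := by simp [h]
  -- As 𝟙 is simple the mate splits, and the identity of 𝟙 factors through f ▷ Xᘁ. If n ⊙ f
  -- vanishes, so does n ⊙ 𝟙 ≅ n.
  obtain ⟨r, hr⟩ := exists_retraction_of_ne_zero hg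
  have h₁ : n ⊴ᵣ (f ▷ Xᘁ) = 0 := by
    have h : (αᵣ n X Xᘁ).hom ≫ (n ⊴ᵣ f) ⊵ᵣ Xᘁ ≫ (αᵣ n Y Xᘁ).inv = n ⊴ᵣ (f ▷ Xᘁ) := by simp
    have := N.right_linear_obj (Xᘁ)
    have h' : (0 : n ⊙ᵣ X ⟶ n ⊙ᵣ Y) ⊵ᵣ Xᘁ = 0 :=
      ((MonoidalRightAction.curriedAction C N.carrier).obj Xᘁ).map_zero _ _
    rw [← h, hf, h', zero_comp, comp_zero]
  have h₂ : 𝟙 (n ⊙ᵣ 𝟙_ C) = 0 := by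
    rw [← MonoidalRightAction.actionHomRight_id, ← hr, MonoidalRightAction.actionHomRight_comp,
      MonoidalRightAction.actionHomRight_comp, h₁, comp_zero, zero_comp]
  refine hn ?_
  rw [← (ρᵣ[C] n).inv_hom_id, ← Category.id_comp (ρᵣ[C] n).hom, h₂, zero_comp, comp_zero]

/-- Stated for arbitrary objects of C, to be applied with k = B(n, pt) and the isomorphisms
`rightGen`. -/
theorem natural_of_iso_unit {a b k Y Y' : C} {f : Y ⟶ Y'} {g : a ⟶ b} (e : k ≅ 𝟙_ C)
    (i : k ⊗ Y ≅ a) (i' : k ⊗ Y' ≅ b) (h : k ◁ f ≫ i'.hom = i.hom ≫ g) :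
    g ≫ (i'.symm ≪≫ whiskerRightIso e Y' ≪≫ λ_ Y').hom =
      (i.symm ≪≫ whiskerRightIso e Y ≪≫ λ_ Y).hom ≫ f := by
  simp only [Iso.trans_hom, Iso.symm_hom, whiskerRightIso_hom]
  rw [← cancel_epi i.hom, ← reassoc_of% h, Iso.hom_inv_id_assoc, Category.assoc, Category.assoc,
    Iso.hom_inv_id_assoc, ← leftUnitor_naturality, ← whisker_exchange_assoc]

/-- The tensor functor of a generating frame of an invertible bimodule category is an
equivalence. -/
theorem Frame.isAutoEquiv {M : Bimod C} {F : TensorEnd C} (φ : Frame M F) [φ.IsGenerating]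
    (hM : IsInvertibleBimod M) : F.IsAutoEquiv := by
  -- Only the product of N with M is used, in this order, because the generator must lie in the
  -- second variable.
  obtain ⟨N, -, B, hB⟩ := hM
  have hK : (B.functor.flip.obj φ.pt).IsEquivalence := φ.isEquivalence_eval _ hB
  let K : N.carrier ⥤ C := B.functor.flip.obj φ.pt
  have hK : K.IsEquivalence := hK
  have : IsCLinear K := B.linear_flip φ.pt
  let n := K.objPreimage (𝟙_ C)
  let e : K.obj n ≅ 𝟙_ C := K.objObjPreimageIso _
  have hn : 𝟙 n ≠ 0 := by
    intro h
    refine id_nonzero (𝟙_ C) ?_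
    have h' : 𝟙 (K.obj n) = 0 := by rw [← K.map_id, h, K.map_zero]
    rw [← e.inv_hom_id, ← Category.id_comp e.hom, h', zero_comp, comp_zero]
  let T : C ⥤ N.carrier := (MonoidalRightAction.curriedAction C N.carrier).flip.obj n
  have : IsCLinear T := N.right_linear_flip n
  have hT : T.Faithful := ⟨fun {X Y f g} h => sub_eq_zero.1 (eq_zero_of_actionHomRight_eq_zero hn
    ((T.map_sub (f := f) (g := g)).trans (sub_eq_zero.2 h)))⟩
  -- B(n ⊙ F(Y), pt) ≅ B(n, pt) ⊗ Y ≅ Y by `rightGen`, since n was chosen with B(n, pt) ≅ 𝟙.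
  let i : F.functor ⋙ (T ⋙ K) ≅ 𝟭 C := (NatIso.ofComponents
      (fun Y : C => (B.rightGen φ n Y).symm ≪≫ (whiskerRightIso e Y) ≪≫ λ_ Y)
    (fun {Y Y'} f =>
      natural_of_iso_unit e (B.rightGen φ n Y) (B.rightGen φ n Y')
        (B.rightGen_natural_right φ n f)))
  have : (F.functor ⋙ (T ⋙ K)).IsEquivalence := Functor.isEquivalence_of_iso i.symm
  have : F.functor.Faithful := Functor.Faithful.of_comp F.functor (T ⋙ K)
  -- Fullness descends from the composite because T ⋙ K is faithful. Essential surjectivity does not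
  -- follow from this one-sided inverse; finite semisimplicity supplies it.
  have : F.functor.Full := Functor.Full.of_comp_faithful F.functor (T ⋙ K)
  exact isEquivalence_of_fullyFaithful F.functor

end Faithful
end OuterSequence
end

noncomputable section

namespace OuterSequence

/-! ### Isomorphism classes of objects -/

section SkeletonHom

theorem exists_toSkeleton_eq {D : Type*} [Category* D] (x : Skeleton D) :
    ∃ X : D, toSkeleton X = x :=
  Quotient.exists_rep x

variable {D : Type*} [Category* D] [MonoidalCategory D] {E : Type*} [Category* E]
  [MonoidalCategory E]

/-- A map of objects which respects isomorphisms, tensor products and the unit object induces a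
homomorphism of monoids of isomorphism classes. -/
def skeletonHom (obj : D → E) (hiso : ∀ X Y : D, (X ≅ Y) → Nonempty (obj X ≅ obj Y))
    (hunit : Nonempty (obj (𝟙_ D) ≅ 𝟙_ E))
    (htensor : ∀ X Y : D, Nonempty (obj (X ⊗ Y) ≅ obj X ⊗ obj Y)) : Skeleton D →* Skeleton E where
  toFun := Quotient.lift (fun X => toSkeleton (obj X))
    (fun X Y ⟨e⟩ => toSkeleton_eq_toSkeleton_iff.2 (hiso X Y e))
  map_one' := toSkeleton_eq_toSkeleton_iff.2 hunit
  map_mul' x y := by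
    obtain ⟨X, rfl⟩ := exists_toSkeleton_eq x
    obtain ⟨Y, rfl⟩ := exists_toSkeleton_eq y
    rw [← Skeleton.toSkeleton_tensorObj]
    refine (toSkeleton_eq_toSkeleton_iff.2 (htensor X Y)).trans ?_
    rw [Skeleton.toSkeleton_tensorObj]
    rfl

/-- A map of objects which induces a bijection on isomorphism classes and respects tensor products
induces an isomorphism of monoids of isomorphism classes. -/
def skeletonMulEquiv (obj : D → E)
    (hiso : ∀ X Y : D, Nonempty (X ≅ Y) ↔ Nonempty (obj X ≅ obj Y))
    (hsurj : ∀ Y : E, ∃ X : D, Nonempty (obj X ≅ Y))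
    (htensor : ∀ X Y : D, Nonempty (obj (X ⊗ Y) ≅ obj X ⊗ obj Y)) : Skeleton D ≃* Skeleton E :=
  let f : Skeleton D →ₙ* Skeleton E :=
    { toFun := Quotient.lift (fun X => toSkeleton (obj X))
        (fun X Y e => toSkeleton_eq_toSkeleton_iff.2 ((hiso X Y).1 e))
      map_mul' := fun x y => by
        obtain ⟨X, rfl⟩ := exists_toSkeleton_eq x
        obtain ⟨Y, rfl⟩ := exists_toSkeleton_eq y
        rw [← Skeleton.toSkeleton_tensorObj]
        refine (toSkeleton_eq_toSkeleton_iff.2 (htensor X Y)).trans ?_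
        rw [Skeleton.toSkeleton_tensorObj]
        rfl }
  MulEquiv.ofBijective f ⟨fun x y h => by
      obtain ⟨X, rfl⟩ := exists_toSkeleton_eq x
      obtain ⟨Y, rfl⟩ := exists_toSkeleton_eq y
      exact toSkeleton_eq_toSkeleton_iff.2 ((hiso X Y).2 (toSkeleton_eq_toSkeleton_iff.1 h)),
    fun y => by
      obtain ⟨Y, rfl⟩ := exists_toSkeleton_eq y
      obtain ⟨X, hX⟩ := hsurj Y
      exact ⟨toSkeleton X, toSkeleton_eq_toSkeleton_iff.2 hX⟩⟩

theorem isInvertible_of_units (u : (Skeleton D)ˣ) {X : D} (h : toSkeleton X = u) :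
    IsInvertible X := by
  obtain ⟨Y, hY⟩ := exists_toSkeleton_eq (u⁻¹ : (Skeleton D)ˣ).val
  refine ⟨Y, toSkeleton_eq_toSkeleton_iff.1 ?_, toSkeleton_eq_toSkeleton_iff.1 ?_⟩
  · rw [Skeleton.toSkeleton_tensorObj, h, hY, u.mul_inv]; rfl
  · rw [Skeleton.toSkeleton_tensorObj, h, hY, u.inv_mul]; rfl

section Core

variable {P : ObjectProperty D} [P.IsMonoidal]

theorem nonempty_iso_core_iff {X Y : Core P.FullSubcategory} :
    Nonempty (X ≅ Y) ↔ Nonempty (X.of.obj ≅ Y.of.obj) :=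
  ⟨fun ⟨e⟩ => ⟨P.ι.mapIso e.hom.iso⟩, fun ⟨e⟩ => ⟨Core.isoMk (P.isoMk e)⟩⟩

variable [IsCatGroup (Core P.FullSubcategory)]

variable (P) in
/-- The homomorphism from isomorphism classes of objects with property `P`. -/
def coreUnitsHom : PiZero (Core P.FullSubcategory) →* (Skeleton D)ˣ :=
  MonoidHom.toHomUnits (skeletonHom (fun X : Core P.FullSubcategory => X.of.obj)
    (fun _ _ e => nonempty_iso_core_iff.1 ⟨e⟩) ⟨Iso.refl _⟩ (fun _ _ => ⟨Iso.refl _⟩))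

theorem coreUnitsHom_injective : Function.Injective (coreUnitsHom P) := by
  intro x y h
  obtain ⟨X, rfl⟩ := exists_toSkeleton_eq x
  obtain ⟨Y, rfl⟩ := exists_toSkeleton_eq y
  exact toSkeleton_eq_toSkeleton_iff.2 (nonempty_iso_core_iff.2
    (toSkeleton_eq_toSkeleton_iff.1 (congrArg Units.val h)))

/-- The isomorphism classes of objects with property `P` are the invertible isomorphism classes. -/
def coreUnitsEquiv (hP : ∀ X : D, IsInvertible X → P X) :
    PiZero (Core P.FullSubcategory) ≃* (Skeleton D)ˣ :=
  MulEquiv.ofBijective (coreUnitsHom P) ⟨coreUnitsHom_injective, fun u => by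
    obtain ⟨X, hX⟩ := exists_toSkeleton_eq u.val
    exact ⟨toSkeleton (C := Core P.FullSubcategory) ⟨⟨X, hP X (isInvertible_of_units u hX)⟩⟩,
      Units.ext hX⟩⟩

end Core
end SkeletonHom

/-! ### Outer bimodule categories -/

section Outer

variable {C : Type u} [Category.{v} C] [Abelian C] [Linear ℂ C] [MonoidalCategory C]

theorem TensorEnd.isAutoEquiv_of_isInvertible {F : TensorEnd C} (hF : IsInvertible F) :
    F.IsAutoEquiv := by
  obtain ⟨G, ⟨e⟩, ⟨e'⟩⟩ := hF
  let toNat {F G : TensorEnd C} (e : F ≅ G) : F.functor ≅ G.functor :=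
    { hom := e.hom.nat
      inv := e.inv.nat
      hom_inv_id := congrArg TensorEnd.Hom.nat e.hom_inv_id
      inv_hom_id := congrArg TensorEnd.Hom.nat e.inv_hom_id }
  exact (CategoryTheory.Equivalence.mk F.functor G.functor (toNat e').symm
    (toNat e)).isEquivalence_functor

variable [MonoidalPreadditive C] [MonoidalLinear ℂ C]

section

variable [IsFiniteSemisimple C]

/-- A tensor inverse G of F gives an inverse M_G of M_F: the isomorphisms F ∘ G ≅ id ≅ G ∘ F make
the regular bimodule a relative tensor product on both sides. -/
theorem isInvertibleBimod_twist {F : TensorEnd C} (hF : F.IsAutoEquiv) :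
    IsInvertibleBimod (twist F) := by
  obtain ⟨G, -, ⟨e⟩, ⟨e'⟩⟩ := TensorEnd.isInvertible_of_isAutoEquiv hF
  exact ⟨twist G, isRelTensor_of_frames (twistFrame F) (twistFrame G) e,
    isRelTensor_of_frames (twistFrame G) (twistFrame F) e'⟩

theorem isOuter_twist {F : TensorEnd C} (hF : F.IsAutoEquiv) : IsOuter (twist F) where
  isInvertible := isInvertibleBimod_twist hF
  exists_equivalence := ⟨𝟭 C, (Bimod.leftLinearId : (𝟭 C).LeftLinear C),
    inferInstanceAs (IsCLinear (𝟭 C)), inferInstanceAs (𝟭 C).IsEquivalence⟩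

variable (C) in
theorem isOuter_regular : IsOuter (regular C) :=
  isOuter_twist (inferInstanceAs (𝟭 C).IsEquivalence)

/-- The class of a bimodule category in `π₀` is determined by bimodule equivalences. -/
theorem outMk_eq_iff {M N : Bimod C} (hM : IsOuter M) (hN : IsOuter N) :
    outMk M hM = outMk N hN ↔ ∃ Φ : Bimod.Hom M N, Φ.functor.IsEquivalence := by
  refine Quotient.eq.trans ⟨?_, ?_⟩
  · rintro ⟨f, g, ⟨e⟩, ⟨e'⟩⟩
    exact ⟨f.hom, Bimod.isEquivalence_of_iso_id f.hom (Ψ := g.hom)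
      ((Bicategory.InducedBicategory.forget (C := Bimod C)).mapFunctor _ _ |>.mapIso e)
      ((Bicategory.InducedBicategory.forget (C := Bimod C)).mapFunctor _ _ |>.mapIso e')⟩
  · rintro ⟨Φ, hΦ⟩
    exact ⟨Bicategory.InducedBicategory.mkHom Φ, Bicategory.InducedBicategory.mkHom (Bimod.invHom Φ),
      ⟨Bicategory.InducedBicategory.isoMk (Bimod.homInvIso Φ)⟩,
      ⟨Bicategory.InducedBicategory.isoMk (Bimod.invHomIso Φ)⟩⟩

theorem outMk_eq_of_frame {M : Bimod C} {F : TensorEnd C} (φ : Frame M F) [φ.IsGenerating]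
    (hF : IsOuter (twist F)) (hM : IsOuter M) : outMk (twist F) hF = outMk M hM :=
  (outMk_eq_iff hF hM).2 ⟨φ.toHom, inferInstance⟩

end

variable [RigidCategory C] [IsFusionCategory C]

/-- The left module equivalence supplies a generator and hence a frame; invertibility of M makes its
tensor functor an auto-equivalence. So every outer bimodule category is some M_F. -/
theorem IsOuter.exists_frame {M : Bimod C} (hM : IsOuter M) :
    ∃ (F : TensorEnd C) (φ : Frame M F), F.IsAutoEquiv ∧ φ.IsGenerating := by
  obtain ⟨E, hE, -, hE'⟩ := hM.exists_equivalence
  obtain ⟨pt, hpt⟩ := exists_generator E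
  exact ⟨_, Generator.frame pt, (Generator.frame pt).isAutoEquiv hM.isInvertible, inferInstance⟩

end Outer
end OuterSequence
end

noncomputable section

namespace OuterSequence

/-! ### Comparison of frames -/

section FrameUnique

open scoped MonoidalLeftAction MonoidalRightAction
open Functor.LaxMonoidal Functor.OplaxMonoidal

variable {C : Type u} [Category.{v} C] [Abelian C] [Linear ℂ C] [MonoidalCategory C]

namespace Frame

variable {M : Bimod C} {F F' : TensorEnd C}

/-- Transport of a frame along an isomorphism of objects. -/
def ofIso (φ : Frame M F) {m : M.carrier} (e : m ≅ φ.pt) : Frame M F where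
  pt := m
  cross Y := rightActIso e Y ≪≫ φ.cross Y ≪≫ (leftActIso (F.functor.obj Y) e).symm
  natural {Y Y'} f := by
    simp only [Iso.trans_hom, rightActIso_hom, Iso.symm_hom, leftActIso_inv, Category.assoc]
    rw [MonoidalRightAction.action_exchange_assoc, reassoc_of% (φ.natural f),
      MonoidalLeftAction.action_exchange]
  tensor Y Y' := by
    have h := M.mid_naturality_mid (F.functor.obj Y) e.inv Y'
    simp only [Iso.trans_hom, rightActIso_hom, Iso.symm_hom, leftActIso_inv, Category.assoc,
      MonoidalRightAction.comp_actionHomLeft, MonoidalLeftAction.actionHomRight_comp,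
      reassoc_of% h, φ.tensor, ← MonoidalLeftAction.action_exchange]
    rw [← MonoidalLeftAction.actionHomRight_comp_assoc (F.functor.obj Y) (e.inv ⊵ᵣ Y'),
      ← MonoidalRightAction.comp_actionHomLeft]
    simp
  unit := by
    simp only [Iso.trans_hom, rightActIso_hom, Iso.symm_hom, leftActIso_inv, Category.assoc,
      φ.unit, ← MonoidalLeftAction.action_exchange]
    simp

/-- A frame determines its tensor functor, given the generator. -/
theorem exists_iso_of_eq (φ : Frame M F) [hφ : φ.IsGenerating] (φ' : Frame M F')
    (h : φ'.pt = φ.pt) : ∃ θ : F ≅ F', ∀ Y,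
      ((φ.cross Y).hom ≫ θ.hom.nat.app Y ⊵ₗ φ.pt) ≫ F'.functor.obj Y ⊴ₗ eqToHom h.symm =
        eqToHom h.symm ⊵ᵣ Y ≫ (φ'.cross Y).hom := by
  obtain ⟨pt, c, natural, tensor, unit⟩ := φ
  obtain ⟨pt', c', natural', tensor', unit'⟩ := φ'
  obtain rfl : pt' = pt := h
  have hL : (MonoidalLeftAction.actionRight (C := C) pt').IsEquivalence := hφ.isEquivalence
  let L := MonoidalLeftAction.actionRight (C := C) pt'
  -- X ↦ X ⊙ pt is fully faithful, so comparing the two crossings of pt ⊙ Y defines a unique F(Y) ≅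
  -- F'(Y). Naturality and monoidality can be checked after acting on `pt`.
  let θ (Y : C) : F.functor.obj Y ≅ F'.functor.obj Y := L.preimageIso ((c Y).symm ≪≫ c' Y)
  have hθ (Y : C) : (c Y).hom ≫ (θ Y).hom ⊵ₗ pt' = (c' Y).hom := by
    have h : (θ Y).hom ⊵ₗ pt' = _ := L.map_preimage ((c Y).symm ≪≫ c' Y).hom
    simp [h]
  have ext {X Y : C} {f g : X ⟶ Y} (h : f ⊵ₗ pt' = g ⊵ₗ pt') : f = g := L.map_injective h
  let e : F.functor ≅ F'.functor := NatIso.ofComponents θ fun {Y Y'} f => ext (by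
    simp only [MonoidalLeftAction.comp_actionHomLeft]
    rw [← cancel_epi (c Y).hom, ← reassoc_of% (natural f), hθ, reassoc_of% (hθ Y), natural'])
  have : NatTrans.IsMonoidal e.hom :=
    { unit := ext (by
        change (ε F.functor ≫ (θ (𝟙_ C)).hom) ⊵ₗ pt' = _
        have h := hθ (𝟙_ C)
        rw [unit, unit'] at h
        simp only [Category.assoc] at h
        rw [MonoidalLeftAction.comp_actionHomLeft]
        exact (cancel_epi (λₗ[C] pt').inv).1 ((cancel_epi (ρᵣ[C] pt').hom).1 h))
      tensor := fun Y Y' => ext (by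
        change (μ F.functor Y Y' ≫ (θ (Y ⊗ Y')).hom) ⊵ₗ pt' =
          (((θ Y).hom ⊗ₘ (θ Y').hom) ≫ μ F'.functor Y Y') ⊵ₗ pt'
        have h := hθ (Y ⊗ Y')
        rw [tensor, tensor'] at h
        simp only [Category.assoc] at h
        have h₁ : (αₗ (F.functor.obj Y) (F.functor.obj Y') pt').inv ≫
            ((θ Y).hom ⊗ₘ (θ Y').hom) ⊵ₗ pt' = (θ Y).hom ⊵ₗ (F.functor.obj Y' ⊙ₗ pt') ≫
              F'.functor.obj Y ⊴ₗ (θ Y').hom ⊵ₗ pt' ≫ (αₗ _ _ pt').inv := by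
          simp [MonoidalCategory.tensorHom_def]
        have h₂ := M.mid_naturality_left (θ Y).hom pt' Y'
        have h₃ := congrArg (fun g => g ⊵ᵣ Y') (hθ Y)
        have h₄ := congrArg (fun g => F'.functor.obj Y ⊴ₗ g) (hθ Y')
        simp only [MonoidalLeftAction.actionHomRight_comp,
          MonoidalRightAction.comp_actionHomLeft] at h₃ h₄
        rw [MonoidalLeftAction.comp_actionHomLeft, MonoidalLeftAction.comp_actionHomLeft,
          ← cancel_epi (αₗ (F.functor.obj Y) (F.functor.obj Y') pt').inv,
          ← cancel_epi (F.functor.obj Y ⊴ₗ (c Y').hom), ← cancel_epi (M.mid _ pt' Y').hom,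
          ← cancel_epi ((c Y).hom ⊵ᵣ Y'), ← cancel_epi (αᵣ pt' Y Y').hom, h, reassoc_of% h₁,
          MonoidalLeftAction.action_exchange_assoc, ← reassoc_of% h₂, reassoc_of% h₃,
          reassoc_of% h₄]) }
  refine ⟨TensorEnd.isoMk e, fun Y => ?_⟩
  change ((c Y).hom ≫ (θ Y).hom ⊵ₗ pt') ≫ F'.functor.obj Y ⊴ₗ 𝟙 pt' = 𝟙 pt' ⊵ᵣ Y ≫ (c' Y).hom
  simp [hθ]

theorem nonempty_iso_of_eq (φ : Frame M F) [φ.IsGenerating] (φ' : Frame M F')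
    (h : φ'.pt = φ.pt) : Nonempty (F ≅ F') :=
  let ⟨θ, _⟩ := φ.exists_iso_of_eq φ' h
  ⟨θ⟩

/-- Transporting φ' along e places both frames at the same point. -/
theorem nonempty_iso (φ : Frame M F) [hφ : φ.IsGenerating] (φ' : Frame M F') (e : φ.pt ≅ φ'.pt) :
    Nonempty (F ≅ F') :=
  φ.nonempty_iso_of_eq (φ'.ofIso e) rfl

/-- Transport of a frame along an isomorphism of tensor functors. -/
def congr (φ : Frame M F) (e : F ≅ F') : Frame M F' where
  pt := φ.pt
  cross Y := φ.cross Y ≪≫ leftActIso'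
    { hom := e.hom.nat.app Y
      inv := e.inv.nat.app Y
      hom_inv_id := TensorEnd.hom_inv_app e Y
      inv_hom_id := TensorEnd.hom_inv_app e.symm Y } φ.pt
  natural {Y Y'} f := by
    have h := e.hom.nat.naturality f
    simp only [Iso.trans_hom, leftActIso'_hom, Category.assoc, reassoc_of% (φ.natural f),
      ← MonoidalLeftAction.comp_actionHomLeft, h]
  tensor Y Y' := by
    have h : μ F.functor Y Y' ≫ e.hom.nat.app (Y ⊗ Y') =
        (e.hom.nat.app Y ⊗ₘ e.hom.nat.app Y') ≫ μ F'.functor Y Y' :=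
      NatTrans.IsMonoidal.tensor Y Y'
    have h₂ := M.mid_naturality_left (e.hom.nat.app Y) φ.pt Y'
    simp only [Iso.trans_hom, leftActIso'_hom, Category.assoc, φ.tensor,
      MonoidalRightAction.comp_actionHomLeft, MonoidalLeftAction.actionHomRight_comp,
      ← MonoidalLeftAction.comp_actionHomLeft, h, reassoc_of% h₂]
    rw [← MonoidalLeftAction.action_exchange_assoc]
    simp [MonoidalCategory.tensorHom_def]
  unit := by
    have h : ε F.functor ≫ e.hom.nat.app (𝟙_ C) = ε F'.functor := NatTrans.IsMonoidal.unit
    simp only [Iso.trans_hom, leftActIso'_hom, Category.assoc, φ.unit,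
      ← MonoidalLeftAction.comp_actionHomLeft, h]

end Frame
end FrameUnique

/-! ### Conjugation and bimodule functors -/

section ConjFrame

open Functor.LaxMonoidal Functor.OplaxMonoidal

section

variable {C : Type u} [Category.{v} C] [MonoidalCategory C]

/-- Essential surjectivity gives h ⊗ g ≅ 𝟙. Then (g ⊗ h) ⊗ g ≅ g ≅ 𝟙 ⊗ g, and full faithfulness
lifts this to g ⊗ h ≅ 𝟙. -/
theorem isInvertible_of_tensorRight {g : C} (hg : (tensorRight g).IsEquivalence) :
    IsInvertible g := by
  let h := (tensorRight g).objPreimage (𝟙_ C)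
  let e : h ⊗ g ≅ 𝟙_ C := (tensorRight g).objObjPreimageIso (𝟙_ C)
  exact ⟨h, ⟨(tensorRight g).preimageIso (α_ g h g ≪≫ whiskerLeftIso g e ≪≫ ρ_ g ≪≫ (λ_ g).symm)⟩,
    ⟨e⟩⟩

variable (g : C) [HasRightDual g]

/-- The map `(g ⊗ W ⊗ g*) ⊗ g ⟶ g ⊗ W` given by the evaluation `g* ⊗ g ⟶ 𝟙`. -/
def conjContract (W : C) : (g ⊗ (W ⊗ gᘁ)) ⊗ g ⟶ g ⊗ W :=
  𝟙 _ ⊗≫ (g ⊗ W) ◁ ε_ g gᘁ ⊗≫ 𝟙 _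

theorem conjContract_natural {W W' : C} (f : W ⟶ W') :
    (g ◁ (f ▷ gᘁ)) ▷ g ≫ conjContract g W' = conjContract g W ≫ g ◁ f := by
  unfold conjContract
  calc _ = 𝟙 _ ⊗≫ g ◁ (f ▷ (gᘁ ⊗ g) ≫ W' ◁ ε_ g gᘁ) ⊗≫ 𝟙 _ := by monoidal
    _ = _ := by rw [← whisker_exchange]; monoidal

/-- The two evaluations involved act on disjoint pairs of factors, so their order is irrelevant. In
inverse form this is the tensor axiom of `conjFrame`. -/
theorem conjContract_tensor (W W' : C) : conjMu g W W' ▷ g ≫ conjContract g (W ⊗ W') =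
    (α_ _ _ _).hom ≫ (g ⊗ (W ⊗ gᘁ)) ◁ conjContract g W' ≫ (α_ _ _ _).inv ≫
      conjContract g W ▷ W' ≫ (α_ _ _ _).hom := by
  unfold conjContract conjMu
  calc _ = 𝟙 _ ⊗≫ (g ⊗ W) ◁ (ε_ g gᘁ ▷ (W' ⊗ (gᘁ ⊗ g)) ≫ 𝟙_ C ◁ (W' ◁ ε_ g gᘁ)) ⊗≫ 𝟙 _ := by
        monoidal
    _ = _ := by rw [← whisker_exchange]; monoidal

/-- A zig-zag identity for g and its dual; in inverse form, the unit axiom of `conjFrame`. -/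
theorem conjContract_unit : conjEps g ▷ g ≫ conjContract g (𝟙_ C) = (λ_ g).hom ≫ (ρ_ g).inv := by
  unfold conjContract conjEps
  calc _ = 𝟙 _ ⊗≫ (η_ g gᘁ ▷ g ⊗≫ g ◁ ε_ g gᘁ) ⊗≫ 𝟙 _ := by monoidal
    _ = _ := by rw [ExactPairing.evaluation_coevaluation'']; monoidal

variable {g}

theorem conjContract_isIso (hg : IsInvertible g) (W : C) : IsIso (conjContract g W) := by
  have := isIso_evaluation hg
  unfold conjContract
  simp only [monoidalComp]
  infer_instance

end

variable {C : Type u} [Category.{v} C] [Abelian C] [Linear ℂ C] [MonoidalCategory C]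
  [MonoidalPreadditive C] [MonoidalLinear ℂ C] [RigidCategory C] [IsFiniteSemisimple C]

/-- The isomorphisms `g ⊗ W ≅ F_g(W) ⊗ g`. -/
def conjCross {g : C} (hg : IsInvertible g) (W : C) : g ⊗ W ≅ (g ⊗ (W ⊗ gᘁ)) ⊗ g :=
  (@asIso _ _ _ _ (conjContract g W) (conjContract_isIso hg W)).symm

theorem conjCross_inv {g : C} (hg : IsInvertible g) (W : C) :
    (conjCross hg W).inv = conjContract g W := rfl

theorem conjCross_natural {g : C} (hg : IsInvertible g) {W W' : C} (f : W ⟶ W') :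
    g ◁ f ≫ (conjCross hg W').hom = (conjCross hg W).hom ≫ (g ◁ (f ▷ gᘁ)) ▷ g := by
  have h := conjContract_natural g f
  rw [← conjCross_inv hg, ← conjCross_inv hg] at h
  rw [← cancel_mono (conjCross hg W').inv, ← cancel_epi (conjCross hg W).inv, Category.assoc,
    Category.assoc, h, Iso.hom_inv_id, Iso.hom_inv_id_assoc, Category.comp_id]

/-- The frame of `M_G` given by an invertible object. -/
def conjFrame {g : C} (hg : IsInvertible g) (G : TensorEnd C) :
    Frame (twist G) (conjTensorEnd hg ⊗ G) where
  pt := g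
  cross Y := conjCross hg (G.functor.obj Y)
  natural f := conjCross_natural hg (G.functor.map f)
  tensor Y Y' := by
    change (conjCross hg (G.functor.obj (Y ⊗ Y'))).hom = (g ◁ δ G.functor Y Y' ≫ (α_ _ _ _).inv) ≫
      (conjCross hg (G.functor.obj Y)).hom ▷ G.functor.obj Y' ≫ (α_ _ _ _).hom ≫
        (g ⊗ (G.functor.obj Y ⊗ gᘁ)) ◁ (conjCross hg (G.functor.obj Y')).hom ≫ (α_ _ _ _).inv ≫
          (conjMu g (G.functor.obj Y) (G.functor.obj Y') ≫ g ◁ (μ G.functor Y Y' ▷ gᘁ)) ▷ g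
    have h := conjContract_tensor g (G.functor.obj Y) (G.functor.obj Y')
    have h' := conjContract_natural g (μ G.functor Y Y')
    rw [← cancel_mono (conjCross hg (G.functor.obj (Y ⊗ Y'))).inv, Iso.hom_inv_id]
    simp only [comp_whiskerRight, Category.assoc, conjCross_inv, h', reassoc_of% h]
    simp only [← conjCross_inv hg]
    simp [- whiskerLeft_comp, ← MonoidalCategory.whiskerLeft_comp_assoc, ← comp_whiskerRight_assoc]
  unit := by
    change (conjCross hg (G.functor.obj (𝟙_ C))).hom = (g ◁ η G.functor ≫ (ρ_ g).hom) ≫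
      (λ_ g).inv ≫ (conjEps g ≫ g ◁ (ε G.functor ▷ gᘁ)) ▷ g
    have h' := conjContract_natural g (ε G.functor)
    rw [← cancel_mono (conjCross hg (G.functor.obj (𝟙_ C))).inv, Iso.hom_inv_id]
    simp only [comp_whiskerRight, Category.assoc, conjCross_inv, h',
      reassoc_of% (conjContract_unit g)]
    simp [← MonoidalCategory.whiskerLeft_comp]

end ConjFrame
end OuterSequence
end

noncomputable section

namespace OuterSequence

/-! ### Equivalences between the bimodule categories `M_F` -/

section TwistEquivalence

open scoped MonoidalLeftAction MonoidalRightAction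
open Functor.LaxMonoidal Functor.OplaxMonoidal

variable {C : Type u} [Category.{v} C] [Abelian C] [Linear ℂ C] [MonoidalCategory C]

instance {M : Bimod C} {F F' : TensorEnd C} (φ : Frame M F) [hφ : φ.IsGenerating] (e : F ≅ F') :
    (φ.congr e).IsGenerating :=
  ⟨hφ.isEquivalence⟩

variable [MonoidalPreadditive C] [MonoidalLinear ℂ C]

section

variable [IsFiniteSemisimple C]

instance {M : Bimod C} {F : TensorEnd C} (Φ : Bimod.Hom (twist F) M) [h : Φ.functor.IsEquivalence] :
    (TwistHom.frame Φ).IsGenerating :=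
  have : (TwistHom.fn Φ).IsEquivalence := h
  ⟨Functor.isEquivalence_of_iso (TwistHom.frameNatIso Φ).symm⟩

/-- In M_G the left action on the generator is right tensoring by it, so generating means
invertible. -/
theorem Frame.isInvertible_pt {F G : TensorEnd C} (φ : Frame (twist G) F) [hφ : φ.IsGenerating] :
    IsInvertible (D := C) φ.pt :=
  isInvertible_of_tensorRight hφ.isEquivalence

variable [RigidCategory C]

instance {g : C} (hg : IsInvertible g) (G : TensorEnd C) : (conjFrame hg G).IsGenerating :=
  ⟨hg.tensorRight⟩

/-- `M_F` and `M_G` are equivalent if and only if `F` and `G` differ by a conjugation. -/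
theorem exists_equivalence_twist_iff {F G : TensorEnd C} :
    (∃ Φ : Bimod.Hom (twist F) (twist G), Φ.functor.IsEquivalence) ↔
      ∃ (g : C) (hg : IsInvertible g), Nonempty (conjTensorEnd hg ⊗ G ≅ F) := by
  constructor
  · rintro ⟨Φ, hΦ⟩
    -- The conjugating object is the image of the unit. It carries the frame of Φ over F and the
    -- conjugation frame over F_g ∘ G, and uniqueness compares the two.
    let g : C := (TwistHom.frame Φ).pt
    have hg : IsInvertible g := (TwistHom.frame Φ).isInvertible_pt
    exact ⟨g, hg, (conjFrame hg G).nonempty_iso_of_eq (TwistHom.frame Φ) rfl⟩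
  · rintro ⟨g, hg, ⟨e⟩⟩
    exact ⟨((conjFrame hg G).congr e).toHom, inferInstance⟩

/-- The composite of bimodule functors M_{F_g ∘ F_h} → M_{F_h} → C given by g and h sends 𝟙 to (𝟙 ⊗
g) ⊗ h, so g ⊗ h carries a frame over F_g ∘ F_h as well as one over F_{g ⊗ h}. -/
theorem nonempty_conjTensorEnd_tensor {g h : C} (hg : IsInvertible g) (hh : IsInvertible h)
    (hgh : IsInvertible (g ⊗ h)) :
    Nonempty (conjTensorEnd hgh ≅ conjTensorEnd hg ⊗ conjTensorEnd hh) := by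
  let Φ := (conjFrame hg (conjTensorEnd hh)).toHom
  let Ψ := ((conjFrame hh (𝟙_ (TensorEnd C))).congr (ρ_ _)).toHom
  let φ := TwistHom.frame (Bimod.compHom Φ Ψ)
  obtain ⟨e⟩ := (conjFrame hgh (𝟙_ (TensorEnd C))).nonempty_iso φ
    (whiskerRightIso (λ_ g).symm h)
  exact ⟨(ρ_ _).symm ≪≫ e⟩

end

/-- A frame is determined by its crossing isomorphisms up to the choice of the generator. -/
theorem Frame.exists_iso_of_pt {M : Bimod C} {F F' : TensorEnd C} (φ : Frame M F)
    [hφ : φ.IsGenerating] (φ' : Frame M F') (e : φ.pt ≅ φ'.pt) :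
    ∃ θ : F ≅ F', ∀ Y, (φ.cross Y).hom ≫ θ.hom.nat.app Y ⊵ₗ φ.pt ≫
      F'.functor.obj Y ⊴ₗ e.hom = e.hom ⊵ᵣ Y ≫ (φ'.cross Y).hom := by
  obtain ⟨θ, hθ⟩ := φ.exists_iso_of_eq (φ'.ofIso e) rfl
  refine ⟨θ, fun Y => ?_⟩
  have h : ((φ.cross Y).hom ≫ θ.hom.nat.app Y ⊵ₗ φ.pt) ≫ F'.functor.obj Y ⊴ₗ 𝟙 φ.pt =
      𝟙 φ.pt ⊵ᵣ Y ≫ e.hom ⊵ᵣ Y ≫ (φ'.cross Y).hom ≫ F'.functor.obj Y ⊴ₗ e.inv := hθ Y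
  rw [MonoidalLeftAction.actionHomRight_id, Category.comp_id,
    MonoidalRightAction.id_actionHomLeft, Category.id_comp] at h
  rw [reassoc_of% h]
  simp [← MonoidalLeftAction.actionHomRight_comp]

theorem actionHomRight_unit_injective {A : Type*} [Category* A] [MonoidalLeftAction C A] {a b : A}
    {f g : a ⟶ b} (h : 𝟙_ C ⊴ₗ f = 𝟙_ C ⊴ₗ g) : f = g := by
  rw [← cancel_epi (λₗ[C] a).hom, MonoidalLeftAction.actionUnitIso_hom_naturality,
    MonoidalLeftAction.actionUnitIso_hom_naturality, h]

variable [IsFiniteSemisimple C]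

/-- The bimodule functors given by two frames are isomorphic if and only if the frames are. -/
theorem Frame.nonempty_toHom_iso_iff {M : Bimod C} {F : TensorEnd C} (φ φ' : Frame M F) :
    Nonempty (φ.toHom ≅ φ'.toHom) ↔ ∃ e : φ.pt ≅ φ'.pt, ∀ Y,
      (φ.cross Y).hom ≫ F.functor.obj Y ⊴ₗ e.hom = e.hom ⊵ᵣ Y ≫ (φ'.cross Y).hom := by
  constructor
  · rintro ⟨α⟩
    let a (X : C) : X ⊙ₗ φ.pt ⟶ X ⊙ₗ φ'.pt := α.hom.nat.app X
    let b (X : C) : X ⊙ₗ φ'.pt ⟶ X ⊙ₗ φ.pt := α.inv.nat.app X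
    have hab (X : C) : a X ≫ b X = 𝟙 _ :=
      NatTrans.congr_app (congrArg Bimod.Hom₂.nat α.hom_inv_id) X
    have hba (X : C) : b X ≫ a X = 𝟙 _ :=
      NatTrans.congr_app (congrArg Bimod.Hom₂.nat α.inv_hom_id) X
    have ha {X X' : C} (f : X ⟶ X') : f ⊵ₗ φ.pt ≫ a X' = a X ≫ f ⊵ₗ φ'.pt :=
      α.hom.nat.naturality f
    have hl (X m : C) : (αₗ X m φ.pt).inv ≫ a (X ⊗ m) = X ⊴ₗ a m ≫ (αₗ X m φ'.pt).inv :=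
      α.hom.left X m
    have hr (m Y : C) : (φ.rightIso m Y).hom ≫ a (m ⊗ F.functor.obj Y) =
        a m ⊵ᵣ Y ≫ (φ'.rightIso m Y).hom :=
      α.hom.right m Y
    let e : φ.pt ≅ φ'.pt := (λₗ[C] φ.pt).symm ≪≫ ⟨a (𝟙_ C), b (𝟙_ C), hab _, hba _⟩ ≪≫ λₗ[C] φ'.pt
    -- Left linearity: a bimodule transformation is determined by its component at 𝟙.
    have he (X : C) : a X = X ⊴ₗ e.hom := by
      have h₁ : (ρ_ X).inv ⊵ₗ φ.pt ≫ a (X ⊗ 𝟙_ C) ≫ (ρ_ X).hom ⊵ₗ φ'.pt = a X := by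
        rw [reassoc_of% (ha (ρ_ X).inv), ← MonoidalLeftAction.comp_actionHomLeft, Iso.inv_hom_id,
          MonoidalLeftAction.id_actionHomLeft, Category.comp_id]
      have h₂ := hl X (𝟙_ C)
      rw [Iso.inv_comp_eq] at h₂
      have h₃ : (ρ_ X).inv ⊵ₗ φ.pt ≫ (αₗ X (𝟙_ C) φ.pt).hom = X ⊴ₗ (λₗ[C] φ.pt).inv := by
        rw [← cancel_mono (X ⊴ₗ (λₗ[C] φ.pt).hom), Category.assoc,
          ← MonoidalLeftAction.rightUnitor_actionHom, ← MonoidalLeftAction.comp_actionHomLeft,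
          ← MonoidalLeftAction.actionHomRight_comp]
        simp
      rw [← h₁, h₂, Category.assoc, reassoc_of% h₃]
      simp [e]
    -- Right linearity at m = 𝟙 gives the compatibility of e with the crossings, up to the action of
    -- 𝟙, which is faithful.
    refine ⟨e, fun Y => actionHomRight_unit_injective (C := C) ?_⟩
    have h := hr (𝟙_ C) Y
    have h' := M.mid_naturality_mid (𝟙_ C) e.hom Y
    simp only [he, Frame.rightIso_hom, reassoc_of% h'] at h
    rw [Category.assoc, cancel_epi, Category.assoc,
      ← cancel_mono (αₗ (𝟙_ C) (F.functor.obj Y) φ'.pt).hom] at h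
    simpa using h
  · rintro ⟨e, he⟩
    have hnat {X Y : C} (f : X ⟶ Y) : f ⊵ₗ φ.pt ≫ Y ⊴ₗ e.hom = X ⊴ₗ e.hom ≫ f ⊵ₗ φ'.pt :=
      (MonoidalLeftAction.action_exchange f e.hom).symm
    refine ⟨Bimod.isoMk (NatIso.ofComponents (fun m : C => leftActIso m e) fun f => ?_)
      (fun X (m : C) => ?_) (fun (m : C) Y => ?_)⟩
    · exact hnat f
    · change (αₗ X m φ.pt).inv ≫ (X ⊗ m) ⊴ₗ e.hom = X ⊴ₗ m ⊴ₗ e.hom ≫ (αₗ X m φ'.pt).inv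
      simp
    · change (φ.rightIso m Y).hom ≫ (m ⊗ F.functor.obj Y) ⊴ₗ e.hom =
        (m ⊴ₗ e.hom) ⊵ᵣ Y ≫ (φ'.rightIso m Y).hom
      have h := congrArg (m ⊴ₗ ·) (he Y)
      simp only [MonoidalLeftAction.actionHomRight_comp] at h
      simp only [Frame.rightIso_hom, reassoc_of% (M.mid_naturality_mid m e.hom Y), Category.assoc,
        ← reassoc_of% h]
      simp

/-- A bimodule endofunctor of `C` which preserves the unit object is given by an automorphism of
the identity functor. -/
theorem exists_iso_twistHom (Φ : regular C ⟶ regular C) (e : unitImage Φ ≅ 𝟙_ C) :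
    ∃ θ : 𝟙_ (TensorEnd C) ≅ 𝟙_ (TensorEnd C), Nonempty (twistHom θ ≅ Φ) := by
  obtain ⟨θ, hθ⟩ := (twistFrame (𝟙_ (TensorEnd C))).exists_iso_of_pt (TwistHom.frame Φ) e.symm
  -- The right structure of `twistHom` uses the inverse of its argument, so inverting θ makes the
  -- crossing at 𝟙 involve θ itself.
  refine ⟨θ.symm, ?_⟩
  have ⟨i⟩ := ((TwistHom.frame (twistHom θ.symm)).nonempty_toHom_iso_iff (TwistHom.frame Φ)).2
    ⟨e.symm, fun Y => ?_⟩
  · exact ⟨(TwistHom.frameIso _).symm ≪≫ i ≪≫ TwistHom.frameIso Φ⟩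
  · refine Eq.trans ?_ (hθ Y)
    have h (f : Y ⟶ Y) (k : Y ⊗ 𝟙_ C ⟶ Y ⊗ unitImage Φ) :
        (𝟙_ C ◁ f ≫ ((λ_ Y).hom ≫ (ρ_ Y).inv) ≫ 𝟙 (Y ⊗ 𝟙_ C)) ≫ k =
          (𝟙 (𝟙_ C ⊗ Y) ≫ ((λ_ Y).hom ≫ (ρ_ Y).inv) ≫ 𝟙 (Y ⊗ 𝟙_ C)) ≫ f ▷ 𝟙_ C ≫ k := by
      simp
    exact h _ _

end TwistEquivalence
end OuterSequence
end

noncomputable section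

namespace OuterSequence

/-! ### The Drinfeld center -/

section CenterFrame

open scoped MonoidalLeftAction MonoidalRightAction
open Functor.LaxMonoidal Functor.OplaxMonoidal

/-- The tensor axiom at (𝟙, 𝟙) and naturality along 𝟙 ⊗ 𝟙 ≅ 𝟙 express one copy of β at 𝟙 as two;
cancelling an invertible copy leaves the unitors. It supplies the unit axiom of the frame. -/
theorem halfBraiding_unit {C : Type u} [Category.{v} C] [MonoidalCategory C] {X : C}
    (b : HalfBraiding X) : (b.β (𝟙_ C)).hom = (ρ_ X).hom ≫ (λ_ X).inv := by
  have h₁ := b.monoidal (𝟙_ C) (𝟙_ C)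
  have h₂ := b.naturality (λ_ (𝟙_ C)).hom
  rw [h₁] at h₂
  have h₃ : X ◁ (λ_ (𝟙_ C)).hom ≫ (b.β (𝟙_ C)).hom =
      (α_ _ _ _).inv ≫ (b.β (𝟙_ C)).hom ▷ 𝟙_ C ≫ (ρ_ _).hom := by
    rw [MonoidalCategory.rightUnitor_naturality, ← Category.assoc]
    congr 1
    monoidal
  rw [h₃, Category.assoc, Category.assoc, cancel_epi, cancel_epi] at h₂
  calc (b.β (𝟙_ C)).hom = (λ_ _).inv ≫ (α_ _ _ _).inv ≫ ((α_ (𝟙_ C) X (𝟙_ C)).hom ≫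
        𝟙_ C ◁ (b.β (𝟙_ C)).hom ≫ (α_ (𝟙_ C) (𝟙_ C) X).inv ≫ (λ_ (𝟙_ C)).hom ▷ X) ≫ 𝟙 _ := by
        monoidal
    _ = _ := by
      simp only [Category.assoc] at h₂
      rw [← h₂]
      monoidal

variable {C : Type u} [Category.{v} C] [Abelian C] [Linear ℂ C] [MonoidalCategory C]
  [MonoidalPreadditive C] [MonoidalLinear ℂ C] [IsFiniteSemisimple C]

/-- The frame of the regular bimodule category given by an object of the Drinfeld center. -/
def centerFrame (z : Center C) : Frame (regular C) (𝟙_ (TensorEnd C)) where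
  pt := z.1
  cross Y := z.2.β Y
  natural f := z.2.naturality f
  tensor Y Y' := by
    change (z.2.β (Y ⊗ Y')).hom = (z.1 ◁ 𝟙 _ ≫ (α_ z.1 Y Y').inv) ≫ (z.2.β Y).hom ▷ Y' ≫
      (α_ _ _ _).hom ≫ Y ◁ (z.2.β Y').hom ≫ (α_ _ _ _).inv ≫ 𝟙 (Y ⊗ Y') ▷ z.1
    rw [z.2.monoidal]
    simp
  unit := by
    change (z.2.β (𝟙_ C)).hom = (z.1 ◁ 𝟙 _ ≫ (ρ_ z.1).hom) ≫ (λ_ z.1).inv ≫ 𝟙 (𝟙_ C) ▷ z.1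
    rw [halfBraiding_unit]
    simp

/-- The object of the Drinfeld center given by a frame of the regular bimodule category. -/
def Frame.center (φ : Frame (regular C) (𝟙_ (TensorEnd C))) : Center C :=
  ⟨φ.pt,
    { β := fun Y => φ.cross Y
      naturality := fun f => φ.natural f
      monoidal := fun Y Y' => by
        have h (pt : C) (c : ∀ Y : C, pt ⊗ Y ≅ Y ⊗ pt) (h : (c (Y ⊗ Y')).hom =
            (pt ◁ 𝟙 _ ≫ (α_ pt Y Y').inv) ≫ (c Y).hom ▷ Y' ≫
              (α_ _ _ _).hom ≫ Y ◁ (c Y').hom ≫ (α_ _ _ _).inv ≫ 𝟙 (Y ⊗ Y') ▷ pt) :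
            (c (Y ⊗ Y')).hom = (α_ _ _ _).inv ≫ ((c Y).hom ▷ Y') ≫ (α_ _ _ _).hom ≫
              (Y ◁ (c Y').hom) ≫ (α_ _ _ _).inv := by
          simpa using h
        exact h φ.pt φ.cross (φ.tensor Y Y') }⟩

/-- Compatibility with half-braidings is literally compatibility of an isomorphism of generators
with the crossings. -/
theorem nonempty_center_iso_iff (z z' : Center C) :
    Nonempty (z ≅ z') ↔ Nonempty ((centerFrame z).toHom ≅ (centerFrame z').toHom) := by
  rw [Frame.nonempty_toHom_iso_iff]
  constructor
  · rintro ⟨i⟩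
    exact ⟨⟨i.hom.f, i.inv.f, congrArg Center.Hom.f i.hom_inv_id,
      congrArg Center.Hom.f i.inv_hom_id⟩, fun Y => (i.hom.comm Y).symm⟩
  · rintro ⟨e, he⟩
    let e' : z.1 ≅ z'.1 := e
    have he' : ∀ Y, (z.2.β Y).hom ≫ Y ◁ e'.hom = e'.hom ▷ Y ≫ (z'.2.β Y).hom := he
    let f : z ⟶ z' := ⟨e'.hom, fun Y => (he' Y).symm⟩
    have : IsIso f.f := inferInstanceAs (IsIso e'.hom)
    exact ⟨Center.isoMk f⟩

/-- The composite functor sends 𝟙 to (𝟙 ⊗ z) ⊗ z', and its crossing is the half-braiding of z ⊗ z'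
up to coherence. -/
theorem nonempty_center_tensor (z z' : Center C) :
    Nonempty ((centerFrame (z ⊗ z')).toHom ≅
      Bimod.compHom (centerFrame z).toHom (centerFrame z').toHom) := by
  obtain ⟨e⟩ := ((centerFrame (z ⊗ z')).nonempty_toHom_iso_iff (TwistHom.frame
    (Bimod.compHom (centerFrame z).toHom (centerFrame z').toHom))).2
      ⟨whiskerRightIso (λ_ z.1).symm z'.1, fun Y => by
        change ((α_ z.1 z'.1 Y).hom ≫ z.1 ◁ (z'.2.β Y).hom ≫ (α_ _ _ _).inv ≫
            (z.2.β Y).hom ▷ z'.1 ≫ (α_ _ _ _).hom) ≫ Y ◁ ((λ_ z.1).inv ▷ z'.1) =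
          ((λ_ z.1).inv ▷ z'.1) ▷ Y ≫ (((α_ (𝟙_ C ⊗ z.1) z'.1 Y).hom ≫
            (𝟙_ C ⊗ z.1) ◁ (z'.2.β Y).hom ≫ (α_ _ _ _).inv) ≫
              ((α_ _ _ _).hom ≫ 𝟙_ C ◁ (z.2.β Y).hom ≫ (α_ _ _ _).inv) ▷ z'.1) ≫
                (((λ_ Y).hom ≫ (ρ_ Y).inv) ▷ z.1) ▷ z'.1 ≫
                  (α_ _ _ _).hom ▷ z'.1 ≫ (α_ _ _ _).hom
        monoidal⟩
  exact ⟨e ≪≫ TwistHom.frameIso _⟩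

/-- Isomorphism classes of objects of the Drinfeld center are isomorphism classes of bimodule
endofunctors of `C`. -/
def centerMulEquivOut (h : IsOuter (regular C)) :
    Skeleton (Center C) ≃* Skeleton (EndMonoidal (outUnit h)) :=
  skeletonMulEquiv (E := EndMonoidal (outUnit h))
    (fun z => Bicategory.InducedBicategory.mkHom (centerFrame z).toHom)
    (fun z z' => (nonempty_center_iso_iff z z').trans
      ⟨fun ⟨e⟩ => ⟨Bicategory.InducedBicategory.isoMk e⟩,
        fun ⟨e⟩ => ⟨(Bicategory.InducedBicategory.forget (C := Bimod C)).mapFunctor _ _ |>.mapIso e⟩⟩)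
    (fun Φ => ⟨(TwistHom.frame Φ.hom).center,
      ⟨Bicategory.InducedBicategory.isoMk (TwistHom.frameIso Φ.hom)⟩⟩)
    (fun z z' => (nonempty_center_tensor z z').map Bicategory.InducedBicategory.isoMk)

/-- Isomorphism classes of objects of the Drinfeld center are isomorphism classes of bimodule
endofunctors of `C`. -/
def centerMulEquivBrPic (h : IsInvertibleBimod (regular C)) :
    Skeleton (Center C) ≃* Skeleton (EndMonoidal (brPicUnit h)) :=
  skeletonMulEquiv (E := EndMonoidal (brPicUnit h))
    (fun z => Bicategory.InducedBicategory.mkHom (centerFrame z).toHom)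
    (fun z z' => (nonempty_center_iso_iff z z').trans
      ⟨fun ⟨e⟩ => ⟨Bicategory.InducedBicategory.isoMk e⟩,
        fun ⟨e⟩ => ⟨(Bicategory.InducedBicategory.forget (C := Bimod C)).mapFunctor _ _ |>.mapIso e⟩⟩)
    (fun Φ => ⟨(TwistHom.frame Φ.hom).center,
      ⟨Bicategory.InducedBicategory.isoMk (TwistHom.frameIso Φ.hom)⟩⟩)
    (fun z z' => (nonempty_center_tensor z z').map Bicategory.InducedBicategory.isoMk)

end CenterFrame
end OuterSequence
end

noncomputable section

namespace OuterSequence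

/-! ### Automorphisms of the identity functor and characters of the universal grading group -/

section Characters

open Functor.LaxMonoidal Functor.OplaxMonoidal

variable {C : Type u} [Category.{v} C] [Abelian C] [Linear ℂ C] [MonoidalCategory C]
  [MonoidalPreadditive C] [MonoidalLinear ℂ C]

/-- The component at `X` of a monoidal automorphism of the identity functor. -/
def autComponent (θ : Aut (𝟙_ (TensorEnd C))) (X : C) : X ⟶ X := θ.hom.nat.app X

section

variable (θ θ' : Aut (𝟙_ (TensorEnd C)))

theorem autComponent_natural {X Y : C} (f : X ⟶ Y) :
    f ≫ autComponent θ Y = autComponent θ X ≫ f :=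
  θ.hom.nat.naturality f

theorem autComponent_tensor (X Y : C) :
    autComponent θ (X ⊗ Y) = autComponent θ X ⊗ₘ autComponent θ Y := by
  have h : 𝟙 _ ≫ autComponent θ (X ⊗ Y) = (autComponent θ X ⊗ₘ autComponent θ Y) ≫ 𝟙 _ :=
    NatTrans.IsMonoidal.tensor (τ := θ.hom.nat) X Y
  simpa using h

theorem autComponent_mul (X : C) :
    autComponent (θ * θ') X = autComponent θ' X ≫ autComponent θ X := rfl

theorem autComponent_comp_inv (X : C) : autComponent θ X ≫ autComponent θ⁻¹ X = 𝟙 X :=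
  TensorEnd.hom_inv_app θ X

variable {θ θ'} in
theorem autComponent_ext (h : ∀ X : C, autComponent θ X = autComponent θ' X) : θ = θ' :=
  Iso.ext (TensorEnd.hom_ext h)

end

theorem simple_smul_id_injective {X : C} [Simple X] {a b : ℂ} (h : a • 𝟙 X = b • 𝟙 X) : a = b :=
  smul_left_injective ℂ (id_nonzero X) h

section

variable [IsFiniteSemisimple C] (θ : Aut (𝟙_ (TensorEnd C)))

theorem exists_autComponent_eq (X : C) [Simple X] : ∃ c : ℂˣ, autComponent θ X = (c : ℂ) • 𝟙 X := by
  obtain ⟨c, hc⟩ := exists_smul_of_simple (autComponent θ X)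
  have h₀ : c ≠ 0 := by
    rintro rfl
    have h := autComponent_comp_inv θ X
    rw [← hc, zero_smul, zero_comp] at h
    exact id_nonzero X h.symm
  exact ⟨Units.mk0 c h₀, hc.symm⟩

/-- The scalar by which an automorphism of the identity functor acts on a simple object. -/
def autScalar (s : SimpleClass C) : ℂˣ :=
  have := s.2.choose_spec.1
  (exists_autComponent_eq θ s.2.choose).choose

/-- The scalar is defined on a chosen representative of the class; naturality along an isomorphism
carries it to X. -/
theorem autComponent_of_simple (X : C) (hX : Simple X) :
    autComponent θ X = (autScalar θ (simpleClass X hX) : ℂ) • 𝟙 X := by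
  have hs := (simpleClass X hX).2.choose_spec
  have := hs.1
  obtain ⟨e⟩ := toSkeleton_eq_toSkeleton_iff.1 hs.2
  have h : autComponent θ (simpleClass X hX).2.choose =
      (autScalar θ (simpleClass X hX) : ℂ) • 𝟙 _ :=
    (exists_autComponent_eq θ (simpleClass X hX).2.choose).choose_spec
  have h' := autComponent_natural θ e.hom
  rw [h, Linear.smul_comp, Category.id_comp] at h'
  rw [← cancel_epi e.hom, h', Linear.comp_smul, Category.comp_id]

theorem autScalar_eq_iff {X : C} (hX : Simple X) (c : ℂˣ) :
    autScalar θ (simpleClass X hX) = c ↔ autComponent θ X = (c : ℂ) • 𝟙 X := by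
  rw [autComponent_of_simple θ X hX]
  exact ⟨fun h => by rw [h], fun h => Units.ext (simple_smul_id_injective h)⟩

/-- The character of the universal grading group given by an automorphism of the identity
functor. -/
def autCharacter : UGroup C →* ℂˣ :=
  PresentedGroup.toGroup (f := autScalar θ) (by
    rintro _ ⟨X, Y, Z, hX, hY, hZ, f, hf, rfl⟩
    simp only [map_mul, map_inv, FreeGroup.lift_apply_of]
    rw [mul_inv_eq_one]
    -- Along f : Z ⟶ X ⊗ Y, naturality equates the scalar of Z with the product of those of X and Y,
    -- multiplied by f; as f ≠ 0 the scalars agree.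
    have h := autComponent_natural θ f
    rw [autComponent_tensor, autComponent_of_simple θ X hX, autComponent_of_simple θ Y hY,
      autComponent_of_simple θ Z hZ] at h
    simp only [MonoidalCategory.tensorHom_def, MonoidalLinear.smul_whiskerRight,
      MonoidalLinear.whiskerLeft_smul, id_whiskerRight, MonoidalCategory.whiskerLeft_id,
      Linear.smul_comp, Linear.comp_smul, Category.comp_id, Category.id_comp, smul_smul] at h
    exact Units.ext (smul_left_injective ℂ hf (by simpa [mul_comm] using h)))

theorem autCharacter_of (s : SimpleClass C) :
    autCharacter θ (PresentedGroup.of s) = autScalar θ s :=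
  PresentedGroup.toGroup.of _

end

/-! ### From characters to automorphisms of the identity functor -/

section

attribute [local instance] Abelian.hasFiniteBiproducts

variable [IsFiniteSemisimple C] (χ χ' : UGroup C →* ℂˣ)

/-- The value of a character at a simple object. -/
def charValue (X : C) (hX : Simple X) : ℂ := χ (PresentedGroup.of (simpleClass X hX))

theorem charValue_congr {X Y : C} (hX : Simple X) (hY : Simple Y) (e : X ≅ Y) :
    charValue χ X hX = charValue χ Y hY := by
  have h : simpleClass X hX = simpleClass Y hY := Subtype.ext (toSkeleton_eq_toSkeleton_iff.2 ⟨e⟩)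
  rw [charValue, charValue, h]

theorem charValue_tensor {X Y Z : C} (hX : Simple X) (hY : Simple Y) (hZ : Simple Z)
    {f : Z ⟶ X ⊗ Y} (hf : f ≠ 0) :
    charValue χ X hX * charValue χ Y hY = charValue χ Z hZ := by
  have h : (PresentedGroup.of (simpleClass X hX) * PresentedGroup.of (simpleClass Y hY) *
      (PresentedGroup.of (simpleClass Z hZ))⁻¹ : UGroup C) = 1 :=
    PresentedGroup.one_of_mem ⟨X, Y, Z, hX, hY, hZ, f, hf, rfl⟩
  rw [mul_inv_eq_one] at h
  have h' := congrArg (fun x => (χ x : ℂ)) h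
  simpa [charValue] using h'

/-- Act on each simple summand of X by its character value. A morphism from a simple S into a
summand is zero or an isomorphism, so S sees only its own value. This property characterizes the
endomorphism without reference to the decomposition. -/
theorem exists_charEndo (X : C) :
    ∃ t : X ⟶ X, ∀ (S : C) (hS : Simple S) (i : S ⟶ X), i ≫ t = charValue χ S hS • i := by
  obtain ⟨n, T, hT, ⟨e⟩⟩ := IsFiniteSemisimple.semisimple X
  refine ⟨e.hom ≫ biproduct.map (fun i => charValue χ (T i) (hT i) • 𝟙 (T i)) ≫ e.inv,
    fun S hS i => ?_⟩
  rw [← cancel_mono e.hom]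
  refine biproduct.hom_ext _ _ fun j => ?_
  simp only [Category.assoc, Iso.inv_hom_id, Category.comp_id, biproduct.map_π, Linear.comp_smul,
    Linear.smul_comp]
  by_cases h : i ≫ e.hom ≫ biproduct.π T j = 0
  · rw [h, smul_zero, smul_zero]
  · have := hT j
    have := isIso_of_hom_simple h
    rw [charValue_congr χ hS (hT j) (asIso (i ≫ e.hom ≫ biproduct.π T j))]

/-- The endomorphism of `X` given by a character of the universal grading group. -/
def charEndo (X : C) : X ⟶ X := (exists_charEndo χ X).choose

theorem comp_charEndo {S X : C} (hS : Simple S) (i : S ⟶ X) :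
    i ≫ charEndo χ X = charValue χ S hS • i :=
  (exists_charEndo χ X).choose_spec S hS i

theorem charEndo_of_simple {X : C} (hX : Simple X) :
    charEndo χ X = charValue χ X hX • 𝟙 X := by
  rw [← comp_charEndo, Category.id_comp]

theorem charEndo_natural {X Y : C} (f : X ⟶ Y) : f ≫ charEndo χ Y = charEndo χ X ≫ f :=
  hom_ext_of_simple fun S hS i => by
    rw [← Category.assoc, comp_charEndo χ hS, ← Category.assoc, comp_charEndo χ hS,
      Linear.smul_comp]

theorem charEndo_mul (X : C) : charEndo (χ * χ') X = charEndo χ X ≫ charEndo χ' X :=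
  hom_ext_of_simple fun S hS i => by
    rw [← Category.assoc]
    simp only [comp_charEndo _ hS, smul_smul]
    exact congrArg (· • i) (mul_comm _ _)

theorem charEndo_one (X : C) : charEndo (1 : UGroup C →* ℂˣ) X = 𝟙 X :=
  hom_ext_of_simple fun S hS i => by
    rw [comp_charEndo _ hS, Category.comp_id]
    exact one_smul _ _

theorem charEndo_comp_inv (X : C) : charEndo χ X ≫ charEndo χ⁻¹ X = 𝟙 X := by
  rw [← charEndo_mul]
  exact (congrArg (charEndo · X) (mul_inv_cancel χ)).trans (charEndo_one X)

theorem charEndo_inv_comp (X : C) : charEndo χ⁻¹ X ≫ charEndo χ X = 𝟙 X := by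
  rw [← charEndo_mul]
  exact (congrArg (charEndo · X) (inv_mul_cancel χ)).trans (charEndo_one X)

variable [RigidCategory C]

/-- Morphisms out of a tensor product agree if they agree on tensor products of simple objects. -/
theorem tensor_hom_ext_of_simple {X Y W : C} {f g : X ⊗ Y ⟶ W}
    (h : ∀ (S : C) (_ : Simple S) (T : C) (_ : Simple T) (i : S ⟶ X) (j : T ⟶ Y),
      (i ⊗ₘ j) ≫ f = (i ⊗ₘ j) ≫ g) : f = g := by
  -- Duality makes f and g morphisms out of X alone, tested on simple subobjects; the left dual of S
  -- then does the same for Y.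
  refine (tensorRightHomEquiv X Y Yᘁ W).injective (hom_ext_of_simple fun S hS i => ?_)
  have h₁ (k : X ⊗ Y ⟶ W) : i ≫ tensorRightHomEquiv X Y Yᘁ W k =
      tensorRightHomEquiv S Y Yᘁ W (i ▷ Y ≫ k) := by
    rw [← Equiv.symm_apply_eq, tensorRightHomEquiv_symm_naturality, Equiv.symm_apply_apply]
  rw [h₁, h₁]
  congr 1
  refine (tensorLeftHomEquiv Y (ᘁS) S W).injective (hom_ext_of_simple fun T hT j => ?_)
  have h₂ (k : S ⊗ Y ⟶ W) : j ≫ tensorLeftHomEquiv Y (ᘁS) S W k =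
      tensorLeftHomEquiv T (ᘁS) S W (S ◁ j ≫ k) := by
    rw [← Equiv.symm_apply_eq, tensorLeftHomEquiv_symm_naturality, Equiv.symm_apply_apply]
  rw [h₂, h₂]
  congr 1
  have h₃ := h S hS T hT i j
  rw [MonoidalCategory.tensorHom_def'] at h₃
  simpa using h₃

/-- By naturality it suffices to treat simple S and T. Every simple U with a nonzero map to S ⊗ T
has value χ(S)χ(T) by the defining relations, so the endomorphism of S ⊗ T is that scalar. -/
theorem charEndo_tensor (X Y : C) :
    charEndo χ (X ⊗ Y) = charEndo χ X ⊗ₘ charEndo χ Y := by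
  refine tensor_hom_ext_of_simple fun S hS T hT i j => ?_
  rw [charEndo_natural, MonoidalCategory.tensorHom_comp_tensorHom, comp_charEndo χ hS,
    comp_charEndo χ hT]
  have h : charEndo χ (S ⊗ T) = (charValue χ S hS * charValue χ T hT) • 𝟙 _ :=
    hom_ext_of_simple fun U hU k => by
      rw [comp_charEndo χ hU, Linear.comp_smul, Category.comp_id]
      by_cases hk : k = 0
      · rw [hk, smul_zero, smul_zero]
      · rw [charValue_tensor χ hS hT hU hk]
  rw [h]
  simp [MonoidalCategory.tensorHom_def, smul_smul, mul_comm]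

end

variable [RigidCategory C] [IsFusionCategory C]

/-- 𝟙 occurs in 𝟙 ⊗ 𝟙, so χ(𝟙)² = χ(𝟙), and χ(𝟙) is nonzero. -/
theorem charEndo_unit (χ : UGroup C →* ℂˣ) : charEndo χ (𝟙_ C) = 𝟙 (𝟙_ C) := by
  have hS : Simple (𝟙_ C) := inferInstance
  have h := charValue_tensor χ hS hS hS (f := (λ_ (𝟙_ C)).inv) (fun h => id_nonzero (𝟙_ C) (by
    rw [← (λ_ (𝟙_ C)).inv_hom_id, h, zero_comp]))
  have h₀ : charValue χ (𝟙_ C) hS ≠ 0 := (χ _).ne_zero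
  rw [charEndo_of_simple χ hS, mul_right_eq_self₀.1 h |>.resolve_right h₀, one_smul]

/-- The automorphism of the identity functor given by a character. -/
def charAut (χ : UGroup C →* ℂˣ) : Aut (𝟙_ (TensorEnd C)) :=
  @TensorEnd.isoMk C _ _ _ _ (𝟙_ (TensorEnd C)) (𝟙_ (TensorEnd C))
    (NatIso.ofComponents (F := 𝟭 C) (G := 𝟭 C)
      (fun X => ⟨charEndo χ X, charEndo χ⁻¹ X, charEndo_comp_inv χ X, charEndo_inv_comp χ X⟩) (fun f => charEndo_natural χ f))
    { unit := (Category.id_comp _).trans (charEndo_unit χ)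
      tensor := fun X Y => (Category.id_comp _).trans
        ((charEndo_tensor χ X Y).trans (Category.comp_id _).symm) }

theorem charEndo_autCharacter (θ : Aut (𝟙_ (TensorEnd C))) (X : C) :
    charEndo (autCharacter θ) X = autComponent θ X :=
  hom_ext_of_simple fun S hS i => by
    rw [comp_charEndo _ hS, autComponent_natural, autComponent_of_simple θ S hS, Linear.smul_comp,
      Category.id_comp, charValue, autCharacter_of]

/-- Monoidal automorphisms of the identity functor are the characters of the universal grading
group. -/
def autEquivCharacter : Aut (𝟙_ (TensorEnd C)) ≃* (UGroup C →* ℂˣ) where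
  toFun := autCharacter
  invFun := charAut
  left_inv θ := autComponent_ext fun X => charEndo_autCharacter θ X
  right_inv χ := PresentedGroup.ext fun ⟨_, X, hX, rfl⟩ => by
    rw [autCharacter_of]
    exact (autScalar_eq_iff _ hX _).2 (charEndo_of_simple χ hX)
  map_mul' θ θ' := PresentedGroup.ext fun ⟨_, X, hX, rfl⟩ => by
    rw [MonoidHom.mul_apply]
    simp only [autCharacter_of]
    refine (autScalar_eq_iff _ hX _).2 ?_
    rw [autComponent_mul, autComponent_of_simple θ X hX, autComponent_of_simple θ' X hX]
    simp [smul_smul, simpleClass]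

theorem autEquivCharacter_spec (θ : Aut (𝟙_ (TensorEnd C))) (X : C) (hX : Simple X) :
    autComponent θ X =
      (autEquivCharacter θ (PresentedGroup.of (simpleClass X hX)) : ℂ) • 𝟙 X := by
  rw [autComponent_of_simple θ X hX]
  change _ = (autCharacter θ _ : ℂ) • _
  rw [autCharacter_of]

end Characters
end OuterSequence
end

noncomputable section

namespace OuterSequence

/-! ### The maps between the groups `π₁` and `π₂` -/

section Underlying

variable {D : Type u} [Category.{v} D] [MonoidalCategory D]

/-- An isomorphism in `InvCat D` from an isomorphism of the underlying objects. -/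
def InvCat.isoMk {g h : InvCat D} (e : g.toObj ≅ h.toObj) : g ≅ h :=
  Core.isoMk (ObjectProperty.isoMk _ e)

theorem InvCat.iso_ext {g h : InvCat D} {φ ψ : g ≅ h}
    (w : (InvCat.iso φ.hom).hom = (InvCat.iso ψ.hom).hom) : φ = ψ :=
  Iso.ext (Core.hom_ext (ObjectProperty.hom_ext _ w))

variable {C : Type u} [Category.{v} C] [Preadditive C] [Linear ℂ C] [MonoidalCategory C]

/-- An isomorphism in `EqCat C` from an isomorphism of tensor functors. -/
def EqCat.isoMk {F G : EqCat C} (e : F.tensorEnd ≅ G.tensorEnd) : F ≅ G :=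
  Core.isoMk (ObjectProperty.isoMk _ e)

theorem EqCat.iso_ext {F G : EqCat C} {θ θ' : F ≅ G}
    (w : ∀ X, (EqCat.iso θ.hom).hom.nat.app X = (EqCat.iso θ'.hom).hom.nat.app X) : θ = θ' :=
  Iso.ext (Core.hom_ext (ObjectProperty.hom_ext _ (TensorEnd.hom_ext w)))

variable (C) in
/-- `π₁` of `EqCat C` is the group of monoidal automorphisms of the identity functor. -/
def piOneEqEquiv : PiOne (EqCat C) ≃* Aut (𝟙_ (TensorEnd C)) where
  toFun θ := EqCat.iso θ.hom
  invFun e := EqCat.isoMk e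
  left_inv _ := EqCat.iso_ext fun _ => rfl
  right_inv _ := rfl
  map_mul' _ _ := Iso.ext rfl

end Underlying

/-! ### Scalars, conjugation on π₁, and evaluation on π₂ -/

section PiOneMaps

open scoped MonoidalLeftAction MonoidalRightAction

variable {C : Type u} [Category.{v} C] [Abelian C] [Linear ℂ C] [MonoidalCategory C]
  [MonoidalPreadditive C] [MonoidalLinear ℂ C]

/-- Scalar automorphisms. -/
def scalarIso (X : C) (c : ℂˣ) : X ≅ X where
  hom := (c : ℂ) • 𝟙 X
  inv := ((c⁻¹ : ℂˣ) : ℂ) • 𝟙 X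
  hom_inv_id := by simp [smul_smul]
  inv_hom_id := by simp [smul_smul]

/-- Scalar automorphisms of the unit object. -/
def scalarHom : ℂˣ →* PiOne (InvCat C) where
  toFun c := InvCat.isoMk (scalarIso (𝟙_ C) c)
  map_one' := InvCat.iso_ext (one_smul ℂ (𝟙 (𝟙_ C)))
  map_mul' c c' := InvCat.iso_ext (by
    change ((c * c' : ℂˣ) : ℂ) • 𝟙 (𝟙_ C) = ((c' : ℂ) • 𝟙 (𝟙_ C)) ≫ ((c : ℂ) • 𝟙 (𝟙_ C))
    simp [smul_smul])

variable [RigidCategory C]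

theorem rightAdjointMate_smul_id (X : C) (c : ℂ) : (c • 𝟙 X)ᘁ = c • 𝟙 Xᘁ := by
  rw [← rightAdjointMate_id (X := X)]
  simp [rightAdjointMate]

/-- The scalar on g and its inverse on the dual cancel by bilinearity of the tensor product. -/
theorem conjMap_smul_id (g : C) (c : ℂˣ) (X : C) :
    (conjMap ((c : ℂ) • 𝟙 g) ((((c⁻¹ : ℂˣ) : ℂ) • 𝟙 g)ᘁ)).app X = 𝟙 (g ⊗ (X ⊗ gᘁ)) := by
  change ((c : ℂ) • 𝟙 g) ⊗ₘ (X ◁ (((c⁻¹ : ℂˣ) : ℂ) • 𝟙 g)ᘁ) = 𝟙 (g ⊗ (X ⊗ gᘁ))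
  rw [rightAdjointMate_smul_id]
  simp [MonoidalCategory.tensorHom_def, smul_smul]

variable [IsFusionCategory C]

theorem scalarHom_bijective : Function.Bijective (scalarHom (C := C)) := by
  refine ⟨fun c c' h => Units.ext (simple_smul_id_injective (X := 𝟙_ C) ?_), fun φ => ?_⟩
  · exact congrArg (fun φ : PiOne (InvCat C) => (InvCat.iso φ.hom).hom) h
  · obtain ⟨c, hc⟩ := exists_smul_of_simple (S := 𝟙_ C) (InvCat.iso φ.hom).hom
    have h₀ : c ≠ 0 := by
      rintro rfl
      have h : (InvCat.iso φ.hom).hom ≫ (InvCat.iso φ.hom).inv = 𝟙 (𝟙_ C) := Iso.hom_inv_id _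
      refine id_nonzero (𝟙_ C) (h.symm.trans ?_)
      refine (congrArg (· ≫ (InvCat.iso φ.hom).inv) hc.symm).trans ?_
      change ((0 : ℂ) • 𝟙 (𝟙_ C)) ≫ _ = _
      rw [zero_smul, zero_comp]
    exact ⟨Units.mk0 c h₀, InvCat.iso_ext hc⟩

variable (C) in
/-- Automorphisms of the unit object are scalars. -/
def piOneInvEquiv : PiOne (InvCat C) ≃* ℂˣ :=
  (MulEquiv.ofBijective scalarHom scalarHom_bijective).symm

theorem piOneInvEquiv_spec (φ : PiOne (InvCat C)) :
    (InvCat.iso φ.hom).hom = (piOneInvEquiv C φ : ℂ) • 𝟙 (𝟙_ C) := by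
  obtain ⟨c, rfl⟩ := (piOneInvEquiv C).symm.surjective φ
  rw [MulEquiv.apply_symm_apply]
  rfl

/-- All automorphisms of the unit are scalars, and conjugation by a scalar is trivial. Hence the
induced map on π₁ is trivial, whatever the identification of units. -/
theorem conj_mapIso_eq_refl (φ : PiOne (InvCat C)) :
    (conj C).mapIso φ = Iso.refl ((conj C).obj (𝟙_ (InvCat C))) := by
  obtain ⟨c, rfl⟩ := scalarHom_bijective.2 φ
  refine EqCat.iso_ext fun X => ?_
  exact conjMap_smul_id (𝟙_ (InvCat C)).toObj c X

/-- The map `π₁(Inv) → π₁(Eq)` induced by conjugation. -/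
def conjPiOne (ι : 𝟙_ (EqCat C) ≅ (conj C).obj (𝟙_ (InvCat C))) :
    PiOne (InvCat C) →* PiOne (EqCat C) :=
  MonoidHom.mk' (fun φ => ι ≪≫ (conj C).mapIso φ ≪≫ ι.symm) fun φ ψ => by
    simp only [conj_mapIso_eq_refl, Iso.refl_trans, Iso.self_symm_id]
    exact (one_mul 1).symm

theorem conjPiOne_apply (ι : 𝟙_ (EqCat C) ≅ (conj C).obj (𝟙_ (InvCat C))) (φ : PiOne (InvCat C)) :
    conjPiOne ι φ = 1 := by
  change ι ≪≫ (conj C).mapIso φ ≪≫ ι.symm = _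
  simp only [conj_mapIso_eq_refl, Iso.refl_trans, Iso.self_symm_id]
  rfl

variable (h : IsOuter (regular C))

/-- The component at `𝟙` of an element of `π₂` of `Out`, as an automorphism. -/
def unitComponentIso (η : BiPiTwo (outUnit h)) : 𝟙_ C ≅ 𝟙_ C where
  hom := unitComponent h η
  inv := unitComponent h η⁻¹
  hom_inv_id := NatTrans.congr_app (congrArg (fun f => Bimod.Hom₂.nat f.hom) η.hom_inv_id) (𝟙_ C)
  inv_hom_id := NatTrans.congr_app (congrArg (fun f => Bimod.Hom₂.nat f.hom) η.inv_hom_id) (𝟙_ C)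

/-- The map `π₂(Out) → π₁(Inv)` given by evaluation at the unit object. -/
def piTwoHom : BiPiTwo (outUnit h) →* PiOne (InvCat C) :=
  MonoidHom.mk' (fun η => InvCat.isoMk (unitComponentIso h η)) fun η η' =>
    InvCat.iso_ext (by rfl)

theorem piTwoHom_spec (η : BiPiTwo (outUnit h)) :
    (InvCat.iso (piTwoHom h η).hom).hom = unitComponent h η := rfl

/-- Left linearity forces the component at X to be X tensored with the component at 𝟙. -/
theorem unitComponent_injective : Function.Injective (unitComponent h) := by
  have key (η : BiPiTwo (outUnit h)) (X : C) :
      (Bimod.Hom₂.nat η.hom.hom).app X = (ρ_ X).inv ≫ X ◁ unitComponent h η ≫ (ρ_ X).hom := by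
    let a (X : C) : X ⟶ X := (Bimod.Hom₂.nat η.hom.hom).app X
    have h₁ : 𝟙 _ ≫ a (X ⊗ 𝟙_ C) = X ◁ a (𝟙_ C) ≫ 𝟙 _ :=
      Bimod.Hom₂.left η.hom.hom X (𝟙_ C : C)
    have h₂ : (ρ_ X).hom ≫ a X = a (X ⊗ 𝟙_ C) ≫ (ρ_ X).hom :=
      (Bimod.Hom₂.nat η.hom.hom).naturality (ρ_ X).hom
    change a X = (ρ_ X).inv ≫ X ◁ a (𝟙_ C) ≫ (ρ_ X).hom
    rw [Category.id_comp, Category.comp_id] at h₁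
    rw [← h₁, ← h₂, Iso.inv_hom_id_assoc]
  intro η η' hη
  refine Iso.ext (Bicategory.InducedBicategory.hom₂_ext (Bimod.hom₂_ext fun X => ?_))
  let g (X : C) (f : 𝟙_ C ⟶ 𝟙_ C) : X ⟶ X := (ρ_ X).inv ≫ X ◁ f ≫ (ρ_ X).hom
  exact (key η X).trans ((congrArg (g X) hη).trans (key η' X).symm)

/-- The automorphism of the identity bimodule functor given by a scalar. -/
def scalarPiTwo (c : ℂˣ) : BiPiTwo (outUnit h) :=
  Bicategory.InducedBicategory.isoMk (Bimod.isoMk (F := Bimod.idHom (regular C))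
    (G := Bimod.idHom (regular C))
    (NatIso.ofComponents (F := 𝟭 C) (G := 𝟭 C) (fun X => scalarIso X c)
      (fun {X Y} f => by simp [scalarIso]))
    (fun X (m : C) => by
      change 𝟙 (X ⊗ m) ≫ ((c : ℂ) • 𝟙 (X ⊗ m)) = X ◁ ((c : ℂ) • 𝟙 m) ≫ 𝟙 _
      simp)
    (fun (m : C) Y => by
      change 𝟙 (m ⊗ Y) ≫ ((c : ℂ) • 𝟙 (m ⊗ Y)) = ((c : ℂ) • 𝟙 m) ▷ Y ≫ 𝟙 _
      simp))

/-- Surjectivity: every automorphism of 𝟙 is a scalar, and scalars act on the identity functor by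
bimodule transformations. -/
theorem piTwoHom_bijective : Function.Bijective (piTwoHom h) := by
  refine ⟨fun η η' hη => unitComponent_injective h ?_, fun φ => ?_⟩
  · exact congrArg (fun φ : PiOne (InvCat C) => (InvCat.iso φ.hom).hom) hη
  · obtain ⟨c, rfl⟩ := scalarHom_bijective.2 φ
    exact ⟨scalarPiTwo h c, InvCat.iso_ext rfl⟩

end PiOneMaps
end OuterSequence
end

noncomputable section

namespace OuterSequence

/-! ### The group `π₁` of `Out` -/

section PiOneOut

open scoped MonoidalLeftAction MonoidalRightAction

variable {C : Type u} [Category.{v} C] [Abelian C] [Linear ℂ C] [MonoidalCategory C]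
  [MonoidalPreadditive C] [MonoidalLinear ℂ C]

/-- Naturality of θ along the components of θ'. It reconciles the product of automorphisms, which
reverses composition, with the composition of bimodule functors. -/
theorem aut_id_mul_comm (θ θ' : Aut (𝟙_ (TensorEnd C))) : θ * θ' = θ' * θ :=
  autComponent_ext fun X => (autComponent_natural θ (autComponent θ' X))

variable [IsFiniteSemisimple C]

theorem nonempty_twistHom_refl :
    Nonempty (twistHom (Iso.refl (𝟙_ (TensorEnd C))) ≅ 𝟙 (regular C)) :=
  ⟨Bimod.isoMk (F := twistHom (Iso.refl (𝟙_ (TensorEnd C)))) (G := Bimod.idHom (regular C))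
    (Iso.refl (𝟭 C))
    (fun X (m : C) => by
      change 𝟙 (X ⊗ m) ≫ 𝟙 (X ⊗ m) = X ◁ 𝟙 m ≫ 𝟙 (X ⊗ m)
      simp)
    (fun (m : C) Y => by
      change m ◁ 𝟙 Y ≫ 𝟙 (m ⊗ Y) = 𝟙 m ▷ Y ≫ 𝟙 (m ⊗ Y)
      simp)⟩

theorem nonempty_twistHom_trans (θ θ' : 𝟙_ (TensorEnd C) ≅ 𝟙_ (TensorEnd C)) :
    Nonempty (twistHom (θ ≪≫ θ') ≅ twistHom θ ≫ twistHom θ') :=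
  ⟨Bimod.isoMk (F := twistHom (θ ≪≫ θ')) (G := Bimod.compHom (twistHom θ) (twistHom θ'))
    (Iso.refl (𝟭 C))
    (fun X (m : C) => by
      change 𝟙 (X ⊗ m) ≫ 𝟙 (X ⊗ m) = X ◁ 𝟙 m ≫ 𝟙 (X ⊗ m) ≫ 𝟙 (X ⊗ m)
      simp)
    (fun (m : C) Y => by
      let a (θ : 𝟙_ (TensorEnd C) ≅ 𝟙_ (TensorEnd C)) : Y ⟶ Y := θ.inv.nat.app Y
      change m ◁ (a θ' ≫ a θ) ≫ 𝟙 (m ⊗ Y) = 𝟙 m ▷ Y ≫ m ◁ a θ' ≫ m ◁ a θ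
      simp)⟩

variable (h : IsOuter (regular C))

/-- The map `π₁(Eq) → π₁(Out)` given by the bimodule functors `M_θ`. -/
def twistPiOne : PiOne (EqCat C) →* BiPiOne (outUnit h) :=
  MonoidHom.toHomUnits
    { toFun := fun θ => toSkeleton (C := EndMonoidal (outUnit h))
        (Bicategory.InducedBicategory.mkHom (twistHom (piOneEqEquiv C θ)))
      map_one' := toSkeleton_eq_toSkeleton_iff.2
        (nonempty_twistHom_refl.map Bicategory.InducedBicategory.isoMk)
      map_mul' := fun θ θ' => by
        rw [map_mul, aut_id_mul_comm]
        refine Eq.trans ?_ (Skeleton.toSkeleton_tensorObj (C := EndMonoidal (outUnit h)) _ _)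
        exact toSkeleton_eq_toSkeleton_iff.2 ((nonempty_twistHom_trans (piOneEqEquiv C θ)
          (piOneEqEquiv C θ')).map Bicategory.InducedBicategory.isoMk) }

theorem twistPiOne_spec (θ : PiOne (EqCat C)) :
    IsOutClass h (twistPiOne h θ) (twistHom (EqCat.iso θ.hom)) := rfl

/-- The forgetful functor preserves tensor products and the unit, so it carries an inverse in the
center to one in C. -/
theorem isInvertible_fst_of_eq_toSkeleton {z : Center C} {φ : (Skeleton (Center C))ˣ}
    (hz : φ = toSkeleton z) : IsInvertible z.1 := by
  obtain ⟨w, ⟨e⟩, ⟨e'⟩⟩ := isInvertible_of_units φ hz.symm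
  exact ⟨w.1, ⟨(Center.forget C).mapIso e⟩, ⟨(Center.forget C).mapIso e'⟩⟩

variable (C) in
/-- Isomorphism classes of invertible objects are invertible isomorphism classes. -/
def piZeroInvEquiv : PiZero (InvCat C) ≃* InvGroup C :=
  coreUnitsEquiv (P := IsInvertible (D := C)) (fun _ hX => hX)

/-- The map on isomorphism classes given by the forgetful functor. -/
def centerForgetHom : Skeleton (Center C) →* Skeleton C :=
  skeletonHom (fun z : Center C => z.1) (fun _ _ e => ⟨(Center.forget C).mapIso e⟩)
    ⟨Iso.refl _⟩ (fun _ _ => ⟨Iso.refl _⟩)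

/-- The map from invertible objects of the Drinfeld center to invertible objects given by the
forgetful functor. -/
def centerForgetUnits : InvGroup (Center C) →* PiZero (InvCat C) :=
  (piZeroInvEquiv C).symm.toMonoidHom.comp
    (Units.map centerForgetHom)

theorem centerForgetUnits_spec (u : InvGroup (Center C)) {z : Center C} (hz : u = toSkeleton z)
    (hz' : IsInvertible z.1) :
    centerForgetUnits u = toSkeleton (C := InvCat C) ⟨⟨z.1, hz'⟩⟩ := by
  refine (MulEquiv.symm_apply_eq (piZeroInvEquiv C)).2 (Units.ext ?_)
  change centerForgetHom (u : Skeleton (Center C)) = toSkeleton z.1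
  rw [hz]
  rfl

/-- Classes of bimodule auto-equivalences are classes of invertible objects of the Drinfeld
center. -/
def piOneOutEquiv : BiPiOne (outUnit h) ≃* InvGroup (Center C) :=
  Units.mapEquiv (centerMulEquivOut h).symm

theorem piOneOutEquiv_spec {φ : BiPiOne (outUnit h)} {F : regular C ⟶ regular C}
    (hF : IsOutClass h φ F) :
    (piOneOutEquiv h φ : Skeleton (Center C)) = toSkeleton (TwistHom.frame F).center := by
  refine (MulEquiv.symm_apply_eq _).2 (Eq.trans hF (toSkeleton_eq_toSkeleton_iff.2 ?_))
  exact ⟨Bicategory.InducedBicategory.isoMk (TwistHom.frameIso F).symm⟩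

/-- The map `π₁(Out) → π₀(Inv)` given by evaluation at the unit object. -/
def piOneOutHom : BiPiOne (outUnit h) →* PiZero (InvCat C) :=
  centerForgetUnits.comp (piOneOutEquiv h).toMonoidHom

theorem piOneOutHom_center (φ : BiPiOne (outUnit h)) (z : Center C)
    (hz : (piOneOutEquiv h φ : Skeleton (Center C)) = toSkeleton z) :
    ∃ hz : IsInvertible z.1, piOneOutHom h φ = toSkeleton (C := InvCat C) ⟨⟨z.1, hz⟩⟩ :=
  have hz' := isInvertible_fst_of_eq_toSkeleton hz
  ⟨hz', centerForgetUnits_spec _ hz hz'⟩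

theorem piOneOutHom_spec (φ : BiPiOne (outUnit h)) (F : regular C ⟶ regular C)
    (hF : IsOutClass h φ F) : ∃ hg : IsInvertible (unitImage F),
      piOneOutHom h φ = toSkeleton (C := InvCat C) ⟨⟨unitImage F, hg⟩⟩ :=
  piOneOutHom_center h φ _ (piOneOutEquiv_spec h hF)

/-- The groups `π₁` of `Out` and `BrPic` agree. -/
def piOneOutBrPicEquiv : BiPiOne (outUnit h) ≃* BiPiOne (brPicUnit h.isInvertible) :=
  (piOneOutEquiv h).trans (Units.mapEquiv (centerMulEquivBrPic h.isInvertible))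

theorem piOneOutBrPicEquiv_spec (φ : BiPiOne (outUnit h)) (F : regular C ⟶ regular C)
    (hF : IsOutClass h φ F) : IsBrPicClass h.isInvertible (piOneOutBrPicEquiv h φ) F := by
  refine (congrArg (centerMulEquivBrPic h.isInvertible) (piOneOutEquiv_spec h hF)).trans
    (toSkeleton_eq_toSkeleton_iff.2 ?_)
  exact ⟨Bicategory.InducedBicategory.isoMk (TwistHom.frameIso F)⟩

/-- The functor M_θ is the identity on objects and so fixes 𝟙. Conversely, a bimodule functor whose
value at 𝟙 is isomorphic to 𝟙 is some M_θ, by `exists_iso_twistHom`. -/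
theorem twistPiOne_range : (twistPiOne h).range = (piOneOutHom h).ker := by
  ext φ
  rw [MonoidHom.mem_ker]
  constructor
  · rintro ⟨θ, rfl⟩
    obtain ⟨hg, h₁⟩ := piOneOutHom_spec h _ _ (twistPiOne_spec h θ)
    exact h₁
  · intro hφ
    obtain ⟨F, hF⟩ := exists_toSkeleton_eq (D := EndMonoidal (outUnit h)) φ.val
    obtain ⟨hg, h₁⟩ := piOneOutHom_spec h φ F.hom hF.symm
    obtain ⟨e⟩ := nonempty_iso_core_iff.1 (toSkeleton_eq_toSkeleton_iff.1 (h₁.symm.trans hφ))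
    obtain ⟨θ, ⟨i⟩⟩ := exists_iso_twistHom F.hom e
    refine ⟨(piOneEqEquiv C).symm θ, Units.ext (Eq.trans ?_ hF)⟩
    exact toSkeleton_eq_toSkeleton_iff.2 ⟨Bicategory.InducedBicategory.isoMk i⟩

end PiOneOut

/-! ### Injectivity of π₁(Eq) → π₁(Out) -/

section Injective

open scoped MonoidalLeftAction MonoidalRightAction

variable {C : Type u} [Category.{v} C] [Abelian C] [Linear ℂ C] [MonoidalCategory C]
  [MonoidalPreadditive C] [MonoidalLinear ℂ C] [RigidCategory C] [IsFusionCategory C]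

/-- An isomorphism from M_θ to the identity is a scalar at the simple object 𝟙, hence the same
scalar everywhere by left linearity. Right linearity then forces θ⁻¹ to be trivial. -/
theorem twistPiOne_injective (h : IsOuter (regular C)) : Function.Injective (twistPiOne h) := by
  refine (injective_iff_map_eq_one _).2 fun θ hθ => (piOneEqEquiv C).injective ?_
  obtain ⟨i⟩ := toSkeleton_eq_toSkeleton_iff.1 (congrArg Units.val hθ)
  let t := (piOneEqEquiv C θ)
  let a (X : C) : X ⟶ X := (Bimod.Hom₂.nat i.hom.hom).app X
  let b (X : C) : X ⟶ X := (Bimod.Hom₂.nat i.inv.hom).app X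
  have hab : a (𝟙_ C) ≫ b (𝟙_ C) = 𝟙 (𝟙_ C) :=
    NatTrans.congr_app (congrArg (fun f => Bimod.Hom₂.nat f.hom) i.hom_inv_id) (𝟙_ C)
  have nat {X Y : C} (f : X ⟶ Y) : f ≫ a Y = a X ≫ f :=
    (Bimod.Hom₂.nat i.hom.hom).naturality f
  have left (X m : C) : 𝟙 _ ≫ a (X ⊗ m) = X ◁ a m ≫ 𝟙 _ := Bimod.Hom₂.left i.hom.hom X (m : C)
  have right (m Y : C) : m ◁ autComponent t⁻¹ Y ≫ a (m ⊗ Y) = a m ▷ Y ≫ 𝟙 _ :=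
    Bimod.Hom₂.right i.hom.hom (m : C) Y
  obtain ⟨c, hc⟩ := exists_smul_of_simple (a (𝟙_ C))
  have h₀ : c ≠ 0 := by
    rintro rfl
    refine id_nonzero (𝟙_ C) ?_
    rw [← hab, ← hc, zero_smul, zero_comp]
  have ha (X : C) : a X = c • 𝟙 X := by
    have h₁ := left X (𝟙_ C)
    rw [Category.id_comp, Category.comp_id, ← hc] at h₁
    rw [← cancel_epi (ρ_ X).hom, nat, h₁]
    simp
  have ht (Y : C) : autComponent t⁻¹ Y = 𝟙 Y := by
    have h₁ := right (𝟙_ C) Y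
    rw [ha, ha, Category.comp_id] at h₁
    simp only [Linear.comp_smul, Category.comp_id, MonoidalLinear.smul_whiskerRight,
      id_whiskerRight] at h₁
    have h₂ := smul_right_injective _ h₀ h₁
    rw [← cancel_epi (λ_ Y).hom, ← MonoidalCategory.leftUnitor_naturality, h₂]
    simp
  have h₁ : t⁻¹ = 1 := autComponent_ext ht
  rw [map_one]
  exact inv_eq_one.1 h₁

end Injective
end OuterSequence
end

noncomputable section

namespace OuterSequence

/-! ### The group `π₀` of `Out` -/

section PiZeroOut

variable {C : Type u} [Category.{v} C] [Abelian C] [Linear ℂ C] [MonoidalCategory C]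
  [MonoidalPreadditive C] [MonoidalLinear ℂ C]

variable (C) in
/-- Isomorphism classes of tensor auto-equivalences are invertible classes of tensor
endofunctors. -/
def piZeroEqEquiv : PiZero (EqCat C) ≃* EqGroup C :=
  coreUnitsEquiv (P := TensorEnd.IsAutoEquiv (C := C))
    (fun _ hF => TensorEnd.isAutoEquiv_of_isInvertible hF)

section

variable [IsFiniteSemisimple C]

theorem EqCat.isOuter_twist (F : EqCat C) : IsOuter (twist F.tensorEnd) :=
  OuterSequence.isOuter_twist F.of.property

theorem outMk_twist_congr {F G : EqCat C} (e : F.tensorEnd ≅ G.tensorEnd) :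
    outMk (twist F.tensorEnd) F.isOuter_twist = outMk (twist G.tensorEnd) G.isOuter_twist :=
  outMk_eq_of_frame ((twistFrame G.tensorEnd).congr e.symm) _ _

/-- The map on isomorphism classes given by `F ↦ M_F`. -/
def outClass : PiZero (EqCat C) → BiPiZero (OutBicat C) :=
  Quotient.lift (fun F : EqCat C => outMk (twist F.tensorEnd) F.isOuter_twist)
    (fun _ _ e => outMk_twist_congr (nonempty_iso_core_iff.1 e).some)

/-- The class of a relative tensor product. -/
theorem outMk_eq_of_isRelTensor {M N P : Bimod C} (hP : IsOuter P) (h : IsRelTensor M N P)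
    {F G : EqCat C} (φ : Frame M F.tensorEnd) (ψ : Frame N G.tensorEnd) [φ.IsGenerating]
    [ψ.IsGenerating] : outMk P hP = outClass (toSkeleton F * toSkeleton G) := by
  obtain ⟨B, hB⟩ := h
  have := prodFrame_isGenerating φ ψ B hB
  rw [← Skeleton.toSkeleton_tensorObj]
  exact (outMk_eq_of_frame (B.prodFrame ψ φ) (F ⊗ G).isOuter_twist hP).symm

/-- The class of `F` determines the class of `M_F` under tensor products. -/
theorem outClass_mul_congr {x x' y y' : PiZero (EqCat C)} (hx : outClass x = outClass x')
    (hy : outClass y = outClass y') : outClass (x * y) = outClass (x' * y') := by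
  obtain ⟨F, rfl⟩ := exists_toSkeleton_eq x
  obtain ⟨F', rfl⟩ := exists_toSkeleton_eq x'
  obtain ⟨G, rfl⟩ := exists_toSkeleton_eq y
  obtain ⟨G', rfl⟩ := exists_toSkeleton_eq y'
  obtain ⟨Φ, hΦ⟩ := (outMk_eq_iff _ _).1 hx
  obtain ⟨Ψ, hΨ⟩ := (outMk_eq_iff _ _).1 hy
  -- One relative tensor product of M_{F'} and M_{G'} is used for both classes: the equivalences Φ
  -- and Ψ give its factors frames over F and G in addition to the tautological ones.
  have h := isRelTensor_of_frames (twistFrame F'.tensorEnd) (twistFrame G'.tensorEnd)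
    (Iso.refl (F'.tensorEnd ⊗ G'.tensorEnd))
  have hP := (F' ⊗ G').isOuter_twist
  exact (outMk_eq_of_isRelTensor hP h (TwistHom.frame Φ) (TwistHom.frame Ψ)).symm.trans
    (outMk_eq_of_isRelTensor hP h (twistFrame F'.tensorEnd) (twistFrame G'.tensorEnd))

end

/-! ### Classes of M_F modulo conjugation -/

section Conj

variable [RigidCategory C] [IsFusionCategory C]

/-- The unit object of the regular bimodule carries the conjugation frame as well as the
tautological one. -/
theorem nonempty_conjTensorEnd_unit (hu : IsInvertible (𝟙_ C)) :
    Nonempty (conjTensorEnd hu ≅ 𝟙_ (TensorEnd C)) :=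
  let ⟨e⟩ := (conjFrame hu (𝟙_ (TensorEnd C))).nonempty_iso_of_eq (twistFrame (𝟙_ (TensorEnd C))) rfl
  ⟨(ρ_ _).symm ≪≫ e⟩

variable (C) in
/-- The map `π₀(Inv) → π₀(Eq)` induced by conjugation. -/
def conjPiZero : PiZero (InvCat C) →* PiZero (EqCat C) :=
  skeletonHom (conj C).obj (fun _ _ e => ⟨(conj C).mapIso e⟩)
    ((nonempty_conjTensorEnd_unit (𝟙_ (InvCat C)).property).map EqCat.isoMk)
    (fun g h => (nonempty_conjTensorEnd_tensor g.property h.property (g ⊗ h).property).map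
      EqCat.isoMk)

theorem conjPiZero_toSkeleton (g : InvCat C) :
    conjPiZero C (toSkeleton g) = toSkeleton ((conj C).obj g) := rfl

theorem outClass_eq_iff (x y : PiZero (EqCat C)) :
    outClass x = outClass y ↔ ∃ g, conjPiZero C g * y = x := by
  obtain ⟨F, rfl⟩ := exists_toSkeleton_eq x
  obtain ⟨G, rfl⟩ := exists_toSkeleton_eq y
  refine (outMk_eq_iff _ _).trans (exists_equivalence_twist_iff.trans ⟨?_, ?_⟩)
  · rintro ⟨g, hg, ⟨e⟩⟩
    refine ⟨toSkeleton (C := InvCat C) ⟨⟨g, hg⟩⟩, ?_⟩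
    rw [conjPiZero_toSkeleton, ← Skeleton.toSkeleton_tensorObj]
    exact toSkeleton_eq_toSkeleton_iff.2 ⟨EqCat.isoMk e⟩
  · rintro ⟨g, hg⟩
    obtain ⟨g, rfl⟩ := exists_toSkeleton_eq g
    rw [conjPiZero_toSkeleton, ← Skeleton.toSkeleton_tensorObj] at hg
    exact ⟨g.toObj, g.property, nonempty_iso_core_iff.1 (toSkeleton_eq_toSkeleton_iff.1 hg)⟩

theorem outClass_eq_one_iff (x : PiZero (EqCat C)) :
    outClass x = outClass 1 ↔ x ∈ (conjPiZero C).range := by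
  simp only [outClass_eq_iff, mul_one, MonoidHom.mem_range]

theorem outClass_surjective : Function.Surjective (outClass (C := C)) := by
  rintro ⟨M, hM⟩
  obtain ⟨F, φ, hF, hφ⟩ := hM.exists_frame
  let F' : EqCat C := ⟨⟨F, hF⟩⟩
  exact ⟨toSkeleton F', outMk_eq_of_frame φ F'.isOuter_twist hM⟩

/-- The conjugations form the fibre of F ↦ [M_F] over the unit class, and the class of a product
depends only on the classes of the factors. So x n x⁻¹ has the class of x x⁻¹, and the identity F ∘
F_g ∘ F⁻¹ ≅ F_{F(g)} is not needed. -/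
instance : (conjPiZero C).range.Normal where
  conj_mem n hn x := by
    rw [← outClass_eq_one_iff] at hn ⊢
    have h := outClass_mul_congr (outClass_mul_congr (Eq.refl (outClass x)) hn)
      (Eq.refl (outClass x⁻¹))
    rwa [mul_one, mul_inv_cancel] at h

theorem outClass_eq_iff_mk_eq (x y : PiZero (EqCat C)) : outClass x = outClass y ↔
    (x : PiZero (EqCat C) ⧸ (conjPiZero C).range) = y := by
  rw [outClass_eq_iff, QuotientGroup.eq_iff_div_mem, MonoidHom.mem_range]
  simp only [eq_div_iff_mul_eq']

variable (C) in
/-- The classes of outer bimodule categories as a quotient group. -/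
def outClassEquiv : PiZero (EqCat C) ⧸ (conjPiZero C).range ≃ BiPiZero (OutBicat C) :=
  Equiv.ofBijective
    (Quotient.lift outClass fun x y h => (outClass_eq_iff_mk_eq x y).2 (Quotient.sound h))
    ⟨fun x y h => by
      obtain ⟨x, rfl⟩ := QuotientGroup.mk_surjective x
      obtain ⟨y, rfl⟩ := QuotientGroup.mk_surjective y
      exact (outClass_eq_iff_mk_eq x y).1 h,
    fun z => by
      obtain ⟨x, rfl⟩ := outClass_surjective z
      exact ⟨x, rfl⟩⟩

variable (C) in
/-- The group structure on the classes of outer bimodule categories. -/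
@[reducible] def outGroup : Group (BiPiZero (OutBicat C)) :=
  (outClassEquiv C).symm.group

variable (C) in
/-- The classes of outer bimodule categories as a quotient group. -/
def outClassMulEquiv :
    letI := outGroup C
    PiZero (EqCat C) ⧸ (conjPiZero C).range ≃* BiPiZero (OutBicat C) :=
  letI := outGroup C
  MulEquiv.symm { (outClassEquiv C).symm with
    map_mul' := fun _ _ => (outClassEquiv C).symm_apply_apply _ }

variable (C) in
/-- The homomorphism `π₀(Eq) → π₀(Out)` given by `F ↦ M_F`. -/
def outHom :
    letI := outGroup C
    PiZero (EqCat C) →* BiPiZero (OutBicat C) :=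
  letI := outGroup C
  (outClassMulEquiv C).toMonoidHom.comp (QuotientGroup.mk' _)

theorem outHom_apply (x : PiZero (EqCat C)) : outHom C x = outClass x := rfl

/-- Frames identify M and N with M_F and M_G. Then M_{F ∘ G} is a relative tensor product, and any
other one has the same class because it carries a generating frame over F ∘ G. -/
theorem isTensorProductLaw_outGroup : IsTensorProductLaw (outGroup C) := by
  intro M N hM hN
  obtain ⟨F, φ, hF, hφ⟩ := hM.exists_frame
  obtain ⟨G, ψ, hG, hψ⟩ := hN.exists_frame
  let F' : EqCat C := ⟨⟨F, hF⟩⟩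
  let G' : EqCat C := ⟨⟨G, hG⟩⟩
  refine ⟨⟨twist (F ⊗ G), (F' ⊗ G').isOuter_twist, isRelTensor_of_frames φ ψ (Iso.refl _)⟩,
    fun P hP h => ?_⟩
  rw [outMk_eq_of_isRelTensor (F := F') (G := G') hP h φ ψ,
    ← outMk_eq_of_frame φ F'.isOuter_twist hM, ← outMk_eq_of_frame ψ G'.isOuter_twist hN]
  let := outGroup C
  exact ((outHom C).map_mul (toSkeleton F') (toSkeleton G')).symm

theorem map_conjPiZero_range :
    ((conjPiZero C).range.map (piZeroEqEquiv C).toMonoidHom : Set (EqGroup C)) = innerSet C := by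
  ext x
  constructor
  · rintro ⟨_, ⟨g, rfl⟩, rfl⟩
    obtain ⟨g, rfl⟩ := exists_toSkeleton_eq g
    exact ⟨g, rfl⟩
  · rintro ⟨g, hg⟩
    exact ⟨_, ⟨toSkeleton g, rfl⟩, Units.ext hg.symm⟩

/-- The inner classes already form a normal subgroup, the image of the conjugations. -/
theorem normalClosure_innerSet : Subgroup.normalClosure (innerSet C) =
    (conjPiZero C).range.map (piZeroEqEquiv C).toMonoidHom := by
  have : ((conjPiZero C).range.map (piZeroEqEquiv C).toMonoidHom).Normal :=
    Subgroup.Normal.map inferInstance _ (piZeroEqEquiv C).surjective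
  rw [← map_conjPiZero_range]
  exact Subgroup.normalClosure_eq_self _

variable (C) in
/-- The quotient of the tensor auto-equivalences by the conjugations. -/
def outGroupEquiv : PiZero (EqCat C) ⧸ (conjPiZero C).range ≃* OutGroup C :=
  QuotientGroup.congr _ _ (piZeroEqEquiv C) normalClosure_innerSet.symm

theorem exists_isOutClass (h : IsOuter (regular C)) (Φ : Bimod.Hom (regular C) (regular C))
    [Φ.functor.IsEquivalence] : ∃ φ : BiPiOne (outUnit h), IsOutClass h φ Φ := by
  let k (Ψ : Bimod.Hom (regular C) (regular C)) : Skeleton (EndMonoidal (outUnit h)) :=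
    toSkeleton (C := EndMonoidal (outUnit h)) (Bicategory.InducedBicategory.mkHom Ψ)
  have hk (Ψ Ψ' : Bimod.Hom (regular C) (regular C))
      (e : Bimod.compHom Ψ Ψ' ≅ Bimod.idHom (regular C)) : k Ψ * k Ψ' = 1 := by
    refine (Skeleton.toSkeleton_tensorObj (C := EndMonoidal (outUnit h)) _ _).symm.trans ?_
    exact toSkeleton_eq_toSkeleton_iff.2 ⟨Bicategory.InducedBicategory.isoMk e⟩
  exact ⟨⟨k Φ, k (Bimod.invHom Φ), hk _ _ (Bimod.homInvIso Φ), hk _ _ (Bimod.invHomIso Φ)⟩, rfl⟩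

theorem IsOutClass.isEquivalence {h : IsOuter (regular C)} {φ : BiPiOne (outUnit h)}
    {Φ : Bimod.Hom (regular C) (regular C)} (hΦ : IsOutClass h φ Φ) :
    Φ.functor.IsEquivalence := by
  obtain ⟨Ψ, ⟨e⟩, ⟨e'⟩⟩ := isInvertible_of_units (D := EndMonoidal (outUnit h)) φ hΦ.symm
  exact Bimod.isEquivalence_of_iso_id Φ (Ψ := Ψ.hom)
    ((Bicategory.InducedBicategory.forget (C := Bimod C)).mapFunctor _ _ |>.mapIso e)
    ((Bicategory.InducedBicategory.forget (C := Bimod C)).mapFunctor _ _ |>.mapIso e')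

/-- If g ≅ Φ(𝟙) for a bimodule endofunctor Φ, then g carries a frame over the identity besides its
conjugation frame, so F_g ≅ id. Conversely F_g ≅ id turns the conjugation frame into a bimodule
auto-equivalence with value 𝟙 ⊗ g at 𝟙. -/
theorem piOneOutHom_range (h : IsOuter (regular C)) :
    (piOneOutHom h).range = (conjPiZero C).ker := by
  ext x
  obtain ⟨g, rfl⟩ := exists_toSkeleton_eq x
  rw [MonoidHom.mem_ker, conjPiZero_toSkeleton]
  constructor
  · rintro ⟨φ, hφ⟩
    obtain ⟨F, hF⟩ := exists_toSkeleton_eq (D := EndMonoidal (outUnit h)) φ.val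
    have hF' : IsOutClass h φ F.hom := hF.symm
    obtain ⟨hg, h₁⟩ := piOneOutHom_spec h φ F.hom hF'
    obtain ⟨i⟩ := nonempty_iso_core_iff.1 (toSkeleton_eq_toSkeleton_iff.1 (hφ.symm.trans h₁))
    have := hF'.isEquivalence
    obtain ⟨e⟩ := (conjFrame g.property (𝟙_ (TensorEnd C))).nonempty_iso
      (TwistHom.frame F.hom) i
    exact toSkeleton_eq_toSkeleton_iff.2 ⟨EqCat.isoMk ((ρ_ _).symm ≪≫ e)⟩
  · intro hg
    obtain ⟨e⟩ := nonempty_iso_core_iff.1 (toSkeleton_eq_toSkeleton_iff.1 hg)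
    let Φ := ((conjFrame g.property (𝟙_ (TensorEnd C))).congr (ρ_ _ ≪≫ e)).toHom
    obtain ⟨φ, hφ⟩ := exists_isOutClass h Φ
    obtain ⟨hg, h₁⟩ := piOneOutHom_spec h φ Φ hφ
    exact ⟨φ, h₁.trans (toSkeleton_eq_toSkeleton_iff.2 ⟨InvCat.isoMk (λ_ g.toObj)⟩)⟩

theorem outHom_ker :
    letI := outGroup C
    (conjPiZero C).range = (outHom C).ker := by
  let := outGroup C
  ext x
  rw [MonoidHom.mem_ker, ← outClass_eq_one_iff, outHom_apply, ← map_one (outHom C), outHom_apply]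

end Conj
end PiZeroOut
end OuterSequence
end

theorem mainTheorem6 {C : Type u} [Category.{v} C] [Abelian C] [Linear ℂ C] [MonoidalCategory C]
    [MonoidalPreadditive C] [MonoidalLinear ℂ C] [RigidCategory C] [IsFusionCategory C] :
    -- the regular bimodule category and all `M_F` are objects of `Out`
    ∃ (h : IsOuter (regular C)) (hM : ∀ F : EqCat C, IsOuter (twist F.tensorEnd))
      -- `π₀` of `Out` is a group under the relative tensor product
      (G : Group (BiPiZero (OutBicat C))) (_ : IsTensorProductLaw G)
      -- the maps of the long exact sequence
      (δ₂ : BiPiTwo (outUnit h) →* PiOne (InvCat C))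
      (f₁ : PiOne (InvCat C) →* PiOne (EqCat C))
      (m₁ : PiOne (EqCat C) →* BiPiOne (outUnit h))
      (δ₁ : BiPiOne (outUnit h) →* PiZero (InvCat C))
      (f₀ : PiZero (InvCat C) →* PiZero (EqCat C))
      (m₀ : PiZero (EqCat C) →* BiPiZero (OutBicat C)),
      -- `f₁`, `f₀` are induced by `g ↦ F_g`, `m₁`, `m₀` by `F ↦ M_F`, and the connecting maps
      -- `δ₂`, `δ₁` are evaluation at the unit object
      ((∀ η, (InvCat.iso (δ₂ η).hom).hom = unitComponent h η) ∧
        (∃ ι : 𝟙_ (EqCat C) ≅ (conj C).obj (𝟙_ (InvCat C)),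
          ∀ φ, f₁ φ = ι ≪≫ (conj C).mapIso φ ≪≫ ι.symm) ∧
        (∀ θ, IsOutClass h (m₁ θ) (twistHom (EqCat.iso θ.hom))) ∧
        (∀ φ F, IsOutClass h φ F →
          ∃ hg : IsInvertible (unitImage F), δ₁ φ = toSkeleton (C := InvCat C) ⟨⟨unitImage F, hg⟩⟩) ∧
        (∀ g : InvCat C, f₀ (toSkeleton g) = toSkeleton ((conj C).obj g)) ∧
        (∀ F : EqCat C, m₀ (toSkeleton F) = outMk (twist F.tensorEnd) (hM F))) ∧
      -- exactness
      (Function.Injective δ₂ ∧ δ₂.range = f₁.ker ∧ f₁.range = m₁.ker ∧ m₁.range = δ₁.ker ∧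
        δ₁.range = f₀.ker ∧ f₀.range = m₀.ker ∧ Function.Surjective m₀) ∧
      -- identification of the terms
      (∃ e : BiPiTwo (outUnit h) ≃* PiOne (InvCat C), ∀ η, e η = δ₂ η) ∧
      (∃ e : PiOne (InvCat C) ≃* ℂˣ, ∀ φ, (InvCat.iso φ.hom).hom = (e φ : ℂ) • 𝟙 (𝟙_ C)) ∧
      (∃ e : PiOne (EqCat C) ≃* Aut (𝟙_ (TensorEnd C)),
        ∀ θ X, (e θ).hom.nat.app X = idComponent θ X) ∧
      (∃ e : PiOne (EqCat C) ≃* (UGroup C →* ℂˣ),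
        ∀ θ (X : C) (hX : Simple X),
          idComponent θ X = (e θ (PresentedGroup.of (simpleClass X hX)) : ℂ) • 𝟙 X) ∧
      (∃ e : BiPiOne (outUnit h) ≃* BiPiOne (brPicUnit h.isInvertible),
        ∀ φ F, IsOutClass h φ F → IsBrPicClass h.isInvertible (e φ) F) ∧
      (∃ e : BiPiOne (outUnit h) ≃* InvGroup (Center C),
        ∀ φ (z : Center C), (e φ : Skeleton (Center C)) = toSkeleton z →
          ∃ hz : IsInvertible z.1, δ₁ φ = toSkeleton (C := InvCat C) ⟨⟨z.1, hz⟩⟩) ∧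
      (∃ e : PiZero (InvCat C) ≃* InvGroup C,
        ∀ g : InvCat C, (e (toSkeleton g) : Skeleton C) = toSkeleton g.toObj) ∧
      (∃ e : PiZero (EqCat C) ≃* EqGroup C,
        (∀ F : EqCat C, (e (toSkeleton F) : Skeleton (TensorEnd C)) = toSkeleton F.tensorEnd) ∧
        (Subgroup.normalClosure (innerSet C) : Set (EqGroup C)) = innerSet C ∧
        ∃ e' : BiPiZero (OutBicat C) ≃* OutGroup C,
          ∀ x, e' (m₀ x) = QuotientGroup.mk (e x)) := by
  let := outGroup C
  -- F_𝟙 ≅ id, extracted from the fact that conjugation preserves the identity class; any choice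
  -- gives the same trivial map on π₁.
  obtain ⟨ι⟩ := toSkeleton_eq_toSkeleton_iff.1 (map_one (conjPiZero C)).symm
  refine ⟨isOuter_regular C, EqCat.isOuter_twist, outGroup C, isTensorProductLaw_outGroup,
    piTwoHom _, conjPiOne ι, twistPiOne _, piOneOutHom _, conjPiZero C, outHom C,
    ⟨piTwoHom_spec _, ⟨ι, fun _ => rfl⟩, twistPiOne_spec _, piOneOutHom_spec _, fun _ => rfl,
      fun _ => rfl⟩,
    ⟨(piTwoHom_bijective _).1, ?_, ?_, twistPiOne_range _, piOneOutHom_range _, outHom_ker,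
      outClass_surjective⟩,
    ⟨MulEquiv.ofBijective _ (piTwoHom_bijective _), fun _ => rfl⟩,
    ⟨piOneInvEquiv C, piOneInvEquiv_spec⟩,
    ⟨piOneEqEquiv C, fun _ _ => rfl⟩,
    ⟨(piOneEqEquiv C).trans autEquivCharacter, fun θ => autEquivCharacter_spec (piOneEqEquiv C θ)⟩,
    ⟨piOneOutBrPicEquiv _, piOneOutBrPicEquiv_spec _⟩,
    ⟨piOneOutEquiv _, piOneOutHom_center _⟩,
    ⟨piZeroInvEquiv C, fun _ => rfl⟩,
    ⟨piZeroEqEquiv C, fun _ => rfl, ?_, (outClassMulEquiv C).symm.trans (outGroupEquiv C), ?_⟩⟩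
  -- Exactness at π₁(Inv): δ₂ is onto and f₁ is trivial.
  · rw [MonoidHom.range_eq_top.2 (piTwoHom_bijective _).2]
    exact ((MonoidHom.ker_eq_top_iff).2 (MonoidHom.ext (conjPiOne_apply ι))).symm
  -- Exactness at π₁(Eq): f₁ is trivial and m₁ is injective.
  · rw [(MonoidHom.ker_eq_bot_iff _).2 (twistPiOne_injective _)]
    exact MonoidHom.range_eq_bot_iff.2 (MonoidHom.ext (conjPiOne_apply ι))
  · rw [normalClosure_innerSet, map_conjPiZero_range]
  · intro x
    exact congrArg (outGroupEquiv C) ((outClassMulEquiv C).symm_apply_apply (QuotientGroup.mk x))
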